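/- **Setting.** Let $\mathcal A$ be a finite non-empty action set, $\mathcal S\subseteq\mathbb R^d$ an unbounded state space, $p(\cdot\mid s,a)$ a Markov transition kernel, $R:\mathcal S\times\mathcal A\to[0,R_{\max}]$ a reward function with $R_{\max}>0$, $\gamma\in(0,1)$, and $V_{\max}=R_{\max}/(1-\gamma)$. Let $V^*(s)=\sup_\pi\mathbb E_\pi[\sum_{t\ge0}\gamma^tR(s_t,a_t)\mid s_0=s]$ (supremum over stationary randomized policies), $Q^*(s,a)=R(s,a)+\gamma\,\mathbb E[V^*(s_1)\mid s_0=s,a_0=a]$, $\mathcal A^*(s)=\arg\max_aQ^*(s,a)$, and let $\pi^*(\cdot\mid s)$ be uniform on $\mathcal A^*(s)$. Let $\Delta_{\min}=\inf_s\big(\max_aQ^*(s,a)-\max_{a\notin\mathcal A^*(s)}Q^*(s,a)\big)$, with $\max\emptyset=-\infty$, and assume $\Delta_{\min}>0$. Assume that there are $\nu,\nu',B,\alpha>0$ and a function $L:\mathcal S\to\mathbb R_+$ with $L(s)\to\infty$ as $\|s\|_2\to\infty$ and $\sup\{\|s\|_2:L(s)\le\ell\}<\infty$ for all finite $\ell$,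 such that $|L(s')-L(s)|\le\nu$ and $\|s'-s\|_2\le\nu'$ for all $s,a$ and all possible next states $s'$ under $p(\cdot\mid s,a)$, and $\mathbb E_{\pi^*}[L(s_{t+1})-L(s_t)\mid s_t=s]\le-\alpha$ whenever $L(s)>B$. Assume also that $L(s)\ge c_1\|s\|_2+c_2$ for all $s$, with constants $c_1>0$ and $c_2\in\mathbb R$. Put $$\tau(\alpha)=\min\Big\{\sqrt{\tfrac{\alpha}{24\nu}},\ \tfrac{1-\gamma}{8R_{\max}},\ \tfrac{(1-\gamma)\alpha}{48R_{\max}|\mathcal A|^2\nu},\ \tfrac{\Delta_{\min}}{\ln(24\nu|\mathcal A|/\alpha)}\Big\},\qquad \delta(\alpha)=\tau(\alpha)^2,$$ the last term being $\infty$ if $\Delta_{\min}=\infty$. **Oracles.** For $\delta\in(0,1]$ let $H=H(\delta)=\max\{1,\lceil\log_\gamma\delta\rceil\}$, and let $C=C(\delta)$ be a positive integer. (a) The *sparse sampling oracle* at $s$ builds a tree of depth $H$ with root $s$ by sampling, at every node $x$ of depth less than $H$ and for every action $a$, $C$ fresh independent next states from $p(\cdot\mid x,a)$ as children. Leaves get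 the value $0$, and values are backed up by $\hat Q(x,a)=R(x,a)+\frac{\gamma}{C}\sum_{x'}\hat V(x')$ (sum over the $C$ children of $x$ under $a$) and $\hat V(x)=\max_a\hat Q(x,a)$. The oracle returns $(\hat Q(s,a))_{a}$ at the root. Here it is required that $$C\ge\frac{2\gamma^2}{\delta^2(1-\gamma)^2}\Big(2H\log\frac{2\gamma^2|\mathcal A|H}{\delta^2(1-\gamma)^2}+\log\frac2\delta\Big).$$ (b) The *modified oracle* is used when $\mathcal S=\mathbb R^d$ with $d\ge1$ and $V^*$ is $\zeta$-Lipschitz for $\|\cdot\|_2$, $\zeta>0$. It is the same, except that every sampled next state is replaced by its closest point in the grid $\varepsilon\mathbb Z^d$, $\varepsilon=\frac{\delta V_{\max}(1-\gamma)}{2\zeta\gamma\sqrt d}$, and that within one call of the oracle next states are sampled only once for each pair of a state and an action, and are reused whenever the state occurs again. Here it is required that $$C\ge c_0\,\frac{\gamma^2}{(1-\gamma)^2\delta^2}\Big(\log\frac{2|\mathcal A|}\delta+d\log H+d\log^+\frac1\varepsilon\Big).$$ **Adaptive scheme.** Fix any norm $\|\cdot\|$ on $\mathbb R^d$. Start at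 any $s_0\in\mathcal S$ with $\delta_0=1$. At each time $t\ge0$, call the oracle at $s_t$ with parameter $\delta_t$ and fresh samples, draw $a_t$ with probabilities proportional to $e^{\hat Q(s_t,a)/\tau_t}$, where $\tau_t=\sqrt{\delta_t}$, and draw $s_{t+1}\sim p(\cdot\mid s_t,a_t)$. Set $\delta_{t+1}=\delta_t/2$ if $\|s_t\|\ge\log^2t$, and $\delta_{t+1}=\delta_t$ otherwise (with $\log^2 0=\infty$). Say that the system is *stable from time $t_0$ with parameter $\delta$* if for each $\theta\in(0,1)$ there is a bounded set $\mathcal S(\theta)\subseteq\mathcal S$ such that the scheme run from time $t_0$ with $\delta_{t_0}=\delta$ satisfies: for every $s\in\mathcal S$, $\limsup_{t\to\infty}\mathbb P(s_t\notin\mathcal S(\theta)\mid s_{t_0}=s)\le\theta$; and, for every $s\in\mathcal S$, the expected value of $\inf\{k\ge0:s_{t+k}\in\mathcal S(\theta)\}$ given $s_t=s$ and $\delta_t=2^{-j}\delta$ is bounded uniformly in $t\ge t_0$ and integers $j\ge0$. **Theorem.** For the scheme with oracle (a), and likewise for the scheme with oracle (b), where $c_0>0$ is a suitable constant that depends only on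 $\gamma,R_{\max},|\mathcal A|,d,\nu'$, there is a finite constant $K$ such that for every $s_0\in\mathcal S$, with probability $1$, one of the following holds: 1. from some time on, $\delta_t\le\delta(\alpha)$ and the system is stable from time $t$ with parameter $\delta_t$; or 2. $\delta_t>\delta(\alpha)$ for all $t$, and $\limsup_{t\to\infty}\|s_t\|/\log^2t\le K$. Moreover, with probability $1$, $\liminf_{t\to\infty}\delta_t>0$. -/

import Mathlib

open MeasureTheory ProbabilityTheory Filter Set
open scoped ENNReal

noncomputable section

namespace AdaptiveRL

/-! ### General probabilistic constructions -/

section General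

variable {X Y : Type*} [MeasurableSpace X] [MeasurableSpace Y]

/-- The law, given `x`, of a family `(Y j)` of independent random variables with `Y j ∼ κ j x`. -/
def kernelPi {J : Type*} [Fintype J] (κ : J → Kernel X Y) [∀ j, IsMarkovKernel (κ j)] :
    Kernel X (J → Y) where
  toFun x := Measure.pi fun j => κ j x
  measurable' := by
    refine Measurable.measure_of_isPiSystem_of_isProbabilityMeasure
      generateFrom_pi.symm (isPiSystem_pi (α := fun _ : J => Y)) ?_
    rintro s ⟨t, ht, rfl⟩
    have ht' : ∀ j, MeasurableSet (t j) := fun j => ht j (mem_univ j)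
    simp only [Measure.pi_pi]
    exact Finset.measurable_prod _ fun j _ => (κ j).measurable_coe (ht' j)

instance {J : Type*} [Fintype J] (κ : J → Kernel X Y) [∀ j, IsMarkovKernel (κ j)] :
    IsMarkovKernel (kernelPi κ) :=
  ⟨fun x => inferInstanceAs (IsProbabilityMeasure (Measure.pi fun j => κ j x))⟩

/-- The law of the trajectory `(y₀, y₁, …)` of the time-inhomogeneous Markov chain that starts at
`y₀ = y` and whose transition from time `n` to time `n + 1` is governed by `κ n`. -/
def pathLaw (κ : ℕ → Kernel Y Y) [∀ n, IsMarkovKernel (κ n)] : Kernel Y (ℕ → Y) :=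
  (Kernel.traj (X := fun _ => Y)
    (fun n => (κ n).comap (fun h : Finset.Iic n → Y => h ⟨n, Finset.mem_Iic.2 le_rfl⟩)
      (measurable_pi_apply _)) 0).comap
    (fun y _ => y) (measurable_pi_lambda _ fun _ => measurable_id)

/-- The first time at which a trajectory visits `B` (`∞` if it never does). -/
def hitTime (B : Set Y) (ω : ℕ → Y) : ℝ≥0∞ := ⨅ (n : ℕ) (_ : ω n ∈ B), (n : ℝ≥0∞)

/-- A measurable family of kernels indexed by `ℕ`, seen as a kernel from `X × ℕ`. -/
def kernelSwitch (κ : ℕ → Kernel X Y) : Kernel (X × ℕ) Y where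
  toFun p := κ p.2 p.1
  measurable' := measurable_from_prod_countable_left fun k => (κ k).measurable

instance (κ : ℕ → Kernel X Y) [∀ n, IsMarkovKernel (κ n)] : IsMarkovKernel (kernelSwitch κ) :=
  ⟨fun p => inferInstanceAs (IsProbabilityMeasure (κ p.2 p.1))⟩

end General

/-- The maximum of a vector indexed by a finite set. -/
def maxA {A : Type*} [Fintype A] [Nonempty A] (q : A → ℝ) : ℝ :=
  Finset.univ.sup' Finset.univ_nonempty q

lemma measurable_maxA {A : Type*} [Fintype A] [Nonempty A] : Measurable (maxA (A := A)) := by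
  have : (maxA (A := A)) = Finset.univ.sup' Finset.univ_nonempty fun a (q : A → ℝ) => q a := by
    ext q; simp [maxA, Finset.sup'_apply]
  rw [this]
  exact Finset.measurable_sup' _ fun a _ => measurable_pi_apply a

/-- Every norm on `ℝᵈ` is a measurable function. -/
lemma measurable_seminorm {d : ℕ} (N : Seminorm ℝ (EuclideanSpace ℝ (Fin d))) :
    Measurable fun x => N x :=
  (continuousOn_univ.1 (N.convexOn.continuousOn isOpen_univ)).measurable

/-! ### The update of the parameter -/

/-- The `k`-th value `2⁻ᵏ` of the parameter `δ`. -/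
def dyadic (k : ℕ) : ℝ := (1 / 2 : ℝ) ^ k

open Classical in
/-- The update of the parameter at time `t`, in terms of the index `k` with `δₜ = 2⁻ᵏ`: `δ` is
halved if and only if `‖sₜ‖ ≥ log² t` (at `t = 0`, where `log² t = ∞`, it is kept). -/
def nextIndex {X : Type*} (size : X → ℝ) (t : ℕ) (p : X × ℕ) : ℕ :=
  if t ≠ 0 ∧ Real.log t ^ 2 ≤ size p.1 then p.2 + 1 else p.2

lemma measurable_nextIndex {X : Type*} [MeasurableSpace X] {size : X → ℝ} (hsize : Measurable size) (t : ℕ) :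
    Measurable (nextIndex size t) := by
  classical
  refine Measurable.ite ?_ (measurable_snd.add_const 1) measurable_snd
  exact (MeasurableSet.const _).inter
    (measurableSet_le measurable_const (hsize.comp measurable_fst))

/-! ### Markov decision processes -/

/-- A discounted Markov decision process with state space `X` and action space `A`: transition
kernel `P`, reward function `R` with values in `[0, Rmax]`, discount factor `γ ∈ (0, 1)`. -/
structure MDP (X A : Type*) [MeasurableSpace X] [MeasurableSpace A] where
  P : Kernel (X × A) X
  markov : IsMarkovKernel P
  R : X × A → ℝ
  measurable_R : Measurable R
  γ : ℝ
  γ_pos : 0 < γ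
  γ_lt_one : γ < 1
  Rmax : ℝ
  Rmax_pos : 0 < Rmax
  R_nonneg : ∀ z, 0 ≤ R z
  R_le : ∀ z, R z ≤ Rmax

attribute [instance] MDP.markov

namespace MDP

variable {X A : Type*} [MeasurableSpace X] [MeasurableSpace A] (M : MDP X A)

/-- `Vmax = Rmax / (1 - γ)`. -/
def Vmax : ℝ := M.Rmax / (1 - M.γ)

/-- The law of the state-action trajectory `(s₀, a₀), (s₁, a₁), …` under the stationary
randomized policy `π`, as a function of `s₀`. -/
def playLaw (π : Kernel X A) [IsMarkovKernel π] : Kernel X (ℕ → X × A) :=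
  pathLaw (fun _ => (Kernel.id ×ₖ π) ∘ₖ M.P) ∘ₖ (Kernel.id ×ₖ π)

/-- The value function `V^π(s) = E_π[∑ₜ γᵗ R(sₜ, aₜ) | s₀ = s]`. -/
def value (π : Kernel X A) [IsMarkovKernel π] (s : X) : ℝ :=
  ∫ ω, ∑' t : ℕ, M.γ ^ t * M.R (ω t) ∂(M.playLaw π s)

/-- The optimal value function `V*(s) = sup_π V^π(s)`, over all stationary policies. -/
def optValue (s : X) : ℝ :=
  ⨆ π : {π : Kernel X A // IsMarkovKernel π}, haveI := π.2; M.value π.1 s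

/-- `Q*(s, a) = E[R(s₀, a₀) + γ V*(s₁) | s₀ = s, a₀ = a]`. -/
def optQ (s : X) (a : A) : ℝ := M.R (s, a) + M.γ * ∫ s', M.optValue s' ∂(M.P (s, a))

/-- The one-step transition kernel of the states under the randomized policy `π`. -/
def closedLoop (π : Kernel X A) : Kernel X X := M.P ∘ₖ (Kernel.id ×ₖ π)

instance (π : Kernel X A) [IsMarkovKernel π] : IsMarkovKernel (M.closedLoop π) :=
  inferInstanceAs (IsMarkovKernel (M.P ∘ₖ (Kernel.id ×ₖ π)))

section Finite

variable [Fintype A]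

open Classical in
/-- `A*(s) = argmax_a Q*(s, a)`. -/
def optActions (s : X) : Finset A := Finset.univ.filter fun a => ∀ b, M.optQ s b ≤ M.optQ s a

open Classical in
/-- The optimal policy that breaks ties uniformly: `π*(a | s) = 1 / |A*(s)|` on `A*(s)`. -/
def optPolicy (s : X) (a : A) : ℝ :=
  if a ∈ M.optActions s then 1 / ((M.optActions s).card : ℝ) else 0

/-- `Δ_min(s) = max_a Q*(s, a) - max_{a ∉ A*(s)} Q*(s, a)`, where a maximum over the empty set is
`-∞`, so that `Δ_min(s) = ∞` if all the actions are optimal in `s`. -/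
def gap (s : X) : EReal :=
  (⨆ a : A, (M.optQ s a : EReal)) - ⨆ a ∈ {a : A | a ∉ M.optActions s}, (M.optQ s a : EReal)

/-- `Δ_min = inf_s Δ_min(s)`. -/
def minGap : EReal := ⨅ s : X, M.gap s

/-- The threshold `τ(α)`. If `Δ_min = ∞`, the last term of the minimum is `∞`. -/
def tauThreshold (ν α : ℝ) : ℝ :=
  (min
    ((min (Real.sqrt (α / (24 * ν)))
      (min ((1 - M.γ) / (8 * M.Rmax))
        ((1 - M.γ) * α / (48 * M.Rmax * (Fintype.card A : ℝ) ^ 2 * ν))) : ℝ) : EReal)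
    (M.minGap / ((Real.log (24 * ν * (Fintype.card A : ℝ) / α) : ℝ) : EReal))).toReal

/-- The threshold `δ(α) = τ(α)²`. -/
def deltaThreshold (ν α : ℝ) : ℝ := M.tauThreshold ν α ^ 2

end Finite

/-! ### Sampling oracles

An oracle is a kernel from states `s` to the (random) vectors `(Q̂(s, a))_a`. -/

/-- The depth `H = ⌈log_γ δ⌉` of the sampling tree (a positive integer, hence `1` for `δ = 1`). -/
def depth (δ : ℝ) : ℕ := max 1 ⌈Real.logb M.γ δ⌉₊

/-- The backed-up values `R(x, a) + γ C⁻¹ ∑ᵢ w(a, i)` at a node `x`, where `w(a, i)` is the value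
estimate of its `i`-th child under the action `a`. -/
def backup {C : ℕ} (x : X) (w : A × Fin C → ℝ) (a : A) : ℝ :=
  M.R (x, a) + M.γ * ((C : ℝ)⁻¹ * ∑ i, w (a, i))

lemma measurable_backup {Ω : Type*} [MeasurableSpace Ω] {C : ℕ} {f : Ω → X}
    {w : Ω → A × Fin C → ℝ} (hf : Measurable f) (hw : Measurable w) :
    Measurable fun z => M.backup (f z) (w z) := by
  refine measurable_pi_lambda _ fun a => ?_
  have h1 : Measurable fun z => ∑ i, w z (a, i) :=
    Finset.measurable_sum _ fun i _ => (measurable_pi_apply _).comp hw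
  exact (M.measurable_R.comp (hf.prodMk measurable_const)).add ((h1.const_mul _).const_mul _)

section Sparse

variable [Fintype A] [Nonempty A] [DiscreteMeasurableSpace A]

/-- The law of the root estimates `(Q̂(s, a))_a` when, for each action, `C` next states are sampled
from the root and the (independent) value estimates of these children have the law `v`. -/
def sparseStep (C : ℕ) (v : Kernel X ℝ) [IsMarkovKernel v] : Kernel X (A → ℝ) :=
  (Kernel.id ×ₖ kernelPi fun j : A × Fin C =>
    (v ∘ₖ M.P).comap (fun s => (s, j.1)) (measurable_id.prodMk measurable_const)).map
    fun p => M.backup p.1 p.2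

instance (C : ℕ) (v : Kernel X ℝ) [IsMarkovKernel v] : IsMarkovKernel (M.sparseStep C v) :=
  Kernel.IsMarkovKernel.map _ (M.measurable_backup measurable_fst measurable_snd)

/-- The law of the value estimate of a node of the sampling tree that has `h` levels below it
(the leaves, with `h = 0`, have the value `0`). -/
def sparseValue (C : ℕ) : ℕ → {v : Kernel X ℝ // IsMarkovKernel v}
  | 0 => ⟨Kernel.const X (Measure.dirac 0), inferInstance⟩
  | h + 1 =>
    haveI := (sparseValue C h).2
    ⟨(M.sparseStep C (sparseValue C h).1).map maxA, Kernel.IsMarkovKernel.map _ measurable_maxA⟩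

/-- The sparse sampling Monte Carlo oracle with `C` samples per node and action and depth `H`. -/
def sparseOracle (C H : ℕ) : Kernel X (A → ℝ) :=
  haveI := (M.sparseValue C (H - 1)).2
  M.sparseStep C (M.sparseValue C (H - 1)).1

instance (C H : ℕ) : IsMarkovKernel (M.sparseOracle C H) :=
  haveI := (M.sparseValue C (H - 1)).2
  inferInstanceAs (IsMarkovKernel (M.sparseStep C (M.sparseValue C (H - 1)).1))

/-- The number of samples per node and action for the sparse sampling oracle. -/
def sparseC (δ : ℝ) : ℝ :=
  2 * M.γ ^ 2 / (δ ^ 2 * (1 - M.γ) ^ 2) *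
    (2 * M.depth δ *
        Real.log (2 * M.γ ^ 2 * (Fintype.card A : ℝ) * M.depth δ / (δ ^ 2 * (1 - M.γ) ^ 2)) +
      Real.log (2 / δ))

/-! ### The Boltzmann policy and the adaptive scheme -/

/-- The Boltzmann distribution with weights proportional to `exp (q a / τ)`. -/
def boltzmann (τ : ℝ) : Kernel (A → ℝ) A where
  toFun q := ∑ a, ENNReal.ofReal (Real.exp (q a / τ) / ∑ b, Real.exp (q b / τ)) • Measure.dirac a
  measurable' := by
    refine Measure.measurable_of_measurable_coe _ fun s hs => ?_
    simp only [Measure.coe_finsetSum, Finset.sum_apply, Measure.smul_apply, smul_eq_mul]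
    refine Finset.measurable_sum _ fun a _ => Measurable.mul_const ?_ _
    fun_prop

instance (τ : ℝ) : IsMarkovKernel (boltzmann (A := A) τ) := by
  refine ⟨fun q => ⟨?_⟩⟩
  have hpos : 0 < ∑ b, Real.exp (q b / τ) :=
    Finset.sum_pos (fun _ _ => Real.exp_pos _) Finset.univ_nonempty
  change (∑ a, ENNReal.ofReal (Real.exp (q a / τ) / ∑ b, Real.exp (q b / τ)) • Measure.dirac a)
    univ = 1
  simp only [Measure.coe_finsetSum, Finset.sum_apply, Measure.smul_apply, smul_eq_mul,
    measure_univ, mul_one]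
  rw [← ENNReal.ofReal_sum_of_nonneg fun a _ => by positivity, ← Finset.sum_div,
    div_self hpos.ne', ENNReal.ofReal_one]

/-- The transition of `(sₜ, k)`, `δₜ = 2⁻ᵏ`, at time `t` under the adaptive scheme: a fresh call of
the oracle with parameter `δₜ` at `sₜ`, an action drawn from the Boltzmann distribution of the
outcome with `τ = √δₜ`, a transition of the MDP, and the update of the parameter. -/
def adaptiveStep (oracle : ℕ → Kernel X (A → ℝ)) {size : X → ℝ} (hsize : Measurable size) (t : ℕ) :
    Kernel (X × ℕ) (X × ℕ) :=
  kernelSwitch (fun k => M.closedLoop (boltzmann (Real.sqrt (dyadic k)) ∘ₖ oracle k)) ×ₖ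
    Kernel.deterministic (nextIndex size t) (measurable_nextIndex hsize t)

instance (oracle : ℕ → Kernel X (A → ℝ)) [∀ k, IsMarkovKernel (oracle k)] {size : X → ℝ}
    (hsize : Measurable size) (t : ℕ) : IsMarkovKernel (M.adaptiveStep oracle hsize t) := by
  unfold adaptiveStep; infer_instance

/-- The law of the trajectory of the adaptive scheme that is at `(s, k)` at time `t₀`; the entry
`n` of the trajectory is the pair of the state and of the parameter index at time `t₀ + n`. -/
def adaptiveLaw (oracle : ℕ → Kernel X (A → ℝ)) [∀ k, IsMarkovKernel (oracle k)] {size : X → ℝ}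
    (hsize : Measurable size) (t₀ : ℕ) : Kernel (X × ℕ) (ℕ → X × ℕ) :=
  pathLaw fun n => M.adaptiveStep oracle hsize (t₀ + n)

/-- Stability of the (time-varying, online) policy that the adaptive scheme follows from time `t₀`
on when its parameter is `2⁻ᵏ` at time `t₀`. In the recurrence property the conditioning on `sₜ = s`
is made uniform over the values `2⁻ʲ`, `j ≥ k`, that the parameter may have at time `t`. -/
def StableFrom {E : Type*} [NormedAddCommGroup E] (pos : X → E)
    (oracle : ℕ → Kernel X (A → ℝ)) [∀ k, IsMarkovKernel (oracle k)] {size : X → ℝ}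
    (hsize : Measurable size) (t₀ k : ℕ) : Prop :=
  ∀ θ ∈ Ioo (0 : ℝ) 1, ∃ B : Set X, MeasurableSet B ∧ Bornology.IsBounded (pos '' B) ∧
    (∀ s : X, limsup (fun n => M.adaptiveLaw oracle hsize t₀ (s, k) {ω | (ω n).1 ∉ B}) atTop
      ≤ ENNReal.ofReal θ) ∧
    (∀ s : X, (⨆ (t : ℕ) (_ : t₀ ≤ t) (j : ℕ) (_ : k ≤ j),
      ∫⁻ ω, hitTime (Prod.fst ⁻¹' B) ω ∂(M.adaptiveLaw oracle hsize t (s, j))) < ∞)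

/-- The guarantee for the adaptive scheme started at `s₀` at time `0` with `δ₀ = 1`. -/
def AdaptiveGuarantee {E : Type*} [NormedAddCommGroup E] (pos : X → E)
    (oracle : ℕ → Kernel X (A → ℝ)) [∀ k, IsMarkovKernel (oracle k)] {size : X → ℝ}
    (hsize : Measurable size) (δα K : ℝ) (s₀ : X) : Prop :=
  ∀ᵐ ω ∂(M.adaptiveLaw oracle hsize 0 (s₀, 0)),
    ((∃ G : ℕ, ∀ t ≥ G, dyadic (ω t).2 ≤ δα ∧ M.StableFrom pos oracle hsize t (ω t).2) ∨
      ((∀ t, δα < dyadic (ω t).2) ∧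
        limsup (fun t : ℕ => ((size (ω t).1 / Real.log t ^ 2 : ℝ) : EReal)) atTop ≤ (K : EReal))) ∧
    0 < liminf (fun t => dyadic (ω t).2) atTop

/-- `L` is a Lyapunov function for the chain of the optimal policy, with bounded increments
(`ν`, `ν'`) and drift `-α` above the level `B`; `pos s` is the state `s` as a vector. The next
states that are possible from `s` under `a` are almost all points for `P(· | s, a)`. -/
structure IsLyapunov {E : Type*} [NormedAddCommGroup E] (pos : X → E)
    (L : X → ℝ) (ν ν' B α : ℝ) : Prop where
  measurable : Measurable L
  nonneg : ∀ s, 0 ≤ L s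
  tendsto : Tendsto L (comap (fun s => ‖pos s‖) atTop) atTop
  bdd : ∀ ℓ : ℝ, BddAbove ((fun s => ‖pos s‖) '' {s | L s ≤ ℓ})
  ν_pos : 0 < ν
  ν'_pos : 0 < ν'
  B_pos : 0 < B
  α_pos : 0 < α
  increment : ∀ s a, ∀ᵐ s' ∂(M.P (s, a)), |L s' - L s| ≤ ν ∧ ‖pos s' - pos s‖ ≤ ν'
  drift : ∀ s, B < L s →
    ∑ a, M.optPolicy s a * ∫ s', (L s' - L s) ∂(M.P (s, a)) ≤ -α

end Sparse

end MDP

/-! ### The sample-efficient oracle on `ℝᵈ` -/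

section Grid

variable {d : ℕ}

/-- The point `(k₁ ε, …, k_d ε)` of the grid. -/
def gridPoint (ε : ℝ) (k : Fin d → ℤ) : EuclideanSpace ℝ (Fin d) :=
  WithLp.toLp 2 fun i => (k i : ℝ) * ε

/-- The index of the point of the grid that is closest to `x`. -/
def gridIndex (ε : ℝ) (x : EuclideanSpace ℝ (Fin d)) : Fin d → ℤ := fun i => round (x i / ε)

lemma measurable_gridIndex (ε : ℝ) : Measurable (gridIndex (d := d) ε) := by
  refine measurable_pi_lambda _ fun i => ?_
  simp only [gridIndex, round_eq]
  refine Measurable.floor ?_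
  fun_prop

/-- The samples drawn by one call of the oracle: `C` next states for each action from each point of
the grid, and `C` next states for each action from the queried state. -/
abbrev Samples (d : ℕ) (A : Type*) (C : ℕ) : Type _ :=
  ((Fin d → ℤ) × (A × Fin C) → EuclideanSpace ℝ (Fin d)) × (A × Fin C → EuclideanSpace ℝ (Fin d))

open Classical in
/-- The next states that were sampled from the grid point of index `k`. Each state is sampled
once, however often it occurs in the tree; in particular the samples from the queried state `s` are
used again if `s` is a point of the grid. -/
def nodeSamples {A : Type*} {C : ℕ} (ε : ℝ) (s : EuclideanSpace ℝ (Fin d)) (ξ : Samples d A C)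
    (k : Fin d → ℤ) : A × Fin C → EuclideanSpace ℝ (Fin d) :=
  if gridPoint ε k = s then ξ.2 else fun j => ξ.1 (k, j)

lemma measurable_nodeSamples {A : Type*} {C : ℕ} (ε : ℝ) (k : Fin d → ℤ) :
    Measurable fun p : EuclideanSpace ℝ (Fin d) × Samples d A C => nodeSamples ε p.1 p.2 k := by
  classical
  unfold nodeSamples
  refine Measurable.ite (measurableSet_eq_fun measurable_const measurable_fst) ?_ ?_ <;> fun_prop

namespace MDP

variable {A : Type*} [MeasurableSpace A] [Fintype A] [Nonempty A] [DiscreteMeasurableSpace A]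
  (M : MDP (EuclideanSpace ℝ (Fin d)) A)

/-- The value estimate of the grid point of index `k` when it occurs with `h` levels below it. -/
def gridValue {C : ℕ} (ε : ℝ) (s : EuclideanSpace ℝ (Fin d)) (ξ : Samples d A C) :
    ℕ → (Fin d → ℤ) → ℝ
  | 0, _ => 0
  | h + 1, k => maxA (M.backup (gridPoint ε k)
      fun j => gridValue ε s ξ h (gridIndex ε (nodeSamples ε s ξ k j)))

/-- The estimates `(Q̂(s, a))_a` obtained from the samples with a tree of depth `H`. -/
def gridQ {C : ℕ} (ε : ℝ) (H : ℕ) (s : EuclideanSpace ℝ (Fin d)) (ξ : Samples d A C) : A → ℝ :=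
  M.backup s fun j => M.gridValue ε s ξ (H - 1) (gridIndex ε (ξ.2 j))

lemma measurable_gridValue {C : ℕ} (ε : ℝ) (h : ℕ) (k : Fin d → ℤ) :
    Measurable fun p : EuclideanSpace ℝ (Fin d) × Samples d A C =>
      M.gridValue ε p.1 p.2 h k := by
  induction h generalizing k with
  | zero => simp only [gridValue]; exact measurable_const
  | succ h ih =>
    simp only [gridValue]
    refine measurable_maxA.comp (M.measurable_backup measurable_const
      (measurable_pi_lambda _ fun j => ?_))
    have h1 : Measurable fun z : (EuclideanSpace ℝ (Fin d) × Samples d A C) × (Fin d → ℤ) =>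
        M.gridValue ε z.1.1 z.1.2 h z.2 := measurable_from_prod_countable_left ih
    exact h1.comp (measurable_id.prodMk ((measurable_gridIndex ε).comp
      ((measurable_pi_apply j).comp (measurable_nodeSamples ε k))))

lemma measurable_gridQ {C : ℕ} (ε : ℝ) (H : ℕ) :
    Measurable fun p : EuclideanSpace ℝ (Fin d) × Samples d A C => M.gridQ ε H p.1 p.2 := by
  refine M.measurable_backup measurable_fst (measurable_pi_lambda _ fun j => ?_)
  have h1 : Measurable fun z : (EuclideanSpace ℝ (Fin d) × Samples d A C) × (Fin d → ℤ) =>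
      M.gridValue ε z.1.1 z.1.2 (H - 1) z.2 :=
    measurable_from_prod_countable_left (M.measurable_gridValue ε (H - 1))
  exact h1.comp (measurable_id.prodMk ((measurable_gridIndex ε).comp (by fun_prop)))

/-- The law of the samples of one call at `s`: all the sampled next states are independent. -/
def samplesLaw (C : ℕ) (ε : ℝ) : Kernel (EuclideanSpace ℝ (Fin d)) (Samples d A C) :=
  Kernel.const _ (Measure.infinitePi fun z : (Fin d → ℤ) × (A × Fin C) =>
      M.P (gridPoint ε z.1, z.2.1)) ×ₖ
    kernelPi fun j : A × Fin C =>
      M.P.comap (fun s => (s, j.1)) (measurable_id.prodMk measurable_const)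

instance (C : ℕ) (ε : ℝ) : IsMarkovKernel (M.samplesLaw C ε) := by
  unfold samplesLaw; infer_instance

/-- The sample-efficient sparse sampling oracle with `C` samples per node and action, grid size
`ε` and depth `H`. -/
def gridOracle (C : ℕ) (ε : ℝ) (H : ℕ) : Kernel (EuclideanSpace ℝ (Fin d)) (A → ℝ) :=
  (Kernel.id ×ₖ M.samplesLaw C ε).map fun p => M.gridQ ε H p.1 p.2

instance (C : ℕ) (ε : ℝ) (H : ℕ) : IsMarkovKernel (M.gridOracle C ε H) :=
  Kernel.IsMarkovKernel.map _ (M.measurable_gridQ ε H)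

/-- The grid size `ε = δ Vmax (1 - γ) / (2 ζ γ √d)`. -/
def gridSize (ζ δ : ℝ) : ℝ :=
  δ * M.Vmax * (1 - M.γ) / (2 * ζ * M.γ * Real.sqrt d)

/-- The order of magnitude of the number of samples per node and action. -/
def gridC (ζ δ : ℝ) : ℝ :=
  M.γ ^ 2 / ((1 - M.γ) ^ 2 * δ ^ 2) *
    (Real.log (2 * (Fintype.card A : ℝ) / δ) + d * Real.log (M.depth δ) +
      d * max 0 (Real.log (1 / M.gridSize ζ δ)))

end MDP

end Grid

end AdaptiveRL

end

set_option linter.unusedSectionVars false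

noncomputable section

namespace AdaptiveRL

/-! ### Markov chains -/

section Chain

variable {Y : Type*} [MeasurableSpace Y] (κ : ℕ → Kernel Y Y) [∀ n, IsMarkovKernel (κ n)]

/-! Everything rests on one property of an oracle: at parameter `δ` its expected sup-norm error as
an estimate of `Q*` is at most `4 δ Vmax`, uniformly in the state. `adaptiveGuarantee` derives the
dichotomy from this alone, and the two oracles are then checked separately.

Suppose `τ = √δ` is below the threshold. The Boltzmann map is `4/τ`-Lipschitz from the sup norm to
the `ℓ¹` norm, so an error of order `τ²` moves the policy by only order `τ` on average; the positive
gap makes the Boltzmann distribution of the exact `Q*` close to the uniform one on the optimal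
actions. Hence at least half of the drift `-α` of `L` survives (`lintegral_closedLoop_le_of_drift`).
Since `L` has bounded increments, a second-order expansion turns this into geometric drift of `exp
(η L)`. The geometric drift gives bounded exponential moments and tightness, and the drift of `L`
itself gives hitting times bounded by `2 L(s) / α` (`stableFrom`).

The parameter is nonincreasing along every trajectory. If it ever becomes small, the exponential
moments and the linear growth of `L` make the probability that `‖s_t‖ ≥ log² t` at most of order
`exp (-a log² t)`, which is summable; by Borel-Cantelli there are finitely many further halvings
(`ae_eventually_size_lt`). If it never becomes small, it takes finitely many values and is
eventually constant, which means that the halving test eventually always fails, that is, `‖s_t‖ <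
log² t`; so `K = 1` works. In both cases the parameter stabilizes at a positive value.

For the tree oracle the subtrees below different children are independent, so sample means
concentrate around the mean of the child estimates; only the bias of these has to be propagated, and
it obeys a `γ`-contraction (`sparseValue_bias`). No union bound over the tree is needed. On the grid
the reused samples destroy this independence; instead Hoeffding's inequality is applied to the fixed
function `V*` at every grid point that can be reached, and bounded increments confine these to a box
whose cardinality is bounded uniformly in the state (`lintegral_gridOracle_le`).

Both arguments use that `V*`, defined as a supremum over policies, is measurable and solves the
optimality equation (`optValue_spec`). -/

instance : IsMarkovKernel (pathLaw κ) := by unfold pathLaw; infer_instance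

/-- This is the Markov property in disintegrated form: the joint law of the history and the next
state is the composition product of the law of the history with the transition kernel. The other
one-step identities are special cases. -/
lemma lintegral_pathLaw_succ (y : Y) (n : ℕ) {f : (Finset.Iic n → Y) × Y → ℝ≥0∞}
    (hf : Measurable f) :
    ∫⁻ ω, f (Preorder.frestrictLe n ω, ω (n + 1)) ∂(pathLaw κ y) =
      ∫⁻ ω, ∫⁻ z, f (Preorder.frestrictLe n ω, z) ∂(κ n (ω n)) ∂(pathLaw κ y) := by
  unfold pathLaw
  simp only [Kernel.comap_apply]
  rw [← lintegral_map (f := f) (g := fun ω : ℕ → Y => (Preorder.frestrictLe n ω, ω (n + 1))) hf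
    (by fun_prop), ← Kernel.partialTraj_compProd_eq_map_traj (Nat.zero_le n),
    Measure.lintegral_compProd hf, ← Kernel.traj_map_frestrictLe_apply, lintegral_map]
  · rfl
  · exact hf.lintegral_kernel_prod_right'
  · fun_prop

lemma lintegral_pathLaw_mul_succ (y : Y) (n : ℕ) {F : (Finset.Iic n → Y) → ℝ≥0∞}
    (hF : Measurable F) {g : Y → ℝ≥0∞} (hg : Measurable g) :
    ∫⁻ ω, F (Preorder.frestrictLe n ω) * g (ω (n + 1)) ∂(pathLaw κ y) =
      ∫⁻ ω, F (Preorder.frestrictLe n ω) * ∫⁻ z, g z ∂(κ n (ω n)) ∂(pathLaw κ y) := by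
  rw [lintegral_pathLaw_succ κ y n (f := fun p => F p.1 * g p.2) (by fun_prop)]
  refine lintegral_congr fun ω => ?_
  exact lintegral_const_mul (F (Preorder.frestrictLe n ω)) hg

lemma lintegral_pathLaw_eval_succ (y : Y) (n : ℕ) {g : Y → ℝ≥0∞} (hg : Measurable g) :
    ∫⁻ ω, g (ω (n + 1)) ∂(pathLaw κ y) = ∫⁻ ω, ∫⁻ z, g z ∂(κ n (ω n)) ∂(pathLaw κ y) := by
  simpa using lintegral_pathLaw_mul_succ κ y n (F := fun _ => 1) measurable_const hg

lemma map_eval_zero_pathLaw (y : Y) :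
    (pathLaw κ y).map (fun ω => ω 0) = Measure.dirac y := by
  have h : (fun ω : ℕ → Y => ω 0) = (fun h : Finset.Iic 0 → Y => h ⟨0, Finset.mem_Iic.2 le_rfl⟩) ∘
      Preorder.frestrictLe (π := fun _ => Y) 0 := rfl
  unfold pathLaw
  rw [Kernel.comap_apply, h, ← Measure.map_map (by fun_prop) (by fun_prop),
    Kernel.traj_map_frestrictLe_apply, Kernel.partialTraj_self, Kernel.id_apply,
    Measure.map_dirac' (by fun_prop)]

lemma lintegral_pathLaw_eval_zero (y : Y) {g : Y → ℝ≥0∞} (hg : Measurable g) :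
    ∫⁻ ω, g (ω 0) ∂(pathLaw κ y) = g y := by
  rw [← lintegral_map (f := g) (g := fun ω : ℕ → Y => ω 0) hg (by fun_prop),
    map_eval_zero_pathLaw, lintegral_dirac' _ hg]

lemma ae_pathLaw_zero (y : Y) {s : Set Y} (hs : MeasurableSet s) (hy : y ∈ s) :
    ∀ᵐ ω ∂(pathLaw κ y), ω 0 ∈ s := by
  have h : ∀ᵐ z ∂((pathLaw κ y).map fun ω => ω 0), z ∈ s := by
    rw [map_eval_zero_pathLaw]; exact (ae_dirac_iff (p := fun z => z ∈ s) hs).2 hy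
  exact ae_of_ae_map (measurable_pi_apply 0).aemeasurable h

lemma ae_pathLaw_step (y : Y) (n : ℕ) {r : Set (Y × Y)} (hr : MeasurableSet r)
    (h : ∀ x, ∀ᵐ z ∂(κ n x), (x, z) ∈ r) :
    ∀ᵐ ω ∂(pathLaw κ y), (ω n, ω (n + 1)) ∈ r := by
  have hm : Measurable fun p : (Finset.Iic n → Y) × Y =>
      (p.1 ⟨n, Finset.mem_Iic.2 le_rfl⟩, p.2) := by fun_prop
  have key := lintegral_pathLaw_succ κ y n
    (f := fun p => rᶜ.indicator 1 (p.1 ⟨n, Finset.mem_Iic.2 le_rfl⟩, p.2))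
    ((measurable_one.indicator hr.compl).comp hm)
  have hz : ∫⁻ ω, ∫⁻ z, rᶜ.indicator (1 : Y × Y → ℝ≥0∞) (ω n, z) ∂(κ n (ω n)) ∂(pathLaw κ y) = 0 := by
    rw [← lintegral_zero (μ := pathLaw κ y)]
    refine lintegral_congr fun ω => ?_
    rw [← lintegral_zero (μ := κ n (ω n))]
    refine lintegral_congr_ae ?_
    filter_upwards [h (ω n)] with z hz
    simp [hz]
  have h0 : ∫⁻ ω : ℕ → Y, rᶜ.indicator (1 : Y × Y → ℝ≥0∞) (ω n, ω (n + 1)) ∂(pathLaw κ y) = 0 :=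
    key.trans hz
  have hm' : Measurable fun ω : ℕ → Y => rᶜ.indicator (1 : Y × Y → ℝ≥0∞) (ω n, ω (n + 1)) :=
    (measurable_one.indicator hr.compl).comp (by fun_prop)
  rw [lintegral_eq_zero_iff hm'] at h0
  filter_upwards [h0] with ω hω
  by_contra hc
  simp [hc] at hω

lemma ae_pathLaw_stay (y : Y) {G : Set Y} (hG : MeasurableSet G)
    (hinv : ∀ n, ∀ x ∈ G, ∀ᵐ z ∂(κ n x), z ∈ G) :
    ∀ᵐ ω ∂(pathLaw κ y), ∀ n, ω n ∈ G → ω (n + 1) ∈ G := by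
  have hr : MeasurableSet {p : Y × Y | p.1 ∈ G → p.2 ∈ G} := by
    have : {p : Y × Y | p.1 ∈ G → p.2 ∈ G} = (Prod.fst ⁻¹' G)ᶜ ∪ Prod.snd ⁻¹' G := by
      ext p; simp [imp_iff_not_or]
    rw [this]
    exact (hG.preimage measurable_fst).compl.union (hG.preimage measurable_snd)
  rw [ae_all_iff]
  refine fun n => ae_pathLaw_step κ y n hr fun x => ?_
  by_cases hx : x ∈ G
  · filter_upwards [hinv n x hx] with z hz _ using hz
  · exact Eventually.of_forall fun z h => absurd h hx

lemma ae_pathLaw_mem_of_invariant {G : Set Y} (hG : MeasurableSet G)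
    (hinv : ∀ n, ∀ x ∈ G, ∀ᵐ z ∂(κ n x), z ∈ G) {y : Y} (hy : y ∈ G) :
    ∀ᵐ ω ∂(pathLaw κ y), ∀ n, ω n ∈ G := by
  have hstep := ae_pathLaw_stay κ y hG hinv
  filter_upwards [hstep, ae_pathLaw_zero κ y hG hy] with ω h1 h0 n
  induction n with
  | zero => exact h0
  | succ n ih => exact h1 n ih

/-- A geometric drift condition bounds the expectation of `V` after time `T`, on an event that is
determined at time `T` and after which the drift condition holds. -/
lemma lintegral_pathLaw_le_of_geometric_drift (y : Y) {V : Y → ℝ≥0∞} (hV : Measurable V)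
    {G : Set Y} (hG : MeasurableSet G) (hinv : ∀ n, ∀ x ∈ G, ∀ᵐ z ∂(κ n x), z ∈ G)
    {ρ c : ℝ≥0∞} (hdrift : ∀ n, ∀ x ∈ G, ∫⁻ z, V z ∂(κ n x) ≤ ρ * V x + c) (T n : ℕ) :
    ∫⁻ ω, G.indicator 1 (ω T) * V (ω (T + n)) ∂(pathLaw κ y) ≤
      ρ ^ n * ∫⁻ ω, V (ω T) ∂(pathLaw κ y) + c * (1 - ρ)⁻¹ := by
  have hstep := ae_pathLaw_stay κ y hG hinv
  have hstay : ∀ᵐ ω ∂(pathLaw κ y), ∀ n, ω T ∈ G → ω (T + n) ∈ G := by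
    filter_upwards [hstep] with ω h n hT
    induction n with
    | zero => exact hT
    | succ n ih => exact h _ ih
  have hind : Measurable (G.indicator (1 : Y → ℝ≥0∞)) := measurable_one.indicator hG
  have key : ∀ n, ∫⁻ ω, G.indicator 1 (ω T) * V (ω (T + n)) ∂(pathLaw κ y) ≤
      ρ ^ n * ∫⁻ ω, V (ω T) ∂(pathLaw κ y) + c * ∑ i ∈ Finset.range n, ρ ^ i := by
    intro n
    induction n with
    | zero =>
      simp only [add_zero, pow_zero, one_mul, Finset.range_zero, Finset.sum_empty, mul_zero]
      refine lintegral_mono fun ω => ?_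
      refine (mul_le_mul_left (indicator_le_self' (fun _ _ => zero_le) _) _).trans ?_
      simp
    | succ n ih =>
      -- Whether `ω T` lies in `G` is determined by the history up to time `T + n`, so conditioning
      -- on that history leaves the indicator untouched.
      have h1 := lintegral_pathLaw_mul_succ κ y (T + n)
        (F := fun h => G.indicator 1 (h ⟨T, Finset.mem_Iic.2 (Nat.le_add_right T n)⟩))
        (hind.comp (measurable_pi_apply _)) hV
      have h2 : ∫⁻ ω, G.indicator 1 (ω T) * V (ω (T + (n + 1))) ∂(pathLaw κ y) =
        ∫⁻ ω, G.indicator 1 (ω T) * ∫⁻ z, V z ∂(κ (T + n) (ω (T + n))) ∂(pathLaw κ y) := h1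
      rw [h2]
      calc _ ≤ ∫⁻ ω, (ρ * (G.indicator 1 (ω T) * V (ω (T + n))) + c) ∂(pathLaw κ y) := by
            refine lintegral_mono_ae ?_
            filter_upwards [hstay] with ω hω
            by_cases hT : ω T ∈ G
            · simpa [hT] using hdrift _ _ (hω n hT)
            · simp [hT]
        _ = ρ * ∫⁻ ω, G.indicator 1 (ω T) * V (ω (T + n)) ∂(pathLaw κ y) + c := by
            rw [lintegral_add_right _ measurable_const, lintegral_const_mul]
            · simp
            · exact (hind.comp (measurable_pi_apply T)).mul (hV.comp (measurable_pi_apply _))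
        _ ≤ ρ * (ρ ^ n * ∫⁻ ω, V (ω T) ∂(pathLaw κ y) + c * ∑ i ∈ Finset.range n, ρ ^ i) + c := by
            gcongr
        _ = _ := by
            rw [Finset.sum_range_succ']
            simp only [pow_succ', ← Finset.mul_sum]
            ring
  refine (key n).trans ?_
  gcongr
  rw [← ENNReal.tsum_geometric]
  exact ENNReal.sum_le_tsum _

/-- An additive drift condition outside `B` bounds the expected hitting time of `B`. -/
lemma lintegral_hitTime_le {B : Set Y} (hB : MeasurableSet B) {f : Y → ℝ≥0∞} (hf : Measurable f)
    {G : Set Y} (hG : MeasurableSet G) (hinv : ∀ n, ∀ x ∈ G, ∀ᵐ z ∂(κ n x), z ∈ G) {β : ℝ≥0∞}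
    (hdrift : ∀ n, ∀ x ∈ G, x ∉ B → ∫⁻ z, f z ∂(κ n x) + β ≤ f x) {y : Y} (hy : y ∈ G) :
    β * ∫⁻ ω, hitTime B ω ∂(pathLaw κ y) ≤ f y := by
  -- `D n` describes the histories that avoid `B` at all times up to and including `n`; its
  -- indicator `I n` is that of the event that the hitting time exceeds `n`, so the hitting time is
  -- the sum of the `I n`.
  let D : (n : ℕ) → Set (Finset.Iic n → Y) := fun n => {h | ∀ i, h i ∉ B}
  have hD : ∀ n, MeasurableSet (D n) := fun n => by
    have : D n = ⋂ i, (fun h : Finset.Iic n → Y => h i) ⁻¹' Bᶜ := by ext; simp [D]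
    rw [this]
    exact MeasurableSet.iInter fun i => hB.compl.preimage (measurable_pi_apply i)
  let I : ℕ → (ℕ → Y) → ℝ≥0∞ := fun n ω => (D n).indicator 1 (Preorder.frestrictLe n ω)
  have hI : ∀ n, Measurable (I n) := fun n =>
    (measurable_one.indicator (hD n)).comp (by fun_prop)
  have hIeq : ∀ n ω, (∀ m ≤ n, ω m ∉ B) → I n ω = 1 := fun n ω h => by
    have : Preorder.frestrictLe n ω ∈ D n := fun i => h i (Finset.mem_Iic.1 i.2)
    simp [I, this]
  have hIzero : ∀ n ω m, m ≤ n → ω m ∈ B → I n ω = 0 := fun n ω m hm h => by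
    have : Preorder.frestrictLe n ω ∉ D n := fun h' => h' ⟨m, Finset.mem_Iic.2 hm⟩ h
    simp [I, this]
  have hIsucc : ∀ n ω, I (n + 1) ω ≤ I n ω := fun n ω => by
    by_cases h : ∀ m ≤ n, ω m ∉ B
    · rw [hIeq n ω h]
      exact indicator_le_self' (fun _ _ => zero_le) _
    · push Not at h
      obtain ⟨m, hm, hmB⟩ := h
      rw [hIzero (n + 1) ω m (hm.trans n.le_succ) hmB]
      exact zero_le
  have hhit : ∀ ω, hitTime B ω ≤ ∑' n, I n ω := fun ω => by
    by_cases h : ∀ m, ω m ∉ B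
    · have : ∀ n, I n ω = 1 := fun n => hIeq n ω fun m _ => h m
      simp [this]
    · classical
      push Not at h
      have hmin : ∀ m < Nat.find h, ω m ∉ B := fun m hm => Nat.find_min h hm
      calc hitTime B ω ≤ (Nat.find h : ℝ≥0∞) := iInf₂_le (f := fun (n : ℕ) (_ : ω n ∈ B) => (n : ℝ≥0∞)) _ (Nat.find_spec h)
        _ = ∑ n ∈ Finset.range (Nat.find h), I n ω := by
            rw [Finset.sum_congr rfl fun n hn => hIeq n ω fun m hm =>
              hmin m (hm.trans_lt (Finset.mem_range.1 hn))]
            simp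
        _ ≤ _ := ENNReal.sum_le_tsum _
  have hmem := ae_pathLaw_mem_of_invariant κ hG hinv hy
  -- On the event `I n` the drift condition applies at time `n`, so the expectation of `f` over the
  -- paths not yet stopped loses at least `β` times the probability of that event. Summation over
  -- `n` telescopes, and nonnegativity of `f` discards the last term.
  have hrec : ∀ n, (∫⁻ ω, I (n + 1) ω * f (ω (n + 1)) ∂(pathLaw κ y)) +
      β * ∫⁻ ω, I n ω ∂(pathLaw κ y) ≤ ∫⁻ ω, I n ω * f (ω n) ∂(pathLaw κ y) := by
    intro n
    calc _ ≤ (∫⁻ ω, I n ω * f (ω (n + 1)) ∂(pathLaw κ y)) + ∫⁻ ω, β * I n ω ∂(pathLaw κ y) := by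
          rw [lintegral_const_mul _ (hI n)]
          gcongr with ω
          exact hIsucc n ω
      _ = ∫⁻ ω, (I n ω * ∫⁻ z, f z ∂(κ n (ω n)) + β * I n ω) ∂(pathLaw κ y) := by
          rw [lintegral_add_right _ ((hI n).const_mul β)]
          congr 1
          exact lintegral_pathLaw_mul_succ κ y n (measurable_one.indicator (hD n)) hf
      _ ≤ _ := by
          refine lintegral_mono_ae ?_
          filter_upwards [hmem] with ω hω
          by_cases h : ∀ m ≤ n, ω m ∉ B
          · rw [hIeq n ω h]
            simpa using hdrift n _ (hω n) (h n le_rfl)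
          · push Not at h
            obtain ⟨m, hm, hmB⟩ := h
            simp [hIzero n ω m hm hmB]
  have hsum : ∀ n, (∫⁻ ω, I n ω * f (ω n) ∂(pathLaw κ y)) +
      β * ∑ m ∈ Finset.range n, ∫⁻ ω, I m ω ∂(pathLaw κ y) ≤ f y := by
    intro n
    induction n with
    | zero =>
      rw [Finset.range_zero, Finset.sum_empty, mul_zero, add_zero]
      refine le_of_le_of_eq ?_ (lintegral_pathLaw_eval_zero κ y hf)
      refine lintegral_mono fun ω => ?_
      refine (mul_le_mul_left (indicator_le_self' (fun _ _ => zero_le) _) _).trans ?_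
      simp
    | succ n ih =>
      rw [Finset.sum_range_succ, mul_add, add_comm (β * _), ← add_assoc]
      exact (add_le_add_left (hrec n) _).trans ih
  calc β * ∫⁻ ω, hitTime B ω ∂(pathLaw κ y) ≤ β * ∫⁻ ω, ∑' n, I n ω ∂(pathLaw κ y) := by
        gcongr with ω; exact hhit ω
    _ = ∑' n, β * ∫⁻ ω, I n ω ∂(pathLaw κ y) := by
        rw [lintegral_tsum fun n => (hI n).aemeasurable, ENNReal.tsum_mul_left]
    _ ≤ f y := by
        refine ENNReal.tsum_le_of_sum_range_le fun n => ?_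
        rw [← Finset.mul_sum]
        exact le_add_self.trans (hsum n)

end Chain

/-! ### Maxima of finite vectors -/

section MaxA

variable {A : Type*} [Fintype A] [Nonempty A]

lemma le_maxA (q : A → ℝ) (a : A) : q a ≤ maxA q := Finset.le_sup' q (Finset.mem_univ a)

lemma maxA_le {q : A → ℝ} {c : ℝ} (h : ∀ a, q a ≤ c) : maxA q ≤ c :=
  Finset.sup'_le _ _ fun a _ => h a

lemma exists_eq_maxA (q : A → ℝ) : ∃ a, q a = maxA q := by
  obtain ⟨a, _, ha⟩ := Finset.exists_mem_eq_sup' (Finset.univ_nonempty (α := A)) q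
  exact ⟨a, ha.symm⟩

lemma maxA_mono {q q' : A → ℝ} (h : ∀ a, q a ≤ q' a) : maxA q ≤ maxA q' :=
  maxA_le fun a => (h a).trans (le_maxA q' a)

lemma abs_maxA_sub_le (q q' : A → ℝ) : |maxA q - maxA q'| ≤ ‖q - q'‖ := by
  have h : ∀ q q' : A → ℝ, maxA q - maxA q' ≤ ‖q - q'‖ := fun q q' => by
    rw [sub_le_iff_le_add]
    refine maxA_le fun a => ?_
    have h1 := norm_le_pi_norm (q - q') a
    have h2 := le_maxA q' a
    rw [Real.norm_eq_abs, Pi.sub_apply] at h1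
    linarith [le_abs_self (q a - q' a)]
  rw [abs_le]
  constructor
  · have := h q' q
    rw [norm_sub_rev] at this
    linarith
  · exact h q q'

end MaxA

/-! ### Bellman operator and value iteration -/

namespace MDP

variable {X A : Type*} [MeasurableSpace X] [MeasurableSpace A] (M : MDP X A)

lemma Vmax_pos : 0 < M.Vmax := div_pos M.Rmax_pos (sub_pos.2 M.γ_lt_one)

lemma Rmax_add_Vmax : M.Rmax + M.γ * M.Vmax = M.Vmax := by
  have : 1 - M.γ ≠ 0 := (sub_pos.2 M.γ_lt_one).ne'
  unfold Vmax
  field_simp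
  ring

lemma measurable_integral_P {W : X → ℝ} (hW : Measurable W) :
    Measurable fun z => ∫ s', W s' ∂(M.P z) :=
  (hW.stronglyMeasurable.integral_kernel (κ := M.P)).measurable

lemma integrable_of_mem_Icc {Ω : Type*} [MeasurableSpace Ω] {μ : Measure Ω} [IsProbabilityMeasure μ]
    {W : Ω → ℝ} (hW : Measurable W) {a b : ℝ} (h : ∀ x, W x ∈ Icc a b) : Integrable W μ :=
  Integrable.of_mem_Icc a b hW.aemeasurable (ae_of_all _ h)

lemma integral_mem_Icc {Ω : Type*} [MeasurableSpace Ω] {μ : Measure Ω} [IsProbabilityMeasure μ]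
    {W : Ω → ℝ} (hW : Measurable W) {a b : ℝ} (h : ∀ x, W x ∈ Icc a b) : ∫ x, W x ∂μ ∈ Icc a b := by
  have hi := integrable_of_mem_Icc (μ := μ) hW h
  constructor
  · simpa using integral_mono (integrable_const a) hi fun x => (h x).1
  · simpa using integral_mono hi (integrable_const b) fun x => (h x).2

/-- One application of the Bellman operator, before the maximum over the actions. -/
def bellmanQ (W : X → ℝ) (s : X) (a : A) : ℝ := M.R (s, a) + M.γ * ∫ s', W s' ∂(M.P (s, a))

lemma bellmanQ_mem_Icc {W : X → ℝ} (hW : Measurable W) (h : ∀ s, W s ∈ Icc 0 M.Vmax) (s : X) (a : A) :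
    M.bellmanQ W s a ∈ Icc 0 M.Vmax := by
  have hi := integral_mem_Icc (μ := M.P (s, a)) hW h
  constructor
  · exact add_nonneg (M.R_nonneg _) (mul_nonneg M.γ_pos.le hi.1)
  · rw [← M.Rmax_add_Vmax]
    exact add_le_add (M.R_le _) (mul_le_mul_of_nonneg_left hi.2 M.γ_pos.le)

lemma measurable_bellmanQ {W : X → ℝ} (hW : Measurable W) :
    Measurable fun z : X × A => M.bellmanQ W z.1 z.2 :=
  M.measurable_R.add ((M.measurable_integral_P hW).const_mul _)

section Finite

variable [Fintype A] [Nonempty A]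

/-- The iterates of the Bellman operator. -/
def valueIter : ℕ → X → ℝ
  | 0, _ => 0
  | n + 1, s => maxA (M.bellmanQ (valueIter n) s)

lemma measurable_maxA_bellmanQ {W : X → ℝ} (hW : Measurable W) :
    Measurable fun s => maxA (M.bellmanQ W s) :=
  measurable_maxA.comp (measurable_pi_lambda _ fun _ =>
    (M.measurable_bellmanQ hW).comp (by fun_prop : Measurable fun s => (s, _)))

lemma maxA_bellmanQ_mem_Icc {W : X → ℝ} (hW : Measurable W) (h : ∀ s, W s ∈ Icc 0 M.Vmax) (s : X) :
    maxA (M.bellmanQ W s) ∈ Icc 0 M.Vmax :=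
  ⟨(M.bellmanQ_mem_Icc hW h s (Classical.arbitrary A)).1.trans (le_maxA _ _),
    maxA_le fun a => (M.bellmanQ_mem_Icc hW h s a).2⟩

lemma valueIter_spec (n : ℕ) :
    Measurable (M.valueIter n) ∧ ∀ s, M.valueIter n s ∈ Icc 0 M.Vmax := by
  induction n with
  | zero => exact ⟨measurable_const, fun s => ⟨le_rfl, M.Vmax_pos.le⟩⟩
  | succ n ih =>
    exact ⟨M.measurable_maxA_bellmanQ ih.1, M.maxA_bellmanQ_mem_Icc ih.1 ih.2⟩

/-- The iteration starts at `0`, below every value by nonnegativity of the rewards, and the Bellman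
operator is monotone. A monotone bounded sequence gives a measurable fixed point by pointwise
convergence. -/
lemma valueIter_le_succ (n : ℕ) (s : X) : M.valueIter n s ≤ M.valueIter (n + 1) s := by
  induction n generalizing s with
  | zero => exact (M.valueIter_spec 1).2 s |>.1
  | succ n ih =>
    refine maxA_mono fun a => ?_
    refine add_le_add_right (mul_le_mul_of_nonneg_left ?_ M.γ_pos.le) _
    exact integral_mono (integrable_of_mem_Icc (M.valueIter_spec n).1 (M.valueIter_spec n).2)
      (integrable_of_mem_Icc (M.valueIter_spec (n + 1)).1 (M.valueIter_spec (n + 1)).2) ih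

/-- The optimality equation has a measurable solution with values in `[0, Vmax]`. -/
lemma exists_bellman_fixedPoint : ∃ W : X → ℝ, Measurable W ∧ (∀ s, W s ∈ Icc 0 M.Vmax) ∧
    ∀ s, W s = maxA (M.bellmanQ W s) := by
  have hbdd : ∀ s, BddAbove (range fun n => M.valueIter n s) := fun s =>
    ⟨M.Vmax, by rintro _ ⟨n, rfl⟩; exact ((M.valueIter_spec n).2 s).2⟩
  have hlim : ∀ s, Tendsto (fun n => M.valueIter n s) atTop (nhds (⨆ n, M.valueIter n s)) :=
    fun s => tendsto_atTop_ciSup (monotone_nat_of_le_succ fun n => M.valueIter_le_succ n s) (hbdd s)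
  have hmeas : Measurable fun s => ⨆ n, M.valueIter n s :=
    measurable_of_tendsto_metrizable (fun n => (M.valueIter_spec n).1) (tendsto_pi_nhds.2 hlim)
  refine ⟨fun s => ⨆ n, M.valueIter n s, hmeas, fun s => ?_, fun s => ?_⟩
  · exact isClosed_Icc.mem_of_tendsto (hlim s)
      (Eventually.of_forall fun n => (M.valueIter_spec n).2 s)
  -- Both sides are limits of the shifted sequence `valueIter (n + 1) s`; on the right, dominated
  -- convergence passes through the integral and the Lipschitz bound passes through the maximum.
  · refine tendsto_nhds_unique ((tendsto_add_atTop_iff_nat 1).2 (hlim s)) ?_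
    have hQ : Tendsto (fun n => M.bellmanQ (M.valueIter n) s) atTop
        (nhds (M.bellmanQ (fun s => ⨆ n, M.valueIter n s) s)) := by
      refine tendsto_pi_nhds.2 fun a => Tendsto.const_add _ (Tendsto.const_mul _ ?_)
      refine tendsto_integral_of_dominated_convergence (fun _ => M.Vmax)
        (fun n => (M.valueIter_spec n).1.aestronglyMeasurable) (integrable_const _)
        (fun n => ae_of_all _ fun x => ?_) (ae_of_all _ hlim)
      have := (M.valueIter_spec n).2 x
      rw [Real.norm_eq_abs, abs_of_nonneg this.1]
      exact this.2
    have hcont : Tendsto (fun n => maxA (M.bellmanQ (M.valueIter n) s)) atTop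
        (nhds (maxA (M.bellmanQ (fun s => ⨆ n, M.valueIter n s) s))) := by
      rw [tendsto_iff_dist_tendsto_zero] at hQ ⊢
      refine squeeze_zero (fun _ => dist_nonneg) (fun n => ?_) hQ
      rw [Real.dist_eq, dist_eq_norm]
      exact abs_maxA_sub_le _ _
    exact hcont

end Finite

/-! ### Policy evaluation -/

section Play

variable (π : Kernel X A) [IsMarkovKernel π]

instance : IsMarkovKernel (M.playLaw π) := by unfold playLaw; infer_instance

lemma lintegral_id_prod_policy (s : X) {g : X × A → ℝ≥0∞} (hg : Measurable g) :
    ∫⁻ z, g z ∂((Kernel.id ×ₖ π) s) = ∫⁻ a, g (s, a) ∂(π s) := by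
  rw [Kernel.lintegral_id_prod]
  exact hg

lemma lintegral_playStep (z : X × A) {g : X × A → ℝ≥0∞} (hg : Measurable g) :
    ∫⁻ y, g y ∂(((Kernel.id ×ₖ π) ∘ₖ M.P) z) = ∫⁻ s', ∫⁻ a, g (s', a) ∂(π s') ∂(M.P z) := by
  rw [Kernel.lintegral_comp _ _ _ hg]
  exact lintegral_congr fun s' => lintegral_id_prod_policy π s' hg

lemma lintegral_playLaw_zero (s : X) {g : X × A → ℝ≥0∞} (hg : Measurable g) :
    ∫⁻ ω, g (ω 0) ∂(M.playLaw π s) = ∫⁻ a, g (s, a) ∂(π s) := by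
  have hg0 : Measurable fun ω : ℕ → X × A => g (ω 0) := hg.comp (measurable_pi_apply 0)
  unfold playLaw
  rw [Kernel.lintegral_comp _ _ _ hg0,
    lintegral_congr fun z => lintegral_pathLaw_eval_zero _ z hg, lintegral_id_prod_policy π s hg]

lemma lintegral_playLaw_succ (s : X) (n : ℕ) {g : X × A → ℝ≥0∞} (hg : Measurable g) :
    ∫⁻ ω, g (ω (n + 1)) ∂(M.playLaw π s) =
      ∫⁻ ω, ∫⁻ s', ∫⁻ a, g (s', a) ∂(π s') ∂(M.P (ω n)) ∂(M.playLaw π s) := by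
  have h1 : Measurable fun s' => ∫⁻ a, g (s', a) ∂(π s') := hg.lintegral_kernel_prod_right'
  have h2 : Measurable fun z => ∫⁻ s', ∫⁻ a, g (s', a) ∂(π s') ∂(M.P z) := h1.lintegral_kernel
  have hg1 : Measurable fun ω : ℕ → X × A => g (ω (n + 1)) := hg.comp (measurable_pi_apply _)
  have h3 : Measurable fun ω : ℕ → X × A => ∫⁻ s', ∫⁻ a, g (s', a) ∂(π s') ∂(M.P (ω n)) :=
    h2.comp (measurable_pi_apply n)
  unfold playLaw
  rw [Kernel.lintegral_comp _ _ _ hg1, Kernel.lintegral_comp _ _ _ h3]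
  refine lintegral_congr fun z => ?_
  rw [lintegral_pathLaw_eval_succ _ z n hg]
  exact lintegral_congr fun ω => M.lintegral_playStep π _ hg

/-- At each time the action is drawn afresh from `π` given the state, so an inequality that holds
only after averaging over the action is enough. The greedy policy needs exactly this, as the two
integrands may differ at actions that it never plays. -/
lemma lintegral_playLaw_mono (s : X) (n : ℕ) {g h : X × A → ℝ≥0∞} (hg : Measurable g)
    (hh : Measurable h) (H : ∀ x, ∫⁻ a, g (x, a) ∂(π x) ≤ ∫⁻ a, h (x, a) ∂(π x)) :
    ∫⁻ ω, g (ω n) ∂(M.playLaw π s) ≤ ∫⁻ ω, h (ω n) ∂(M.playLaw π s) := by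
  cases n with
  | zero => rw [lintegral_playLaw_zero _ _ _ hg, lintegral_playLaw_zero _ _ _ hh]; exact H s
  | succ n =>
    rw [lintegral_playLaw_succ _ _ _ _ hg, lintegral_playLaw_succ _ _ _ _ hh]
    exact lintegral_mono fun ω => lintegral_mono fun s' => H s'

/-- Tonelli moves the discounted sum outside the expectation. From here on values are handled in
`ℝ≥0∞`, where no integrability has to be checked. -/
lemma value_eq_toReal (s : X) :
    M.value π s = (∑' t : ℕ, ENNReal.ofReal (M.γ ^ t) *
      ∫⁻ ω, ENNReal.ofReal (M.R (ω t)) ∂(M.playLaw π s)).toReal := by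
  have hnn : ∀ (ω : ℕ → X × A) t, 0 ≤ M.γ ^ t * M.R (ω t) := fun ω t =>
    mul_nonneg (pow_nonneg M.γ_pos.le _) (M.R_nonneg _)
  have hsum : ∀ ω : ℕ → X × A, Summable fun t => M.γ ^ t * M.R (ω t) := fun ω =>
    Summable.of_nonneg_of_le (hnn ω)
      (fun t => mul_le_mul_of_nonneg_left (M.R_le _) (pow_nonneg M.γ_pos.le _))
      ((summable_geometric_of_lt_one M.γ_pos.le M.γ_lt_one).mul_right M.Rmax)
  have hR : Measurable fun z => ENNReal.ofReal (M.R z) := M.measurable_R.ennreal_ofReal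
  have hm : ∀ t : ℕ, Measurable fun ω : ℕ → X × A => ENNReal.ofReal (M.R (ω t)) := fun t =>
    hR.comp (measurable_pi_apply t)
  have heq : ∀ ω : ℕ → X × A, ENNReal.ofReal (∑' t, M.γ ^ t * M.R (ω t)) =
      ∑' t, ENNReal.ofReal (M.γ ^ t) * ENNReal.ofReal (M.R (ω t)) := fun ω => by
    rw [ENNReal.ofReal_tsum_of_nonneg (hnn ω) (hsum ω)]
    exact tsum_congr fun t => ENNReal.ofReal_mul (pow_nonneg M.γ_pos.le _)
  have hmeas : Measurable fun ω : ℕ → X × A => ∑' t, M.γ ^ t * M.R (ω t) := by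
    have h1 : Measurable fun ω : ℕ → X × A =>
        (∑' t, ENNReal.ofReal (M.γ ^ t) * ENNReal.ofReal (M.R (ω t))).toReal :=
      (Measurable.tsum fun t => (hm t).const_mul _).ennreal_toReal
    convert h1 using 1
    funext ω
    rw [← heq, ENNReal.toReal_ofReal (tsum_nonneg (hnn ω))]
  unfold value
  rw [integral_eq_lintegral_of_nonneg_ae (ae_of_all _ fun ω => tsum_nonneg (hnn ω))
    hmeas.aestronglyMeasurable, lintegral_congr heq, lintegral_tsum fun t =>
      ((hm t).const_mul _).aemeasurable]
  congr 1
  exact tsum_congr fun t => lintegral_const_mul _ (hm t)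

/-- A measurable family of weights with positive sums, seen as a policy. -/
def weightPolicy [Fintype A] (v : X → A → ℝ) (hv : Measurable v) : Kernel X A where
  toFun s := ∑ a, ENNReal.ofReal (v s a / ∑ b, v s b) • Measure.dirac a
  measurable' := by
    refine Measure.measurable_of_measurable_coe _ fun t ht => ?_
    simp only [Measure.coe_finsetSum, Finset.sum_apply, Measure.smul_apply, smul_eq_mul]
    refine Finset.measurable_sum _ fun a _ => Measurable.mul_const ?_ _
    fun_prop

lemma isMarkovKernel_weightPolicy [Fintype A] {v : X → A → ℝ} (hv : Measurable v)
    (hnn : ∀ s a, 0 ≤ v s a) (hpos : ∀ s, 0 < ∑ b, v s b) : IsMarkovKernel (weightPolicy v hv) := by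
  refine ⟨fun s => ⟨?_⟩⟩
  change (∑ a, ENNReal.ofReal (v s a / ∑ b, v s b) • Measure.dirac a) univ = 1
  simp only [Measure.coe_finsetSum, Finset.sum_apply, Measure.smul_apply, smul_eq_mul,
    measure_univ, mul_one]
  rw [← ENNReal.ofReal_sum_of_nonneg fun a _ => div_nonneg (hnn s a) (hpos s).le, ← Finset.sum_div,
    div_self (hpos s).ne', ENNReal.ofReal_one]

lemma lintegral_weightPolicy [Fintype A] {v : X → A → ℝ} (hv : Measurable v) (s : X)
    {g : A → ℝ≥0∞} (hg : Measurable g) :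
    ∫⁻ a, g a ∂(weightPolicy v hv s) = ∑ a, ENNReal.ofReal (v s a / ∑ b, v s b) * g a := by
  change ∫⁻ a, g a ∂(∑ a, ENNReal.ofReal (v s a / ∑ b, v s b) • Measure.dirac a) = _
  rw [lintegral_finsetSum_measure]
  refine Finset.sum_congr rfl fun a _ => ?_
  rw [lintegral_smul_measure, lintegral_dirac' _ hg, smul_eq_mul]

lemma measurable_apply_const {g : X × A → ℝ≥0∞} (hg : Measurable g) (s : X) :
    Measurable fun a => g (s, a) := hg.comp measurable_prodMk_left

end Play

/-! ### Identification of the optimal value function -/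

section Optimal

variable {W : X → ℝ}

lemma lintegral_playLaw_bellman (hW : Measurable W) (h : ∀ s, W s ∈ Icc 0 M.Vmax)
    (π : Kernel X A) [IsMarkovKernel π] (s : X) (t : ℕ) :
    (∫⁻ ω, ENNReal.ofReal (M.R (ω t)) ∂(M.playLaw π s)) +
      ENNReal.ofReal M.γ * ∫⁻ ω, ENNReal.ofReal (W (ω (t + 1)).1) ∂(M.playLaw π s) =
    ∫⁻ ω, ENNReal.ofReal (M.bellmanQ W (ω t).1 (ω t).2) ∂(M.playLaw π s) := by
  have hg : Measurable fun z : X × A => ENNReal.ofReal (W z.1) :=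
    (hW.comp measurable_fst).ennreal_ofReal
  have hR : Measurable fun ω : ℕ → X × A => ENNReal.ofReal (M.R (ω t)) :=
    (M.measurable_R.comp (measurable_pi_apply t)).ennreal_ofReal
  have hI : Measurable fun ω : ℕ → X × A => ∫⁻ s', ENNReal.ofReal (W s') ∂(M.P (ω t)) :=
    (hW.ennreal_ofReal.lintegral_kernel (κ := M.P)).comp (measurable_pi_apply t)
  have hs := M.lintegral_playLaw_succ π s t hg
  simp only [lintegral_const, measure_univ, mul_one] at hs
  rw [hs, ← lintegral_const_mul _ hI, ← lintegral_add_left hR]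
  refine lintegral_congr fun ω => ?_
  have hint : ∫⁻ s', ENNReal.ofReal (W s') ∂(M.P (ω t)) =
      ENNReal.ofReal (∫ s', W s' ∂(M.P (ω t))) :=
    (ofReal_integral_eq_lintegral_ofReal (integrable_of_mem_Icc hW h)
      (ae_of_all _ fun x => (h x).1)).symm
  rw [hint, ← ENNReal.ofReal_mul M.γ_pos.le, ← ENNReal.ofReal_add (M.R_nonneg _)
    (mul_nonneg M.γ_pos.le (integral_mem_Icc hW h).1)]
  rfl

variable [Fintype A] [Nonempty A]

/-- The quantity "reward collected up to time `n` plus `γ^n E[W(s_n)]`" is nonincreasing in `n`,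
because `W` dominates the Bellman backup of every action. It equals `W s` at `n = 0` and dominates
the partial sums of the value. -/
lemma value_le_of_bellman (hW : Measurable W) (h : ∀ s, W s ∈ Icc 0 M.Vmax)
    (hfix : ∀ s, W s = maxA (M.bellmanQ W s)) (π : Kernel X A) [IsMarkovKernel π] (s : X) :
    M.value π s ≤ W s := by
  have hle : ∀ n, (∑ t ∈ Finset.range n, ENNReal.ofReal (M.γ ^ t) *
        ∫⁻ ω, ENNReal.ofReal (M.R (ω t)) ∂(M.playLaw π s)) +
      ENNReal.ofReal (M.γ ^ n) * ∫⁻ ω, ENNReal.ofReal (W (ω n).1) ∂(M.playLaw π s) ≤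
      ENNReal.ofReal (W s) := by
    intro n
    induction n with
    | zero =>
      have := M.lintegral_playLaw_zero π s (g := fun z => ENNReal.ofReal (W z.1))
        (hW.comp measurable_fst).ennreal_ofReal
      simp only [lintegral_const, measure_univ, mul_one] at this
      simp [this]
    | succ n ih =>
      refine le_trans ?_ ih
      rw [Finset.sum_range_succ, add_assoc]
      gcongr
      rw [pow_succ, ENNReal.ofReal_mul (pow_nonneg M.γ_pos.le _), mul_assoc, ← mul_add,
        M.lintegral_playLaw_bellman hW h]
      gcongr with ω
      rw [hfix (ω n).1]
      exact le_maxA _ _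
  rw [value_eq_toReal]
  refine ENNReal.toReal_le_of_le_ofReal (h s).1 (ENNReal.tsum_le_of_sum_range_le fun n => ?_)
  exact le_self_add.trans (hle n)

/-- Under a greedy policy the quantity that bounds the value from above does not decrease either,
and its remainder `γ^n E[W(s_n)]` vanishes because `W ≤ Vmax`. -/
lemma exists_policy_value_eq [DiscreteMeasurableSpace A] (hW : Measurable W)
    (h : ∀ s, W s ∈ Icc 0 M.Vmax) (hfix : ∀ s, W s = maxA (M.bellmanQ W s)) :
    ∃ (π : Kernel X A) (_ : IsMarkovKernel π), ∀ s, W s ≤ M.value π s := by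
  classical
  -- Equal weights on all maximizers give a measurable policy without selecting a single maximizer
  -- measurably.
  let v : X → A → ℝ := fun s a => if M.bellmanQ W s a = W s then 1 else 0
  have hQ : ∀ a, Measurable fun s => M.bellmanQ W s a := fun a =>
    (M.measurable_bellmanQ hW).comp (measurable_id.prodMk measurable_const)
  have hv : Measurable v := measurable_pi_lambda _ fun a =>
    Measurable.ite (measurableSet_eq_fun (hQ a) hW) measurable_const measurable_const
  have hnn : ∀ s a, 0 ≤ v s a := fun s a => by dsimp [v]; split_ifs <;> norm_num
  have hpos : ∀ s, 0 < ∑ b, v s b := fun s => by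
    obtain ⟨a, ha⟩ := exists_eq_maxA (M.bellmanQ W s)
    refine Finset.sum_pos' (fun b _ => hnn s b) ⟨a, Finset.mem_univ a, ?_⟩
    simp [v, ha, ← hfix s]
  have hπ := isMarkovKernel_weightPolicy hv hnn hpos
  refine ⟨weightPolicy v hv, hπ, fun s => ?_⟩
  have hWm : Measurable fun z : X × A => ENNReal.ofReal (W z.1) :=
    (hW.comp measurable_fst).ennreal_ofReal
  have hQm : Measurable fun z : X × A => ENNReal.ofReal (M.bellmanQ W z.1 z.2) :=
    (M.measurable_bellmanQ hW).ennreal_ofReal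
  have hopt : ∀ t, ∫⁻ ω, ENNReal.ofReal (W (ω t).1) ∂(M.playLaw (weightPolicy v hv) s) ≤
      ∫⁻ ω, ENNReal.ofReal (M.bellmanQ W (ω t).1 (ω t).2) ∂(M.playLaw (weightPolicy v hv) s) := by
    refine fun t => M.lintegral_playLaw_mono _ s t hWm hQm fun x => ?_
    rw [lintegral_weightPolicy hv x (measurable_apply_const hWm x),
      lintegral_weightPolicy hv x (measurable_apply_const hQm x)]
    refine Finset.sum_le_sum fun a _ => ?_
    by_cases ha : M.bellmanQ W x a = W x
    · rw [ha]
    · simp [v, ha]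
  have hle : ∀ n, ENNReal.ofReal (W s) ≤ (∑ t ∈ Finset.range n, ENNReal.ofReal (M.γ ^ t) *
        ∫⁻ ω, ENNReal.ofReal (M.R (ω t)) ∂(M.playLaw (weightPolicy v hv) s)) +
      ENNReal.ofReal (M.γ ^ n) *
        ∫⁻ ω, ENNReal.ofReal (W (ω n).1) ∂(M.playLaw (weightPolicy v hv) s) := by
    intro n
    induction n with
    | zero =>
      have := M.lintegral_playLaw_zero (weightPolicy v hv) s hWm
      simp only [lintegral_const, measure_univ, mul_one] at this
      simp [this]
    | succ n ih =>
      refine ih.trans ?_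
      rw [Finset.sum_range_succ, add_assoc]
      gcongr
      rw [pow_succ, ENNReal.ofReal_mul (pow_nonneg M.γ_pos.le _), mul_assoc, ← mul_add,
        M.lintegral_playLaw_bellman hW h]
      exact mul_le_mul' le_rfl (hopt n)
  set S := ∑' t : ℕ, ENNReal.ofReal (M.γ ^ t) *
    ∫⁻ ω, ENNReal.ofReal (M.R (ω t)) ∂(M.playLaw (weightPolicy v hv) s) with hS
  have hle' : ∀ n, ENNReal.ofReal (W s) ≤ S + ENNReal.ofReal (M.γ ^ n) * ENNReal.ofReal M.Vmax := by
    refine fun n => (hle n).trans ?_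
    gcongr
    · exact ENNReal.sum_le_tsum _
    · calc _ ≤ ∫⁻ _, ENNReal.ofReal M.Vmax ∂(M.playLaw (weightPolicy v hv) s) :=
            lintegral_mono fun ω => ENNReal.ofReal_le_ofReal (h _).2
        _ = _ := by simp
  have hlim : Tendsto (fun n : ℕ => S + ENNReal.ofReal (M.γ ^ n) * ENNReal.ofReal M.Vmax) atTop
      (nhds (S + 0)) := by
    refine Tendsto.const_add _ ?_
    have h1 : Tendsto (fun n : ℕ => ENNReal.ofReal (M.γ ^ n * M.Vmax)) atTop (nhds 0) := by
      have := (tendsto_pow_atTop_nhds_zero_of_lt_one M.γ_pos.le M.γ_lt_one).mul_const M.Vmax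
      rw [zero_mul] at this
      simpa using ENNReal.tendsto_ofReal this
    refine h1.congr fun n => ENNReal.ofReal_mul (pow_nonneg M.γ_pos.le _)
  have hfin : S ≠ ∞ := by
    have : S ≤ ENNReal.ofReal (∑' t : ℕ, M.γ ^ t * M.Rmax) := by
      rw [ENNReal.ofReal_tsum_of_nonneg
        (fun t => mul_nonneg (pow_nonneg M.γ_pos.le _) M.Rmax_pos.le)
        ((summable_geometric_of_lt_one M.γ_pos.le M.γ_lt_one).mul_right M.Rmax)]
      refine ENNReal.tsum_le_tsum fun t => ?_
      rw [ENNReal.ofReal_mul (pow_nonneg M.γ_pos.le _)]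
      gcongr
      calc _ ≤ ∫⁻ _, ENNReal.ofReal M.Rmax ∂(M.playLaw (weightPolicy v hv) s) :=
            lintegral_mono fun ω => ENNReal.ofReal_le_ofReal (M.R_le _)
        _ = _ := by simp
    exact (this.trans_lt ENNReal.ofReal_lt_top).ne
  have hfinal := ge_of_tendsto' hlim hle'
  rw [add_zero] at hfinal
  rw [value_eq_toReal]
  exact (ENNReal.ofReal_le_iff_le_toReal hfin).1 hfinal

variable [DiscreteMeasurableSpace A]

/-- The optimal value function is the solution of the optimality equation. -/
lemma optValue_eq_of_bellman (hW : Measurable W) (h : ∀ s, W s ∈ Icc 0 M.Vmax)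
    (hfix : ∀ s, W s = maxA (M.bellmanQ W s)) : M.optValue = W := by
  obtain ⟨π, hπ, hval⟩ := M.exists_policy_value_eq hW h hfix
  funext s
  have hle : ∀ π : {π : Kernel X A // IsMarkovKernel π}, (haveI := π.2; M.value π.1 s) ≤ W s :=
    fun π => haveI := π.2; M.value_le_of_bellman hW h hfix π.1 s
  have : Nonempty {π : Kernel X A // IsMarkovKernel π} := ⟨⟨π, hπ⟩⟩
  exact le_antisymm (ciSup_le hle) ((hval s).trans
    (le_ciSup (f := fun π : {π : Kernel X A // IsMarkovKernel π} =>
      (haveI := π.2; M.value π.1 s)) ⟨W s, by rintro _ ⟨π, rfl⟩; exact hle π⟩ ⟨π, hπ⟩))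

/-- A supremum over a possibly uncountable family of policies need not be measurable for a general
reason; here it inherits measurability and bounds from the fixed point of value iteration. -/
lemma optValue_spec : Measurable M.optValue ∧ (∀ s, M.optValue s ∈ Icc 0 M.Vmax) ∧
    ∀ s, M.optValue s = maxA (M.optQ s) := by
  obtain ⟨W, hW, h, hfix⟩ := M.exists_bellman_fixedPoint
  have : M.optValue = W := M.optValue_eq_of_bellman hW h hfix
  refine ⟨this ▸ hW, this ▸ h, fun s => ?_⟩
  have h2 : M.optQ s = M.bellmanQ W s := by
    funext a
    rw [optQ, bellmanQ, this]
  rw [this, h2]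
  exact hfix s

end Optimal

end MDP

namespace MDP

/-! ### Stability of Boltzmann distributions -/

section Boltzmann

variable {A : Type*} [Fintype A] [Nonempty A]

/-- The Boltzmann probabilities. -/
def softmax (τ : ℝ) (q : A → ℝ) (a : A) : ℝ := Real.exp (q a / τ) / ∑ b, Real.exp (q b / τ)

lemma sum_exp_pos (τ : ℝ) (q : A → ℝ) : 0 < ∑ b, Real.exp (q b / τ) :=
  Finset.sum_pos (fun _ _ => Real.exp_pos _) Finset.univ_nonempty

lemma softmax_nonneg (τ : ℝ) (q : A → ℝ) (a : A) : 0 ≤ softmax τ q a :=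
  div_nonneg (Real.exp_pos _).le (sum_exp_pos τ q).le

lemma sum_softmax (τ : ℝ) (q : A → ℝ) : ∑ a, softmax τ q a = 1 := by
  unfold softmax
  rw [← Finset.sum_div, div_self (sum_exp_pos τ q).ne']

/-- The numerator and the normalizing sum each change by a factor of at most `exp (‖q - q'‖ / τ)`,
whence the `2` in the exponent. -/
lemma softmax_le_exp_mul {τ : ℝ} (hτ : 0 < τ) (q q' : A → ℝ) (a : A) :
    softmax τ q a ≤ Real.exp (2 * ‖q - q'‖ / τ) * softmax τ q' a := by
  have hc : ∀ (q q' : A → ℝ) b,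
      Real.exp (q b / τ) ≤ Real.exp (‖q - q'‖ / τ) * Real.exp (q' b / τ) := fun q q' b => by
    rw [← Real.exp_add, ← add_div]
    gcongr
    have h1 := norm_le_pi_norm (q - q') b
    rw [Real.norm_eq_abs, Pi.sub_apply] at h1
    linarith [le_abs_self (q b - q' b)]
  have hsum : ∑ b, Real.exp (q' b / τ) ≤
      Real.exp (‖q - q'‖ / τ) * ∑ b, Real.exp (q b / τ) := by
    rw [Finset.mul_sum, norm_sub_rev]
    exact Finset.sum_le_sum fun b _ => hc q' q b
  have hZ := sum_exp_pos τ q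
  have hZ' := sum_exp_pos τ q'
  unfold softmax
  rw [← mul_div_assoc, div_le_div_iff₀ hZ hZ']
  calc _ ≤ (Real.exp (‖q - q'‖ / τ) * Real.exp (q' a / τ)) *
        (Real.exp (‖q - q'‖ / τ) * ∑ b, Real.exp (q b / τ)) := by
        gcongr
        exact hc q q' a
    _ = _ := by
        have : Real.exp (2 * ‖q - q'‖ / τ) = Real.exp (‖q - q'‖ / τ) * Real.exp (‖q - q'‖ / τ) := by
          rw [← Real.exp_add]; ring_nf
        rw [this]; ring

/-- The Boltzmann distribution is Lipschitz in the total variation norm. -/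
lemma sum_abs_softmax_sub_le {τ : ℝ} (hτ : 0 < τ) (q q' : A → ℝ) :
    ∑ a, |softmax τ q a - softmax τ q' a| ≤ 4 * ‖q - q'‖ / τ := by
  set y := 2 * ‖q - q'‖ / τ with hy
  have hy0 : 0 ≤ y := by positivity
  have h4 : 4 * ‖q - q'‖ / τ = 2 * y := by rw [hy]; ring
  rw [h4]
  -- For `y ≤ 1` the multiplicative comparison gives `exp y - 1 ≤ 2 y`; for `y ≥ 1` the trivial
  -- bound `2` on the `ℓ¹` distance of two probability vectors is already enough.
  rcases le_total y 1 with h1 | h1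
  · have hexp : Real.exp y - 1 ≤ 2 * y := by
      have := Real.abs_exp_sub_one_le (x := y) (by rwa [abs_of_nonneg hy0])
      rw [abs_of_nonneg hy0] at this
      exact (le_abs_self _).trans this
    calc _ ≤ ∑ a, 2 * y * softmax τ q' a := by
          refine Finset.sum_le_sum fun a _ => ?_
          have e1 := softmax_le_exp_mul hτ q q' a
          have e2 := softmax_le_exp_mul hτ q' q a
          rw [norm_sub_rev q' q] at e2
          rw [← hy] at e1 e2
          have p1 := softmax_nonneg τ q a
          have p2 := softmax_nonneg τ q' a
          rw [abs_le]
          constructor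
          · rcases le_total (softmax τ q a) (softmax τ q' a) with hle | hle
            · nlinarith
            · nlinarith
          · nlinarith
      _ = _ := by rw [← Finset.mul_sum, sum_softmax, mul_one]
  · calc _ ≤ ∑ a, (softmax τ q a + softmax τ q' a) := by
          refine Finset.sum_le_sum fun a _ => ?_
          have p1 := softmax_nonneg τ q a
          have p2 := softmax_nonneg τ q' a
          rw [abs_le]
          constructor <;> linarith
      _ ≤ _ := by
          rw [Finset.sum_add_distrib, sum_softmax, sum_softmax]
          linarith

/-- The Boltzmann distribution is close to the uniform distribution on the maximizers. -/
lemma sum_abs_softmax_sub_uniform_le {τ g : ℝ} (hτ : 0 < τ) (q : A → ℝ) (O : Finset A)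
    (hO : O.Nonempty) (hmax : ∀ a ∈ O, q a = maxA q) (hgap : ∀ a ∉ O, q a ≤ maxA q - g) :
    ∑ a, |softmax τ q a - (O : Set A).indicator (fun _ => 1 / (O.card : ℝ)) a| ≤
      2 * Fintype.card A * Real.exp (-g / τ) := by
  classical
  -- Dividing by the largest weight gives every optimal action weight `1`, so the normalizer is `|O|
  -- + r` with `r` the total suboptimal weight. The deficit on `O` and the mass outside `O` are both
  -- `r / (|O| + r)`, which explains the factor `2`.
  set e : A → ℝ := fun a => Real.exp ((q a - maxA q) / τ) with he
  have hes : ∀ a, softmax τ q a = e a / ∑ b, e b := fun a => by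
    have : ∀ b, Real.exp (q b / τ) = Real.exp (maxA q / τ) * e b := fun b => by
      rw [he, ← Real.exp_add]; congr 1; ring
    unfold softmax
    simp only [this]
    rw [← Finset.mul_sum, mul_div_mul_left _ _ (Real.exp_pos _).ne']
  have heO : ∀ a ∈ O, e a = 1 := fun a ha => by simp [he, hmax a ha]
  set r := ∑ a ∈ Oᶜ, e a with hr
  have hr0 : 0 ≤ r := Finset.sum_nonneg fun a _ => (Real.exp_pos _).le
  have hZ : ∑ b, e b = O.card + r := by
    rw [← Finset.sum_add_sum_compl O, Finset.sum_congr rfl heO]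
    simp [hr]
  have hm : (1 : ℝ) ≤ O.card := by exact_mod_cast hO.card_pos
  have hrle : r ≤ Fintype.card A * Real.exp (-g / τ) := by
    calc r ≤ ∑ _a ∈ Oᶜ, Real.exp (-g / τ) := by
          refine Finset.sum_le_sum fun a ha => ?_
          rw [he]
          have := hgap a (Finset.mem_compl.1 ha)
          dsimp only
          gcongr
          linarith
      _ = (Oᶜ.card : ℝ) * Real.exp (-g / τ) := by rw [Finset.sum_const, nsmul_eq_mul]
      _ ≤ _ := by
          gcongr
          exact Finset.card_le_univ _
  have hZpos : 0 < (O.card : ℝ) + r := by linarith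
  have h1 : ∑ a ∈ O, |softmax τ q a - (O : Set A).indicator (fun _ => 1 / (O.card : ℝ)) a| =
      r / (O.card + r) := by
    have : ∀ a ∈ O, |softmax τ q a - (O : Set A).indicator (fun _ => 1 / (O.card : ℝ)) a| =
        1 / O.card - 1 / (O.card + r) := fun a ha => by
      rw [hes, heO a ha, hZ, indicator_of_mem (Finset.mem_coe.2 ha), abs_sub_comm, abs_of_nonneg]
      rw [sub_nonneg]
      exact one_div_le_one_div_of_le (by linarith) (by linarith)
    rw [Finset.sum_congr rfl this, Finset.sum_const, nsmul_eq_mul]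
    have : (O.card : ℝ) ≠ 0 := by linarith
    field_simp
    ring
  have h2 : ∑ a ∈ Oᶜ, |softmax τ q a - (O : Set A).indicator (fun _ => 1 / (O.card : ℝ)) a| =
      r / (O.card + r) := by
    rw [hr, Finset.sum_div]
    refine Finset.sum_congr rfl fun a ha => ?_
    rw [indicator_of_notMem (by simpa using ha), sub_zero, abs_of_nonneg (softmax_nonneg _ _ _),
      hes, hZ]
  rw [← Finset.sum_add_sum_compl O, h1, h2]
  have : r / (O.card + r) ≤ r := div_le_self hr0 (by linarith)
  linarith

variable [MeasurableSpace A] [DiscreteMeasurableSpace A]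

lemma lintegral_boltzmann (τ : ℝ) (q : A → ℝ) (g : A → ℝ≥0∞) :
    ∫⁻ a, g a ∂(boltzmann τ q) = ∑ a, ENNReal.ofReal (softmax τ q a) * g a := by
  change ∫⁻ a, g a ∂(∑ a, ENNReal.ofReal (Real.exp (q a / τ) / ∑ b, Real.exp (q b / τ)) •
    Measure.dirac a) = _
  rw [lintegral_finsetSum_measure]
  refine Finset.sum_congr rfl fun a _ => ?_
  rw [lintegral_smul_measure, lintegral_dirac' _ (Measurable.of_discrete), smul_eq_mul]
  rfl

end Boltzmann

/-! ### The optimality gap and the threshold for the temperature -/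

section Threshold

variable {X A : Type*} [MeasurableSpace X] [MeasurableSpace A] (M : MDP X A) [Fintype A] [Nonempty A]

lemma optActions_nonempty (s : X) : (M.optActions s).Nonempty := by
  classical
  obtain ⟨a, ha⟩ := exists_eq_maxA (M.optQ s)
  exact ⟨a, Finset.mem_filter.2 ⟨Finset.mem_univ a, fun b => ha ▸ le_maxA _ b⟩⟩

lemma optQ_eq_maxA_of_mem {s : X} {a : A} (ha : a ∈ M.optActions s) :
    M.optQ s a = maxA (M.optQ s) := by
  classical
  exact le_antisymm (le_maxA _ a) (maxA_le (Finset.mem_filter.1 ha).2)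

lemma minGap_le {s : X} {a : A} (ha : a ∉ M.optActions s) :
    M.minGap ≤ ((maxA (M.optQ s) - M.optQ s a : ℝ) : EReal) := by
  refine (iInf_le _ s).trans ?_
  rw [EReal.coe_sub]
  unfold gap
  refine EReal.sub_le_sub (iSup_le fun b => EReal.coe_le_coe_iff.2 (le_maxA _ b)) ?_
  exact le_iSup₂ (f := fun (b : A) (_ : b ∈ {a : A | a ∉ M.optActions s}) =>
    (M.optQ s b : EReal)) a ha

variable {ν α : ℝ}

lemma one_lt_ratio (hα : 0 < α) (hαν : α ≤ ν) : 1 < 24 * ν * (Fintype.card A : ℝ) / α := by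
  have hA : (1 : ℝ) ≤ Fintype.card A := by exact_mod_cast Fintype.card_pos
  rw [lt_div_iff₀ hα]
  nlinarith

/-- These are the two consequences of the threshold that the drift estimate uses: the third term of
the minimum controls the effect of the oracle error, the fourth the Boltzmann mass on suboptimal
actions. `α ≤ ν` makes the logarithm positive, so that dividing by it preserves order. -/
lemma tauThreshold_spec (hgap : 0 < M.minGap) (hα : 0 < α) (hαν : α ≤ ν) :
    0 < M.tauThreshold ν α ∧
    M.tauThreshold ν α ≤ (1 - M.γ) * α / (48 * M.Rmax * (Fintype.card A : ℝ) ^ 2 * ν) ∧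
    ∀ s a, a ∉ M.optActions s → M.optQ s a ≤ maxA (M.optQ s) -
      M.tauThreshold ν α * Real.log (24 * ν * (Fintype.card A : ℝ) / α) := by
  have hA : (1 : ℝ) ≤ Fintype.card A := by exact_mod_cast Fintype.card_pos
  have hν : 0 < ν := hα.trans_le hαν
  have hγ : 0 < 1 - M.γ := sub_pos.2 M.γ_lt_one
  have hR := M.Rmax_pos
  have hlog : 0 < Real.log (24 * ν * (Fintype.card A : ℝ) / α) :=
    Real.log_pos (one_lt_ratio hα hαν)
  set l := Real.log (24 * ν * (Fintype.card A : ℝ) / α) with hl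
  set r : ℝ := min (Real.sqrt (α / (24 * ν))) (min ((1 - M.γ) / (8 * M.Rmax))
        ((1 - M.γ) * α / (48 * M.Rmax * (Fintype.card A : ℝ) ^ 2 * ν))) with hr
  have hr0 : 0 < r := by
    rw [hr]
    refine lt_min (Real.sqrt_pos.2 ?_) (lt_min ?_ ?_) <;> positivity
  have hdef : M.tauThreshold ν α = (min (r : EReal) (M.minGap / (l : EReal))).toReal := rfl
  -- The real number `r` caps the minimum even when the gap is infinite, so `toReal` is never
  -- applied to `⊤` or `⊥`.
  set m := min (r : EReal) (M.minGap / (l : EReal)) with hm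
  have hm0 : 0 ≤ m := le_min (EReal.coe_nonneg.2 hr0.le)
    (EReal.div_nonneg hgap.le (EReal.coe_nonneg.2 hlog.le))
  have hbot : m ≠ ⊥ := fun h => by rw [h] at hm0; simp at hm0
  have htop : m ≠ ⊤ := ne_of_lt ((min_le_left _ _).trans_lt (EReal.coe_lt_top r))
  have hcoe : ((M.tauThreshold ν α : ℝ) : EReal) = m := by rw [hdef, EReal.coe_toReal htop hbot]
  refine ⟨?_, ?_, fun s a ha => ?_⟩
  · rw [← EReal.coe_pos, hcoe]
    exact lt_min (EReal.coe_pos.2 hr0)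
      (EReal.div_pos hgap (EReal.coe_pos.2 hlog) (EReal.coe_ne_top l))
  · have : M.tauThreshold ν α ≤ r := by
      rw [← EReal.coe_le_coe_iff, hcoe]; exact min_le_left _ _
    exact this.trans ((min_le_right _ _).trans (min_le_right _ _))
  · have h1 := M.minGap_le ha
    have h2 : ((M.tauThreshold ν α : ℝ) : EReal) ≤
        ((maxA (M.optQ s) - M.optQ s a : ℝ) : EReal) / (l : EReal) := by
      rw [hcoe]
      exact (min_le_right _ _).trans
        (EReal.div_le_div_right_of_nonneg (EReal.coe_nonneg.2 hlog.le) h1)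
    rw [← EReal.coe_div, EReal.coe_le_coe_iff, le_div_iff₀ hlog] at h2
    linarith

end Threshold

end MDP

namespace MDP

variable {X A : Type*} [MeasurableSpace X] [MeasurableSpace A] (M : MDP X A)
  [Fintype A] [Nonempty A] [DiscreteMeasurableSpace A]

/-! ### Drift of the Lyapunov function under an approximately optimal Boltzmann policy -/

lemma lintegral_closedLoop_boltzmann (ϖ : Kernel X (A → ℝ)) [IsMarkovKernel ϖ] (τ : ℝ) (s : X)
    {f : X → ℝ≥0∞} (hf : Measurable f) :
    ∫⁻ s', f s' ∂(M.closedLoop (boltzmann τ ∘ₖ ϖ) s) =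
      ∫⁻ q, ∑ a, ENNReal.ofReal (softmax τ q a) * ∫⁻ s', f s' ∂(M.P (s, a)) ∂(ϖ s) := by
  have h1 : Measurable fun z => ∫⁻ s', f s' ∂(M.P z) := hf.lintegral_kernel
  unfold closedLoop
  rw [Kernel.lintegral_comp _ _ _ hf, lintegral_id_prod_policy _ s h1,
    Kernel.lintegral_comp _ _ _ (Measurable.of_discrete)]
  exact lintegral_congr fun q => lintegral_boltzmann τ q _

lemma lintegral_closedLoop_boltzmann_le (ϖ : Kernel X (A → ℝ)) [IsMarkovKernel ϖ] (τ : ℝ) (s : X)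
    {f : X → ℝ≥0∞} (hf : Measurable f) {c : ℝ≥0∞} (h : ∀ a, ∫⁻ s', f s' ∂(M.P (s, a)) ≤ c) :
    ∫⁻ s', f s' ∂(M.closedLoop (boltzmann τ ∘ₖ ϖ) s) ≤ c := by
  rw [lintegral_closedLoop_boltzmann M ϖ τ s hf]
  calc _ ≤ ∫⁻ _q, c ∂(ϖ s) := by
        refine lintegral_mono fun q => ?_
        calc _ ≤ ∑ a, ENNReal.ofReal (softmax τ q a) * c := by
              gcongr with a
              exact h a
          _ = c := by
              rw [← Finset.sum_mul, ← ENNReal.ofReal_sum_of_nonneg fun a _ => softmax_nonneg τ q a,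
                sum_softmax, ENNReal.ofReal_one, one_mul]
    _ = c := by simp

lemma optPolicy_eq_indicator (s : X) (a : A) :
    M.optPolicy s a =
      (M.optActions s : Set A).indicator (fun _ => 1 / ((M.optActions s).card : ℝ)) a := by
  classical
  unfold optPolicy
  by_cases h : a ∈ M.optActions s <;> simp [h]

lemma optPolicy_nonneg (s : X) (a : A) : 0 ≤ M.optPolicy s a := by
  rw [optPolicy_eq_indicator]
  exact indicator_nonneg (fun _ _ => by positivity) a

lemma sum_optPolicy (s : X) : ∑ a, M.optPolicy s a = 1 := by
  classical
  simp only [optPolicy_eq_indicator]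
  rw [Finset.sum_indicator_eq_sum_filter]
  have : (M.optActions s).card ≠ 0 := (M.optActions_nonempty s).card_pos.ne'
  simp [this]

namespace IsLyapunov

variable {M} {E : Type*} [NormedAddCommGroup E] {pos : X → E} {L : X → ℝ} {ν ν' B α : ℝ}
  (hL : M.IsLyapunov pos L ν ν' B α)

include hL

lemma integrable_sub (s : X) (a : A) : Integrable (fun s' => L s' - L s) (M.P (s, a)) := by
  refine Integrable.of_bound (hL.measurable.sub_const _).aestronglyMeasurable ν ?_
  filter_upwards [hL.increment s a] with s' h using h.1

lemma abs_drift_le (s : X) (a : A) : |∫ s', (L s' - L s) ∂(M.P (s, a))| ≤ ν := by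
  have := norm_integral_le_of_norm_le_const (μ := M.P (s, a)) (f := fun s' => L s' - L s) (C := ν)
    (by filter_upwards [hL.increment s a] with s' h using h.1)
  simpa using this

/-- The redundant factor `1` puts the right side in the form `u + w * drift` that
`lintegral_closedLoop_le_of_drift` expects. -/
lemma lintegral_L (s : X) (a : A) : ∫⁻ s', ENNReal.ofReal (L s') ∂(M.P (s, a)) =
    ENNReal.ofReal (L s + 1 * ∫ s', (L s' - L s) ∂(M.P (s, a))) := by
  have h1 : (fun s' => L s') = fun s' => (L s' - L s) + L s := by ext; ring
  have hint : Integrable (fun s' => L s') (M.P (s, a)) := by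
    rw [h1]; exact (hL.integrable_sub s a).add (integrable_const _)
  rw [← ofReal_integral_eq_lintegral_ofReal hint (ae_of_all _ hL.nonneg)]
  congr 1
  rw [h1, integral_add (hL.integrable_sub s a) (integrable_const _)]
  simp [add_comm]

/-- For `|x| ≤ 1` one has `exp x ≤ 1 + x + x²`; with `x = η (L s' - L s)` and `|x| ≤ η ν` this
yields a bound affine in the drift, as needed for averaging over actions. -/
lemma lintegral_exp_L {η : ℝ} (hη : 0 ≤ η) (hην : η * ν ≤ 1) (s : X) (a : A) :
    ∫⁻ s', ENNReal.ofReal (Real.exp (η * L s')) ∂(M.P (s, a)) ≤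
    ENNReal.ofReal (Real.exp (η * L s) * (1 + η ^ 2 * ν ^ 2) +
      (η * Real.exp (η * L s)) * ∫ s', (L s' - L s) ∂(M.P (s, a))) := by
  have hpt : ∀ᵐ s' ∂(M.P (s, a)), Real.exp (η * L s') ≤
      Real.exp (η * L s) * (1 + η ^ 2 * ν ^ 2) + (η * Real.exp (η * L s)) * (L s' - L s) := by
    filter_upwards [hL.increment s a] with s' h
    set x := η * (L s' - L s) with hx
    have hxabs : |x| ≤ η * ν := by
      rw [hx, abs_mul, abs_of_nonneg hη]
      exact mul_le_mul_of_nonneg_left h.1 hη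
    have hexp := (abs_le.1 (Real.abs_exp_sub_one_sub_id_le (hxabs.trans hην))).2
    have hx2 : x ^ 2 ≤ η ^ 2 * ν ^ 2 := by
      rw [← sq_abs, ← mul_pow]
      exact pow_le_pow_left₀ (abs_nonneg x) hxabs 2
    have he : Real.exp (η * L s') = Real.exp (η * L s) * Real.exp x := by
      rw [← Real.exp_add, hx]; congr 1; ring
    rw [he]
    calc _ ≤ Real.exp (η * L s) * (1 + η ^ 2 * ν ^ 2 + x) :=
          mul_le_mul_of_nonneg_left (by linarith) (Real.exp_pos _).le
      _ = _ := by rw [hx]; ring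
  have hint : Integrable (fun s' => Real.exp (η * L s) * (1 + η ^ 2 * ν ^ 2) +
      (η * Real.exp (η * L s)) * (L s' - L s)) (M.P (s, a)) :=
    (integrable_const _).add ((hL.integrable_sub s a).const_mul _)
  calc _ ≤ ∫⁻ s', ENNReal.ofReal (Real.exp (η * L s) * (1 + η ^ 2 * ν ^ 2) +
      (η * Real.exp (η * L s)) * (L s' - L s)) ∂(M.P (s, a)) := by
        refine lintegral_mono_ae ?_
        filter_upwards [hpt] with s' h using ENNReal.ofReal_le_ofReal h
    _ = _ := by
        rw [← ofReal_integral_eq_lintegral_ofReal hint, integral_add (integrable_const _)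
          ((hL.integrable_sub s a).const_mul _), integral_const_mul (η * Real.exp (η * L s))]
        · simp
        · filter_upwards [hpt] with s' h using (Real.exp_pos _).le.trans h

lemma lintegral_exp_L_le {η : ℝ} (hη : 0 ≤ η) (s : X) (a : A) :
    ∫⁻ s', ENNReal.ofReal (Real.exp (η * L s')) ∂(M.P (s, a)) ≤
      ENNReal.ofReal (Real.exp (η * (L s + ν))) := by
  calc _ ≤ ∫⁻ _, ENNReal.ofReal (Real.exp (η * (L s + ν))) ∂(M.P (s, a)) := by
        refine lintegral_mono_ae ?_
        filter_upwards [hL.increment s a] with s' h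
        gcongr
        linarith [(abs_le.1 h.1).2]
    _ = _ := by simp

/-- The drift is an average of increments of size at most `ν`. One state above level `B` is enough,
and unboundedness of the state space provides it. -/
lemma alpha_le_nu {s : X} (hs : B < L s) : α ≤ ν := by
  have h := hL.drift s hs
  have hge : -ν ≤ ∑ a, M.optPolicy s a * ∫ s', (L s' - L s) ∂(M.P (s, a)) := by
    calc -ν = ∑ a, M.optPolicy s a * (-ν) := by rw [← Finset.sum_mul, M.sum_optPolicy s, one_mul]
      _ ≤ _ := by
          refine Finset.sum_le_sum fun a _ => mul_le_mul_of_nonneg_left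
            (abs_le.1 (hL.abs_drift_le s a)).1 (M.optPolicy_nonneg s a)
  linarith

/-- If the policy is a Boltzmann policy with a small enough parameter `τ` for estimates of `Q*` with
an expected error of the order of `τ²`, then an affine bound in terms of the increment of `L`
improves on average. -/
lemma lintegral_closedLoop_le_of_drift (hgap : 0 < M.minGap)
    (ϖ : Kernel X (A → ℝ)) [IsMarkovKernel ϖ] {τ : ℝ} (hτ : 0 < τ) (hτα : τ ≤ M.tauThreshold ν α)
    {s : X} (hacc : ∫⁻ q, ENNReal.ofReal ‖q - M.optQ s‖ ∂(ϖ s) ≤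
      ENNReal.ofReal (4 * τ ^ 2 * M.Vmax))
    (hs : B < L s) {f : X → ℝ≥0∞} (hf : Measurable f) {u w : ℝ} (hw : 0 ≤ w)
    (h0 : ∀ a, 0 ≤ u + w * ∫ s', (L s' - L s) ∂(M.P (s, a)))
    (hfP : ∀ a, ∫⁻ s', f s' ∂(M.P (s, a)) ≤
      ENNReal.ofReal (u + w * ∫ s', (L s' - L s) ∂(M.P (s, a)))) :
    ∫⁻ s', f s' ∂(M.closedLoop (boltzmann τ ∘ₖ ϖ) s) ≤ ENNReal.ofReal (u - w * (α / 2)) := by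
  set D : A → ℝ := fun a => ∫ s', (L s' - L s) ∂(M.P (s, a)) with hD
  have hα := hL.α_pos
  have hν := hL.ν_pos
  have hαν := hL.alpha_le_nu hs
  have hA : (1 : ℝ) ≤ Fintype.card A := by exact_mod_cast Fintype.card_pos
  obtain ⟨hτ0, hτ1, hτ2⟩ := M.tauThreshold_spec hgap hα hαν
  -- The comparison goes through the Boltzmann distribution of `Q*` itself: the first term is the
  -- Lipschitz cost of the estimation error, the second the bias of the temperature, at most `2 |A|
  -- · α / (24 ν |A|)`.
  have hunif : ∀ q, ∑ a, |softmax τ q a - M.optPolicy s a| ≤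
      4 * ‖q - M.optQ s‖ / τ + α / (12 * ν) := by
    intro q
    have h1 := sum_abs_softmax_sub_le hτ q (M.optQ s)
    have h2 := sum_abs_softmax_sub_uniform_le hτ (M.optQ s) (M.optActions s)
      (M.optActions_nonempty s) (fun a ha => M.optQ_eq_maxA_of_mem ha) (hτ2 s)
    have hexp : Real.exp (-(M.tauThreshold ν α * Real.log (24 * ν * (Fintype.card A : ℝ) / α)) / τ) ≤
        α / (24 * ν * Fintype.card A) := by
      have hlog : 0 < Real.log (24 * ν * (Fintype.card A : ℝ) / α) :=
        Real.log_pos (one_lt_ratio hα hαν)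
      have : -(M.tauThreshold ν α * Real.log (24 * ν * (Fintype.card A : ℝ) / α)) / τ ≤
          -Real.log (24 * ν * (Fintype.card A : ℝ) / α) := by
        rw [neg_div, neg_le_neg_iff, le_div_iff₀ hτ]
        nlinarith
      refine (Real.exp_le_exp.2 this).trans_eq ?_
      rw [Real.exp_neg, Real.exp_log (by positivity), inv_div]
    have h3 : 2 * Fintype.card A *
        Real.exp (-(M.tauThreshold ν α * Real.log (24 * ν * (Fintype.card A : ℝ) / α)) / τ) ≤
        α / (12 * ν) := by
      calc _ ≤ 2 * Fintype.card A * (α / (24 * ν * Fintype.card A)) := by gcongr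
        _ = _ := by field_simp; norm_num
    calc _ ≤ ∑ a, (|softmax τ q a - softmax τ (M.optQ s) a| +
          |softmax τ (M.optQ s) a - M.optPolicy s a|) :=
          Finset.sum_le_sum fun a _ => abs_sub_le _ _ _
      _ ≤ _ := by
          rw [Finset.sum_add_distrib]
          simp only [optPolicy_eq_indicator]
          linarith
  have hpt : ∀ q, ∑ a, softmax τ q a * (u + w * D a) ≤
      (u - w * α + w * (α / 12)) + (w * ν * (4 / τ)) * ‖q - M.optQ s‖ := by
    intro q
    have h1 : ∑ a, softmax τ q a * D a ≤ -α + ν * (4 * ‖q - M.optQ s‖ / τ + α / (12 * ν)) := by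
      calc _ = ∑ a, (M.optPolicy s a * D a + (softmax τ q a - M.optPolicy s a) * D a) :=
            Finset.sum_congr rfl fun a _ => by ring
        _ ≤ ∑ a, M.optPolicy s a * D a + ν * ∑ a, |softmax τ q a - M.optPolicy s a| := by
            rw [Finset.sum_add_distrib, Finset.mul_sum]
            refine add_le_add_right (Finset.sum_le_sum fun a _ => ?_) _
            rw [mul_comm ν]
            refine (le_abs_self _).trans ?_
            rw [abs_mul]
            exact mul_le_mul_of_nonneg_left (hL.abs_drift_le s a) (abs_nonneg _)
        _ ≤ _ := add_le_add (hL.drift s hs) (mul_le_mul_of_nonneg_left (hunif q) hν.le)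
    have h2 : ∑ a, softmax τ q a * (u + w * D a) = u + w * ∑ a, softmax τ q a * D a := by
      rw [Finset.mul_sum]
      calc _ = ∑ a, (softmax τ q a * u + w * (softmax τ q a * D a)) :=
            Finset.sum_congr rfl fun a _ => by ring
        _ = _ := by rw [Finset.sum_add_distrib, ← Finset.sum_mul, sum_softmax, one_mul]
    rw [h2]
    have h3 : ν * (4 * ‖q - M.optQ s‖ / τ + α / (12 * ν)) =
        ν * (4 / τ) * ‖q - M.optQ s‖ + α / 12 := by
      field_simp
    rw [h3] at h1
    have := mul_le_mul_of_nonneg_left h1 hw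
    linarith
  -- `ENNReal.ofReal` truncates at `0`, so splitting a sum later requires this sign. It holds
  -- because the affine bounds are nonnegative for each action, hence also on average under the
  -- optimal policy.
  have hx0 : 0 ≤ u - w * α := by
    have h1 : 0 ≤ ∑ a, M.optPolicy s a * (u + w * D a) := by
      refine Finset.sum_nonneg fun a _ => mul_nonneg (M.optPolicy_nonneg s a) (h0 a)
    have h2 : ∑ a, M.optPolicy s a * (u + w * D a) = u + w * ∑ a, M.optPolicy s a * D a := by
      rw [Finset.mul_sum]
      calc _ = ∑ a, (M.optPolicy s a * u + w * (M.optPolicy s a * D a)) :=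
            Finset.sum_congr rfl fun a _ => by ring
        _ = _ := by rw [Finset.sum_add_distrib, ← Finset.sum_mul, M.sum_optPolicy s, one_mul]
    have h3 := mul_le_mul_of_nonneg_left (hL.drift s hs) hw
    have h4 : w * ∑ a, M.optPolicy s a * D a ≤ w * -α := h3
    linarith
  have hc : 0 ≤ w * ν * (4 / τ) := by positivity
  -- The expected error `4 τ² Vmax` times the Lipschitz constant `4 / τ` is `16 τ Vmax`. In total
  -- the drift is at most `-α + α/12 + α/3 = -7α/12`, which is below `-α/2`.
  have hτV : ν * (16 * τ * M.Vmax) ≤ α / 3 := by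
    have hγ : 0 < 1 - M.γ := sub_pos.2 M.γ_lt_one
    have hR := M.Rmax_pos
    have h1 : τ ≤ (1 - M.γ) * α / (48 * M.Rmax * ν) := by
      refine hτα.trans (hτ1.trans ?_)
      refine div_le_div_of_nonneg_left (by positivity) (by positivity) ?_
      have hA2 : (1 : ℝ) ≤ (Fintype.card A : ℝ) ^ 2 := one_le_pow₀ hA
      have : 0 < 48 * M.Rmax * ν := by positivity
      nlinarith
    rw [le_div_iff₀ (by positivity)] at h1
    unfold Vmax
    rw [← mul_div_assoc, ← mul_div_assoc, div_le_iff₀ hγ]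
    linarith
  have hnorm : Measurable fun q : A → ℝ => ENNReal.ofReal ‖q - M.optQ s‖ := by fun_prop
  rw [lintegral_closedLoop_boltzmann M ϖ τ s hf]
  calc _ ≤ ∫⁻ q, (ENNReal.ofReal (u - w * α + w * (α / 12)) +
        ENNReal.ofReal (w * ν * (4 / τ)) * ENNReal.ofReal ‖q - M.optQ s‖) ∂(ϖ s) := by
        refine lintegral_mono fun q => ?_
        calc _ ≤ ∑ a, ENNReal.ofReal (softmax τ q a) * ENNReal.ofReal (u + w * D a) := by
              gcongr with a
              exact hfP a
          _ = ENNReal.ofReal (∑ a, softmax τ q a * (u + w * D a)) := by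
              rw [ENNReal.ofReal_sum_of_nonneg fun a _ => mul_nonneg (softmax_nonneg τ q a) (h0 a)]
              exact Finset.sum_congr rfl fun a _ =>
                (ENNReal.ofReal_mul (softmax_nonneg τ q a)).symm
          _ ≤ ENNReal.ofReal ((u - w * α + w * (α / 12)) +
                (w * ν * (4 / τ)) * ‖q - M.optQ s‖) := ENNReal.ofReal_le_ofReal (hpt q)
          _ ≤ _ := by
              rw [← ENNReal.ofReal_mul hc]
              exact ENNReal.ofReal_add_le
    _ = ENNReal.ofReal (u - w * α + w * (α / 12)) +
        ENNReal.ofReal (w * ν * (4 / τ)) * ∫⁻ q, ENNReal.ofReal ‖q - M.optQ s‖ ∂(ϖ s) := by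
        rw [lintegral_add_left measurable_const, lintegral_const_mul _ hnorm]
        simp
    _ ≤ ENNReal.ofReal (u - w * α + w * (α / 12)) +
        ENNReal.ofReal (w * ν * (4 / τ)) * ENNReal.ofReal (4 * τ ^ 2 * M.Vmax) := by gcongr
    _ = ENNReal.ofReal (u - w * α + w * (α / 12) + w * ν * (4 / τ) * (4 * τ ^ 2 * M.Vmax)) := by
        rw [← ENNReal.ofReal_mul hc, ← ENNReal.ofReal_add]
        · have : 0 ≤ w * (α / 12) := by positivity
          linarith
        · have := M.Vmax_pos
          positivity
    _ ≤ _ := by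
        refine ENNReal.ofReal_le_ofReal ?_
        have h1 : w * ν * (4 / τ) * (4 * τ ^ 2 * M.Vmax) = w * (ν * (16 * τ * M.Vmax)) := by
          field_simp; ring
        rw [h1]
        have := mul_le_mul_of_nonneg_left hτV hw
        nlinarith

lemma nonneg_exp_affine {η : ℝ} (hη : 0 ≤ η) (hην : η * ν ≤ 1) (s : X) (a : A) :
    0 ≤ Real.exp (η * L s) * (1 + η ^ 2 * ν ^ 2) +
      (η * Real.exp (η * L s)) * ∫ s', (L s' - L s) ∂(M.P (s, a)) := by
  have h := (abs_le.1 (hL.abs_drift_le s a)).1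
  have h1 : -1 ≤ η * ∫ s', (L s' - L s) ∂(M.P (s, a)) := by nlinarith
  have h2 : 0 ≤ 1 + η ^ 2 * ν ^ 2 + η * ∫ s', (L s' - L s) ∂(M.P (s, a)) := by
    nlinarith [mul_nonneg (sq_nonneg η) (sq_nonneg ν)]
  have := mul_nonneg (Real.exp_pos (η * L s)).le h2
  linarith

end IsLyapunov

end MDP

/-! ### The sequence of parameters and a summability estimate -/

lemma dyadic_pos (k : ℕ) : 0 < dyadic k := by unfold dyadic; positivity

lemma dyadic_le_one (k : ℕ) : dyadic k ≤ 1 :=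
  pow_le_one₀ (by norm_num) (by norm_num)

lemma dyadic_antitone : Antitone dyadic := fun _ _ h =>
  pow_le_pow_of_le_one (by norm_num) (by norm_num) h

lemma exists_dyadic_le {r : ℝ} (hr : 0 < r) : ∃ k, dyadic k ≤ r := by
  obtain ⟨k, hk⟩ := exists_pow_lt_of_lt_one hr (by norm_num : (1 / 2 : ℝ) < 1)
  exact ⟨k, hk.le⟩

lemma le_nextIndex {X : Type*} (size : X → ℝ) (t : ℕ) (p : X × ℕ) : p.2 ≤ nextIndex size t p := by
  unfold nextIndex; split_ifs <;> omega

/-- Once `log n ≥ 2 / a`, the term is at most `n⁻²`. This is what makes `log² t` a workable size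
threshold for every rate `a`: a multiple of `log t` would need a sufficiently large constant. -/
lemma summable_exp_neg_log_sq {a : ℝ} (ha : 0 < a) :
    Summable fun n : ℕ => Real.exp (-(a * Real.log n ^ 2)) := by
  refine Summable.of_norm_bounded_eventually_nat
    (Real.summable_one_div_nat_pow.2 (by norm_num : 1 < 2)) ?_
  have h1 : Tendsto (fun n : ℕ => Real.log n) atTop atTop :=
    Real.tendsto_log_atTop.comp tendsto_natCast_atTop_atTop
  filter_upwards [h1.eventually_ge_atTop (2 / a), h1.eventually_ge_atTop 0,
    eventually_gt_atTop 0] with n hn hn0 hpos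
  have hnpos : (0 : ℝ) < n := by exact_mod_cast hpos
  rw [Real.norm_eq_abs, abs_of_pos (Real.exp_pos _)]
  have h2 : 2 * Real.log n ≤ a * Real.log n ^ 2 := by
    rw [div_le_iff₀ ha] at hn
    nlinarith
  calc _ ≤ Real.exp (-(2 * Real.log n)) := Real.exp_le_exp.2 (by linarith)
    _ = 1 / (n : ℝ) ^ 2 := by
        rw [Real.exp_neg, one_div, mul_comm, Real.exp_mul, Real.exp_log hnpos]
        norm_cast

/-! ### Moments, stability and the dichotomy for the adaptive scheme -/

namespace MDP

variable {X A : Type*} [MeasurableSpace X] [MeasurableSpace A] (M : MDP X A)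
  [Fintype A] [Nonempty A] [DiscreteMeasurableSpace A]
  (oracle : ℕ → Kernel X (A → ℝ)) [∀ k, IsMarkovKernel (oracle k)] {size : X → ℝ}
  (hsize : Measurable size)

lemma lintegral_adaptiveStep_fst (t : ℕ) (p : X × ℕ) {f : X → ℝ≥0∞} (hf : Measurable f) :
    ∫⁻ z, f z.1 ∂(M.adaptiveStep oracle hsize t p) =
      ∫⁻ s', f s' ∂(M.closedLoop (boltzmann (Real.sqrt (dyadic p.2)) ∘ₖ oracle p.2) p.1) := by
  have h : Kernel.fst (M.adaptiveStep oracle hsize t) =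
      kernelSwitch (fun k => M.closedLoop (boltzmann (Real.sqrt (dyadic k)) ∘ₖ oracle k)) := by
    unfold adaptiveStep
    exact Kernel.fst_prod _ _
  rw [← Kernel.lintegral_fst _ _ hf, h]
  rfl

lemma ae_adaptiveStep_snd (t : ℕ) (p : X × ℕ) :
    ∀ᵐ z ∂(M.adaptiveStep oracle hsize t p), z.2 = nextIndex size t p := by
  have h : Kernel.snd (M.adaptiveStep oracle hsize t) =
      Kernel.deterministic (nextIndex size t) (measurable_nextIndex hsize t) := by
    unfold adaptiveStep
    exact Kernel.snd_prod _ _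
  have h2 : ∀ᵐ k ∂(Kernel.snd (M.adaptiveStep oracle hsize t) p), k = nextIndex size t p := by
    rw [h, Kernel.deterministic_apply, ae_dirac_eq]
    rfl
  rw [Kernel.snd_apply] at h2
  exact ae_of_ae_map measurable_snd.aemeasurable h2

lemma ae_adaptiveLaw_index (t₀ : ℕ) (p : X × ℕ) :
    ∀ᵐ ω ∂(M.adaptiveLaw oracle hsize t₀ p), ∀ n,
      (ω (n + 1)).2 = nextIndex size (t₀ + n) (ω n) := by
  rw [ae_all_iff]
  intro n
  refine ae_pathLaw_step (fun n => M.adaptiveStep oracle hsize (t₀ + n)) p n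
    (r := {z | z.2.2 = nextIndex size (t₀ + n) z.1}) ?_ fun x => M.ae_adaptiveStep_snd oracle hsize _ x
  exact measurableSet_eq_fun (measurable_snd.comp measurable_snd)
    ((measurable_nextIndex hsize _).comp measurable_fst)

/-- The pairs of a state and of an index of a parameter that is at most `δ`. -/
def smallParameter (X : Type*) (δ : ℝ) : Set (X × ℕ) := {p | dyadic p.2 ≤ δ}

lemma measurableSet_smallParameter (δ : ℝ) : MeasurableSet (smallParameter X δ) :=
  measurable_snd (MeasurableSet.of_discrete (s := {k | dyadic k ≤ δ}))

lemma ae_mem_smallParameter {δ : ℝ} (t : ℕ) {p : X × ℕ} (hp : p ∈ smallParameter X δ) :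
    ∀ᵐ z ∂(M.adaptiveStep oracle hsize t p), z ∈ smallParameter X δ := by
  filter_upwards [M.ae_adaptiveStep_snd oracle hsize t p] with z hz
  have : dyadic z.2 ≤ dyadic p.2 := dyadic_antitone (hz ▸ le_nextIndex size t p)
  exact this.trans hp

variable {M}

namespace IsLyapunov

variable {E : Type*} [NormedAddCommGroup E] {pos : X → E} {L : X → ℝ} {ν ν' B α : ℝ}
  (hL : M.IsLyapunov pos L ν ν' B α)

include hL

/-- A geometric drift condition for `exp (η L)`. -/
lemma geometric_drift (hgap : 0 < M.minGap) (hαν : α ≤ ν)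
    (hacc : ∀ k s, ∫⁻ q, ENNReal.ofReal ‖q - M.optQ s‖ ∂(oracle k s) ≤
      ENNReal.ofReal (4 * dyadic k * M.Vmax)) (t : ℕ) {p : X × ℕ}
    (hp : p ∈ smallParameter X (M.deltaThreshold ν α)) :
    ∫⁻ z, ENNReal.ofReal (Real.exp (α / (4 * ν ^ 2) * L z.1)) ∂(M.adaptiveStep oracle hsize t p) ≤
      ENNReal.ofReal (1 - α ^ 2 / (16 * ν ^ 2)) *
        ENNReal.ofReal (Real.exp (α / (4 * ν ^ 2) * L p.1)) +
      ENNReal.ofReal (Real.exp (α / (4 * ν ^ 2) * (B + ν))) := by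
  have hα := hL.α_pos
  have hν := hL.ν_pos
  -- This `η` minimizes the one-step exponent bound `-η α / 2 + η² ν²`, with minimum `-α² / (16
  -- ν²)`; it also satisfies `η ν ≤ 1/4`.
  set η := α / (4 * ν ^ 2) with hη
  have hη0 : 0 ≤ η := by positivity
  have hην : η * ν ≤ 1 := by
    rw [hη, div_mul_eq_mul_div, div_le_one (by positivity)]
    nlinarith
  have hmeas : Measurable fun s => ENNReal.ofReal (Real.exp (η * L s)) :=
    (Real.measurable_exp.comp (hL.measurable.const_mul η)).ennreal_ofReal
  rw [lintegral_adaptiveStep_fst M oracle hsize t p hmeas]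
  by_cases hB : B < L p.1
  · have hτ0 := (M.tauThreshold_spec hgap hα hαν).1
    have hsq : Real.sqrt (dyadic p.2) ^ 2 = dyadic p.2 := Real.sq_sqrt (dyadic_pos _).le
    have hτα : Real.sqrt (dyadic p.2) ≤ M.tauThreshold ν α := Real.sqrt_le_iff.2 ⟨hτ0.le, hp⟩
    refine le_add_right ?_
    refine (hL.lintegral_closedLoop_le_of_drift hgap (oracle p.2) (Real.sqrt_pos.2 (dyadic_pos _))
      hτα (by rw [hsq]; exact hacc _ _) hB hmeas (by positivity)
      (hL.nonneg_exp_affine hη0 hην p.1) (hL.lintegral_exp_L hη0 hην p.1)).trans ?_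
    rw [← ENNReal.ofReal_mul' (Real.exp_pos _).le]
    refine ENNReal.ofReal_le_ofReal (le_of_eq ?_)
    have : α ^ 2 / (16 * ν ^ 2) = η * (α / 2) - η ^ 2 * ν ^ 2 := by
      rw [hη]; field_simp; norm_num
    rw [this]
    ring
  -- Below level `B` nothing is known about the drift, but one step raises `L` by at most `ν`, so
  -- the additive constant alone is a bound.
  · refine le_add_left ?_
    refine M.lintegral_closedLoop_boltzmann_le (oracle p.2) _ p.1 hmeas fun a => ?_
    refine (hL.lintegral_exp_L_le hη0 p.1 a).trans (ENNReal.ofReal_le_ofReal ?_)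
    gcongr
    exact not_lt.1 hB

lemma additive_drift (hgap : 0 < M.minGap) (hαν : α ≤ ν)
    (hacc : ∀ k s, ∫⁻ q, ENNReal.ofReal ‖q - M.optQ s‖ ∂(oracle k s) ≤
      ENNReal.ofReal (4 * dyadic k * M.Vmax)) (t : ℕ) {p : X × ℕ}
    (hp : p ∈ smallParameter X (M.deltaThreshold ν α)) (hB : B < L p.1) :
    ∫⁻ z, ENNReal.ofReal (L z.1) ∂(M.adaptiveStep oracle hsize t p) + ENNReal.ofReal (α / 2) ≤
      ENNReal.ofReal (L p.1) := by
  have hα := hL.α_pos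
  have hτ0 := (M.tauThreshold_spec hgap hα hαν).1
  have hsq : Real.sqrt (dyadic p.2) ^ 2 = dyadic p.2 := Real.sq_sqrt (dyadic_pos _).le
  have hτα : Real.sqrt (dyadic p.2) ≤ M.tauThreshold ν α := Real.sqrt_le_iff.2 ⟨hτ0.le, hp⟩
  rw [lintegral_adaptiveStep_fst M oracle hsize t p hL.measurable.ennreal_ofReal]
  have hnn : ∀ a, 0 ≤ L p.1 + 1 * ∫ s', (L s' - L p.1) ∂(M.P (p.1, a)) := fun a => by
    have hint : Integrable L (M.P (p.1, a)) := by
      have := (hL.integrable_sub p.1 a).add (integrable_const (L p.1))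
      simpa [Pi.add_def] using this
    rw [integral_sub hint (integrable_const _)]
    simpa using integral_nonneg hL.nonneg
  have hkey := hL.lintegral_closedLoop_le_of_drift hgap (oracle p.2)
    (Real.sqrt_pos.2 (dyadic_pos _)) hτα (by rw [hsq]; exact hacc _ _) hB
    hL.measurable.ennreal_ofReal zero_le_one hnn fun a => (hL.lintegral_L p.1 a).le
  -- This prevents truncation in `ENNReal.ofReal (L - α / 2)`. Since `L` stays nonnegative while the
  -- optimal policy lowers it by `α` on average, even `L ≥ α` holds here.
  have hle : α / 2 ≤ L p.1 := by
    have hsum : 0 ≤ L p.1 - α := by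
      have h1 : 0 ≤ ∑ a, M.optPolicy p.1 a *
          (L p.1 + 1 * ∫ s', (L s' - L p.1) ∂(M.P (p.1, a))) :=
        Finset.sum_nonneg fun a _ => mul_nonneg (M.optPolicy_nonneg _ a) (hnn a)
      simp only [one_mul, mul_add, Finset.sum_add_distrib, ← Finset.sum_mul,
        M.sum_optPolicy] at h1
      linarith [hL.drift p.1 hB]
    linarith
  calc _ ≤ ENNReal.ofReal (L p.1 - 1 * (α / 2)) + ENNReal.ofReal (α / 2) := by gcongr
    _ = _ := by
        rw [← ENNReal.ofReal_add (by linarith) (by linarith)]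
        congr 1; ring

/-- Whatever the parameter, a step multiplies `exp (η L)` by at most `exp (η ν)`. Thus the moment is
still finite at whichever fixed time the small-parameter regime is taken to start. -/
lemma lintegral_exp_lt_top (t₀ : ℕ) (p : X × ℕ) (n : ℕ) :
    ∫⁻ ω, ENNReal.ofReal (Real.exp (α / (4 * ν ^ 2) * L (ω n).1))
      ∂(M.adaptiveLaw oracle hsize t₀ p) < ∞ := by
  have hα := hL.α_pos
  have hν := hL.ν_pos
  set η := α / (4 * ν ^ 2) with hη
  have hη0 : 0 ≤ η := by positivity
  have hmeas : Measurable fun s => ENNReal.ofReal (Real.exp (η * L s)) :=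
    (Real.measurable_exp.comp (hL.measurable.const_mul η)).ennreal_ofReal
  have hmeas' : Measurable fun z : X × ℕ => ENNReal.ofReal (Real.exp (η * L z.1)) :=
    hmeas.comp measurable_fst
  unfold adaptiveLaw
  induction n with
  | zero =>
    rw [lintegral_pathLaw_eval_zero _ p hmeas']
    exact ENNReal.ofReal_lt_top
  | succ n ih =>
    rw [lintegral_pathLaw_eval_succ _ p n hmeas']
    calc _ ≤ ∫⁻ ω, ENNReal.ofReal (Real.exp (η * ν)) *
          ENNReal.ofReal (Real.exp (η * L (ω n).1))
          ∂(pathLaw (fun n => M.adaptiveStep oracle hsize (t₀ + n)) p) := by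
          refine lintegral_mono fun ω => ?_
          rw [lintegral_adaptiveStep_fst M oracle hsize _ _ hmeas]
          refine M.lintegral_closedLoop_boltzmann_le (oracle _) _ _ hmeas fun a => ?_
          refine (hL.lintegral_exp_L_le hη0 _ a).trans_eq ?_
          rw [← ENNReal.ofReal_mul (Real.exp_pos _).le, ← Real.exp_add]
          congr 2; ring
      _ < ∞ := by
          have hm : Measurable fun ω : ℕ → X × ℕ => ENNReal.ofReal (Real.exp (η * L (ω n).1)) :=
            hmeas'.comp (measurable_pi_apply n)
          rw [lintegral_const_mul _ hm]
          exact ENNReal.mul_lt_top ENNReal.ofReal_lt_top ih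

/-- Exponential moments stay bounded once the parameter is small. -/
lemma exists_moment_bound (hgap : 0 < M.minGap) (hαν : α ≤ ν)
    (hacc : ∀ k s, ∫⁻ q, ENNReal.ofReal ‖q - M.optQ s‖ ∂(oracle k s) ≤
      ENNReal.ofReal (4 * dyadic k * M.Vmax)) :
    ∃ (ρ D : ℝ≥0∞), ρ < 1 ∧ D < ∞ ∧ ∀ (t₀ : ℕ) (p : X × ℕ) (T n : ℕ),
      ∫⁻ ω, (smallParameter X (M.deltaThreshold ν α)).indicator 1 (ω T) *
        ENNReal.ofReal (Real.exp (α / (4 * ν ^ 2) * L (ω (T + n)).1))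
        ∂(M.adaptiveLaw oracle hsize t₀ p) ≤
      ρ ^ n * ∫⁻ ω, ENNReal.ofReal (Real.exp (α / (4 * ν ^ 2) * L (ω T).1))
        ∂(M.adaptiveLaw oracle hsize t₀ p) + D := by
  have hα := hL.α_pos
  have hν := hL.ν_pos
  have hρ : ENNReal.ofReal (1 - α ^ 2 / (16 * ν ^ 2)) < 1 := by
    rw [← ENNReal.ofReal_one, ENNReal.ofReal_lt_ofReal_iff one_pos]
    have : 0 < α ^ 2 / (16 * ν ^ 2) := by positivity
    linarith
  refine ⟨ENNReal.ofReal (1 - α ^ 2 / (16 * ν ^ 2)), ENNReal.ofReal (Real.exp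
    (α / (4 * ν ^ 2) * (B + ν))) * (1 - ENNReal.ofReal (1 - α ^ 2 / (16 * ν ^ 2)))⁻¹, hρ,
    ENNReal.mul_lt_top ENNReal.ofReal_lt_top ?_, fun t₀ p T n => ?_⟩
  · rw [ENNReal.inv_lt_top]
    exact tsub_pos_of_lt hρ
  · exact lintegral_pathLaw_le_of_geometric_drift
      (fun n => M.adaptiveStep oracle hsize (t₀ + n)) p
      (V := fun z => ENNReal.ofReal (Real.exp (α / (4 * ν ^ 2) * L z.1)))
      ((Real.measurable_exp.comp ((hL.measurable.comp measurable_fst).const_mul _)).ennreal_ofReal)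
      (measurableSet_smallParameter _)
      (fun n x hx => M.ae_mem_smallParameter oracle hsize _ hx)
      (fun n x hx => hL.geometric_drift oracle hsize hgap hαν hacc _ hx) T n

/-- The bounded sets are sublevel sets of `L`. Markov's inequality for the exponential moment gives
tightness, and the additive drift gives the hitting time bound `2 L(s) / α`, free of `t` and `j`. -/
lemma stableFrom (hgap : 0 < M.minGap) (hαν : α ≤ ν)
    (hacc : ∀ k s, ∫⁻ q, ENNReal.ofReal ‖q - M.optQ s‖ ∂(oracle k s) ≤
      ENNReal.ofReal (4 * dyadic k * M.Vmax)) (t₀ : ℕ) {k : ℕ}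
    (hk : dyadic k ≤ M.deltaThreshold ν α) : M.StableFrom pos oracle hsize t₀ k := by
  have hα := hL.α_pos
  have hν := hL.ν_pos
  obtain ⟨ρ, D, hρ, hD, hmom⟩ := hL.exists_moment_bound oracle hsize hgap hαν hacc
  set η := α / (4 * ν ^ 2) with hη
  have hη0 : 0 < η := by positivity
  intro θ hθ
  -- The `1` in `D + 1` absorbs the initial moment, whose contribution decays geometrically; `B ≤ ℓ`
  -- ensures that the drift condition holds off the sublevel set.
  obtain ⟨ℓ, hℓB, hℓ⟩ : ∃ ℓ, B ≤ ℓ ∧ (D + 1).toReal * Real.exp (-(η * ℓ)) ≤ θ := by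
    have h1 : Tendsto (fun ℓ : ℝ => (D + 1).toReal * Real.exp (-(η * ℓ))) atTop
        (nhds ((D + 1).toReal * 0)) :=
      (Real.tendsto_exp_neg_atTop_nhds_zero.comp (tendsto_id.const_mul_atTop hη0)).const_mul _
    rw [mul_zero] at h1
    obtain ⟨ℓ, h2, h3⟩ := ((h1.eventually_le_const hθ.1).and (eventually_ge_atTop B)).exists
    exact ⟨ℓ, h3, h2⟩
  have hBm : MeasurableSet {s | L s ≤ ℓ} := measurableSet_le hL.measurable measurable_const
  refine ⟨{s | L s ≤ ℓ}, hBm, ?_, fun s => ?_, fun s => ?_⟩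
  · obtain ⟨b, hb⟩ := hL.bdd ℓ
    rw [isBounded_iff_forall_norm_le]
    refine ⟨b, ?_⟩
    rintro _ ⟨s, hs, rfl⟩
    exact hb ⟨s, hs, rfl⟩
  · set μ := M.adaptiveLaw oracle hsize t₀ (s, k) with hμ
    have hstart : ∀ᵐ ω ∂μ, ω 0 ∈ smallParameter X (M.deltaThreshold ν α) :=
      ae_pathLaw_zero _ _ (measurableSet_smallParameter _) hk
    have hinit : ∫⁻ ω, ENNReal.ofReal (Real.exp (η * L (ω 0).1)) ∂μ < ∞ :=
      hL.lintegral_exp_lt_top oracle hsize t₀ (s, k) 0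
    have hlim : Tendsto (fun n : ℕ => ρ ^ n * ∫⁻ ω, ENNReal.ofReal (Real.exp (η * L (ω 0).1)) ∂μ)
        atTop (nhds 0) := by
      have := ENNReal.Tendsto.mul_const (ENNReal.tendsto_pow_atTop_nhds_zero_of_lt_one hρ)
        (b := ∫⁻ ω, ENNReal.ofReal (Real.exp (η * L (ω 0).1)) ∂μ) (Or.inr hinit.ne)
      rwa [zero_mul] at this
    refine limsup_le_of_le (by isBoundedDefault) ?_
    filter_upwards [hlim.eventually_le_const one_pos] with n hn
    have hmn : ∫⁻ ω, ENNReal.ofReal (Real.exp (η * L (ω n).1)) ∂μ ≤ D + 1 := by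
      have h1 := hmom t₀ (s, k) 0 n
      rw [zero_add, ← hμ] at h1
      calc _ = ∫⁻ ω, (smallParameter X (M.deltaThreshold ν α)).indicator 1 (ω 0) *
            ENNReal.ofReal (Real.exp (η * L (ω n).1)) ∂μ := by
            refine lintegral_congr_ae ?_
            filter_upwards [hstart] with ω hω
            simp [hω]
        _ ≤ _ := h1
        _ ≤ 1 + D := by gcongr
        _ = _ := add_comm _ _
    have hV : Measurable fun ω : ℕ → X × ℕ => ENNReal.ofReal (Real.exp (η * L (ω n).1)) :=
      (Real.measurable_exp.comp ((hL.measurable.comp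
        (measurable_fst.comp (measurable_pi_apply n))).const_mul _)).ennreal_ofReal
    calc μ {ω | (ω n).1 ∉ {s | L s ≤ ℓ}}
        ≤ μ {ω | ENNReal.ofReal (Real.exp (η * ℓ)) ≤
            ENNReal.ofReal (Real.exp (η * L (ω n).1))} := by
          refine measure_mono fun ω hω => ?_
          have hlt : ℓ < L (ω n).1 := not_le.1 hω
          refine ENNReal.ofReal_le_ofReal (Real.exp_le_exp.2 ?_)
          exact mul_le_mul_of_nonneg_left hlt.le hη0.le
      _ ≤ (∫⁻ ω, ENNReal.ofReal (Real.exp (η * L (ω n).1)) ∂μ) /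
            ENNReal.ofReal (Real.exp (η * ℓ)) :=
          meas_ge_le_lintegral_div hV.aemeasurable
            (ENNReal.ofReal_pos.2 (Real.exp_pos _)).ne' ENNReal.ofReal_ne_top
      _ ≤ (D + 1) / ENNReal.ofReal (Real.exp (η * ℓ)) := by gcongr
      _ = ENNReal.ofReal ((D + 1).toReal * Real.exp (-(η * ℓ))) := by
          rw [ENNReal.ofReal_mul ENNReal.toReal_nonneg, ENNReal.ofReal_toReal (by simp [hD.ne]),
            Real.exp_neg, ENNReal.ofReal_inv_of_pos (Real.exp_pos _), ENNReal.div_eq_inv_mul,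
            mul_comm]
      _ ≤ ENNReal.ofReal θ := ENNReal.ofReal_le_ofReal hℓ
  · have hβ : ENNReal.ofReal (α / 2) ≠ 0 := (ENNReal.ofReal_pos.2 (by positivity)).ne'
    refine lt_of_le_of_lt (b := ENNReal.ofReal (L s) / ENNReal.ofReal (α / 2)) ?_
      (ENNReal.div_lt_top ENNReal.ofReal_ne_top hβ)
    refine iSup₂_le fun t _ => iSup₂_le fun j hj => ?_
    rw [ENNReal.le_div_iff_mul_le (Or.inl hβ) (Or.inl ENNReal.ofReal_ne_top), mul_comm]
    refine lintegral_hitTime_le (fun n => M.adaptiveStep oracle hsize (t + n))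
      (hBm.preimage measurable_fst) (f := fun z => ENNReal.ofReal (L z.1))
      (hL.measurable.comp measurable_fst).ennreal_ofReal
      (measurableSet_smallParameter (M.deltaThreshold ν α))
      (fun n x hx => M.ae_mem_smallParameter oracle hsize _ hx)
      (fun n x hx hxB => hL.additive_drift oracle hsize hgap hαν hacc _ hx ?_)
      (y := (s, j)) ((dyadic_antitone hj).trans hk)
    exact hℓB.trans_lt (not_le.1 hxB)

/-- After a time at which the parameter is small, the size of the state is eventually smaller than
`log² t`. -/
lemma ae_eventually_size_lt (hgap : 0 < M.minGap) (hαν : α ≤ ν)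
    (hacc : ∀ k s, ∫⁻ q, ENNReal.ofReal ‖q - M.optQ s‖ ∂(oracle k s) ≤
      ENNReal.ofReal (4 * dyadic k * M.Vmax)) {c₁ c₂ cN : ℝ} (hc₁ : 0 < c₁) (hcN : 0 < cN)
    (hlin : ∀ s, c₁ * ‖pos s‖ + c₂ ≤ L s) (hN : ∀ s, size s ≤ cN * ‖pos s‖) (p : X × ℕ) (T : ℕ) :
    ∀ᵐ ω ∂(M.adaptiveLaw oracle hsize 0 p), ω T ∈ smallParameter X (M.deltaThreshold ν α) →
      ∀ᶠ t : ℕ in atTop, size (ω t).1 < Real.log t ^ 2 := by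
  have hα := hL.α_pos
  have hν := hL.ν_pos
  obtain ⟨ρ, D, hρ, hD, hmom⟩ := hL.exists_moment_bound oracle hsize hgap hαν hacc
  set η := α / (4 * ν ^ 2) with hη
  have hη0 : 0 < η := by positivity
  set μ := M.adaptiveLaw oracle hsize 0 p with hμ
  set G := smallParameter X (M.deltaThreshold ν α) with hG
  set C := ∫⁻ ω, ENNReal.ofReal (Real.exp (η * L (ω T).1)) ∂μ + D with hC
  have hCtop : C ≠ ∞ :=
    ENNReal.add_ne_top.2 ⟨(hL.lintegral_exp_lt_top oracle hsize 0 p T).ne, hD.ne⟩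
  have hbound : ∀ n, ∫⁻ ω, G.indicator 1 (ω T) *
      ENNReal.ofReal (Real.exp (η * L (ω (T + n)).1)) ∂μ ≤ C := fun n => by
    refine (hmom 0 p T n).trans ?_
    rw [hC]
    gcongr
    exact mul_le_of_le_one_left zero_le (pow_le_one₀ zero_le hρ.le)
  -- On a bad event linear growth forces `L ≥ (c₁ / cN) log² t + c₂`, so its probability is at most
  -- a constant times `exp (-η (c₁ / cN) log² t)`, and Borel-Cantelli applies.
  let bad : ℕ → Set (ℕ → X × ℕ) := fun n =>
    {ω | ω T ∈ G ∧ Real.log ((T + n : ℕ) : ℝ) ^ 2 ≤ size (ω (T + n)).1}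
  have hbad : ∀ n, μ (bad n) ≤ C * ENNReal.ofReal (Real.exp (-(η * c₂))) *
      ENNReal.ofReal (Real.exp (-(η * (c₁ / cN) * Real.log ((T + n : ℕ) : ℝ) ^ 2))) := by
    intro n
    set b := c₁ / cN * Real.log ((T + n : ℕ) : ℝ) ^ 2 + c₂ with hb
    have hV : Measurable fun ω : ℕ → X × ℕ => G.indicator (1 : X × ℕ → ℝ≥0∞) (ω T) *
        ENNReal.ofReal (Real.exp (η * L (ω (T + n)).1)) :=
      ((measurable_one.indicator (measurableSet_smallParameter _)).comp
        (measurable_pi_apply T)).mul (Real.measurable_exp.comp ((hL.measurable.comp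
        (measurable_fst.comp (measurable_pi_apply (T + n)))).const_mul _)).ennreal_ofReal
    calc μ (bad n) ≤ μ {ω | ENNReal.ofReal (Real.exp (η * b)) ≤ G.indicator 1 (ω T) *
            ENNReal.ofReal (Real.exp (η * L (ω (T + n)).1))} := by
          refine measure_mono fun ω hω => ?_
          have h1 : ω T ∈ G := hω.1
          simp only [mem_ofPred_eq, h1, indicator_of_mem, Pi.one_apply, one_mul]
          refine ENNReal.ofReal_le_ofReal (Real.exp_le_exp.2 (mul_le_mul_of_nonneg_left ?_ hη0.le))
          have h2 := hω.2.trans (hN _)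
          have h3 : c₁ / cN * Real.log ((T + n : ℕ) : ℝ) ^ 2 ≤ c₁ * ‖pos (ω (T + n)).1‖ := by
            rw [div_mul_eq_mul_div, div_le_iff₀ hcN]
            calc _ ≤ c₁ * (cN * ‖pos (ω (T + n)).1‖) := mul_le_mul_of_nonneg_left h2 hc₁.le
              _ = _ := by ring
          linarith [hlin (ω (T + n)).1]
      _ ≤ _ / ENNReal.ofReal (Real.exp (η * b)) := meas_ge_le_lintegral_div hV.aemeasurable
            (ENNReal.ofReal_pos.2 (Real.exp_pos _)).ne' ENNReal.ofReal_ne_top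
      _ ≤ C / ENNReal.ofReal (Real.exp (η * b)) := by gcongr; exact hbound n
      _ = _ := by
          rw [mul_assoc, ← ENNReal.ofReal_mul (Real.exp_pos _).le, ← Real.exp_add,
            ENNReal.div_eq_inv_mul, ← ENNReal.ofReal_inv_of_pos (Real.exp_pos _), ← Real.exp_neg,
            mul_comm]
          congr 3
          rw [hb]; ring
  have hsum : ∑' n, μ (bad n) ≠ ∞ := by
    refine ne_top_of_le_ne_top ?_ (ENNReal.tsum_le_tsum hbad)
    rw [ENNReal.tsum_mul_left]
    refine ENNReal.mul_ne_top (ENNReal.mul_ne_top hCtop ENNReal.ofReal_ne_top) ?_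
    have hs : Summable fun n : ℕ =>
        Real.exp (-(η * (c₁ / cN) * Real.log ((T + n : ℕ) : ℝ) ^ 2)) := by
      have := (summable_nat_add_iff T).2
        (summable_exp_neg_log_sq (a := η * (c₁ / cN)) (by positivity))
      simpa [add_comm] using this
    exact hs.tsum_ofReal_ne_top
  filter_upwards [ae_eventually_notMem hsum] with ω hω hT
  obtain ⟨n₀, hn₀⟩ := eventually_atTop.1 hω
  refine eventually_atTop.2 ⟨T + n₀, fun t ht => ?_⟩
  obtain ⟨m, rfl⟩ := Nat.exists_eq_add_of_le ((Nat.le_add_right T n₀).trans ht)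
  by_contra hcon
  exact hn₀ m (by omega) ⟨hT, not_lt.1 hcon⟩

/-- The guarantee for the adaptive scheme holds for every oracle whose expected error at the
parameter `δ` is at most `4 δ Vmax`. -/
theorem adaptiveGuarantee (hgap : 0 < M.minGap)
    (hacc : ∀ k s, ∫⁻ q, ENNReal.ofReal ‖q - M.optQ s‖ ∂(oracle k s) ≤
      ENNReal.ofReal (4 * dyadic k * M.Vmax)) {c₁ c₂ cN : ℝ} (hc₁ : 0 < c₁) (hcN : 0 < cN)
    (hunb : ∀ r : ℝ, ∃ s, r < ‖pos s‖)
    (hlin : ∀ s, c₁ * ‖pos s‖ + c₂ ≤ L s) (hN : ∀ s, size s ≤ cN * ‖pos s‖) (s₀ : X) :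
    M.AdaptiveGuarantee pos oracle hsize (M.deltaThreshold ν α) 1 s₀ := by
  have hαν : α ≤ ν := by
    obtain ⟨s, hs⟩ := hunb ((B - c₂) / c₁)
    rw [div_lt_iff₀ hc₁] at hs
    exact hL.alpha_le_nu (s := s) (by linarith [hlin s])
  have hδ : 0 < M.deltaThreshold ν α := pow_pos (M.tauThreshold_spec hgap hL.α_pos hαν).1 2
  -- The time at which the parameter becomes small is random; intersecting over the countably many
  -- fixed times `T` lets it be chosen along the trajectory.
  have hsmall := ae_all_iff.2 fun T =>
    hL.ae_eventually_size_lt oracle hsize hgap hαν hacc hc₁ hcN hlin hN (s₀, 0) T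
  filter_upwards [hsmall, M.ae_adaptiveLaw_index oracle hsize 0 (s₀, 0)] with ω hω hidx
  simp only [zero_add] at hidx
  have hmono : Monotone fun t => (ω t).2 :=
    monotone_nat_of_le_succ fun t => by rw [hidx t]; exact le_nextIndex size t (ω t)
  have hliminf : (∃ t₁, ∀ t ≥ t₁, (ω t).2 = (ω t₁).2) →
      0 < liminf (fun t => dyadic (ω t).2) atTop := by
    rintro ⟨t₁, h⟩
    have : Tendsto (fun t => dyadic (ω t).2) atTop (nhds (dyadic (ω t₁).2)) :=
      tendsto_const_nhds.congr' (by
        filter_upwards [eventually_ge_atTop t₁] with t ht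
        rw [h t ht])
    rw [this.liminf_eq]
    exact dyadic_pos _
  by_cases hT : ∃ T, dyadic (ω T).2 ≤ M.deltaThreshold ν α
  · obtain ⟨T, hT⟩ := hT
    refine ⟨Or.inl ⟨T, fun t ht => ?_⟩, hliminf ?_⟩
    · have : dyadic (ω t).2 ≤ M.deltaThreshold ν α := (dyadic_antitone (hmono ht)).trans hT
      exact ⟨this, hL.stableFrom oracle hsize hgap hαν hacc t this⟩
    · obtain ⟨t₁, ht₁⟩ := eventually_atTop.1 (hω T hT)
      refine ⟨t₁, fun t ht => ?_⟩
      induction t, ht using Nat.le_induction with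
      | base => rfl
      | succ t ht ih =>
        rw [hidx t, nextIndex, if_neg fun h => (not_le.2 (ht₁ t ht)) h.2, ih]
  -- The index stays below `k₀`, so this monotone integer sequence reaches its maximum and is
  -- constant afterwards.
  · push Not at hT
    obtain ⟨k₀, hk₀⟩ := exists_dyadic_le hδ
    have hbdd : ∀ t, (ω t).2 < k₀ := fun t => by
      by_contra hcon
      exact absurd (hT t) (not_lt.2 ((dyadic_antitone (not_lt.1 hcon)).trans hk₀))
    have hconst : ∃ t₁, ∀ t ≥ t₁, (ω t).2 = (ω t₁).2 := by
      obtain ⟨t₁, ht₁⟩ := Nat.sSup_mem (s := range fun t => (ω t).2) (range_nonempty _)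
        ⟨k₀, by rintro _ ⟨t, rfl⟩; exact (hbdd t).le⟩
      refine ⟨t₁, fun t ht => le_antisymm ?_ (hmono ht)⟩
      rw [show (ω t₁).2 = _ from ht₁]
      exact le_csSup ⟨k₀, by rintro _ ⟨t, rfl⟩; exact (hbdd t).le⟩ ⟨t, rfl⟩
    refine ⟨Or.inr ⟨hT, ?_⟩, hliminf hconst⟩
    obtain ⟨t₁, ht₁⟩ := hconst
    refine limsup_le_of_le (by isBoundedDefault) ?_
    filter_upwards [eventually_ge_atTop t₁, eventually_gt_atTop 0] with t ht ht0
    rw [EReal.coe_le_coe_iff]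
    refine div_le_one_of_le₀ ?_ (sq_nonneg _)
    -- A state of size at least `log² t` would trigger a halving, against the constancy of the
    -- index.
    by_contra hcon
    have h1 : (ω (t + 1)).2 = (ω t).2 + 1 := by
      rw [hidx t, nextIndex, if_pos ⟨ht0.ne', (not_le.1 hcon).le⟩]
    rw [ht₁ t ht, ht₁ (t + 1) (by omega)] at h1
    omega

end IsLyapunov

end MDP

/-! ### Concentration of sample means -/

section Hoeffding

variable {A Y : Type*} [Fintype A] [MeasurableSpace Y]

/-- The `C` samples for one action are independent and, once centred, sub-Gaussian with variance
proxy `(V/2)²`. The sign `c` treats both tails with a single argument. -/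
lemma pi_sampleMean_sub_le (μ : A → Measure Y) [∀ a, IsProbabilityMeasure (μ a)] {f : Y → ℝ}
    (hf : Measurable f) {V : ℝ} (hV : 0 < V) (hb : ∀ a, ∀ᵐ y ∂(μ a), f y ∈ Icc 0 V) {C : ℕ}
    (hC : 0 < C) {r : ℝ} (hr : 0 ≤ r) (a : A) (c : ℝ) (hc : c = 1 ∨ c = -1) :
    (Measure.pi fun j : A × Fin C => μ j.1)
      {w | r < c * ((C : ℝ)⁻¹ * ∑ i, f (w (a, i)) - ∫ y, f y ∂(μ a))} ≤
      ENNReal.ofReal (Real.exp (-(2 * C * r ^ 2 / V ^ 2))) := by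
  set P := Measure.pi fun j : A × Fin C => μ j.1 with hP
  set m := ∫ y, f y ∂(μ a) with hm
  have hCpos : (0 : ℝ) < C := by exact_mod_cast hC
  have hind : iIndepFun (fun (i : Fin C) (w : A × Fin C → Y) => c * (f (w (a, i)) - m)) P := by
    have h1 : iIndepFun (fun (j : A × Fin C) (w : A × Fin C → Y) => c * (f (w j) - m)) P :=
      iIndepFun_pi (X := fun _ y => c * (f y - m)) fun j =>
        ((hf.sub_const m).const_mul c).aemeasurable
    exact h1.precomp (g := fun i : Fin C => (a, i)) fun i i' h => (Prod.mk.inj h).2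
  have hsub : ∀ i : Fin C, HasSubgaussianMGF (fun w : A × Fin C → Y => c * (f (w (a, i)) - m))
      ((‖V - 0‖₊ / 2) ^ 2) P := by
    intro i
    have hmp := measurePreserving_eval (fun j : A × Fin C => μ j.1) (a, i)
    have hmean : ∫ w, f (w (a, i)) ∂P = m := by
      rw [hm, ← hmp.map_eq, integral_map hmp.measurable.aemeasurable hf.aestronglyMeasurable]
    have h1 : HasSubgaussianMGF (fun w : A × Fin C → Y => f (w (a, i)) - ∫ w, f (w (a, i)) ∂P)
        ((‖V - 0‖₊ / 2) ^ 2) P :=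
      hasSubgaussianMGF_of_mem_Icc (hf.comp (measurable_pi_apply _)).aemeasurable
        (hmp.quasiMeasurePreserving.ae (hb a))
    rw [hmean] at h1
    rcases hc with rfl | rfl
    · simpa using h1
    · refine h1.neg.congr (ae_of_all _ fun w => ?_)
      simp
  have key := HasSubgaussianMGF.measure_sum_ge_le_of_iIndepFun hind (s := Finset.univ)
    (fun i _ => hsub i) (ε := C * r) (by positivity)
  have hexp : -(C * r) ^ 2 / (2 * ∑ _i : Fin C, (((‖V - 0‖₊ / 2) ^ 2 : NNReal) : ℝ)) =
      -(2 * C * r ^ 2 / V ^ 2) := by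
    have : ((‖V - 0‖₊ / 2 : NNReal) : ℝ) = V / 2 := by simp [abs_of_pos hV]
    simp only [Finset.sum_const, Finset.card_univ, Fintype.card_fin, nsmul_eq_mul, NNReal.coe_pow,
      this]
    field_simp
  push_cast at key hexp
  rw [hexp] at key
  rw [← ofReal_measureReal (by finiteness)]
  refine ENNReal.ofReal_le_ofReal (le_trans (measureReal_mono ?_ (by finiteness)) key)
  intro w hw
  have h1 : r < c * ((C : ℝ)⁻¹ * ∑ i, f (w (a, i)) - m) := hw
  have h2 : ∑ i : Fin C, c * (f (w (a, i)) - m) =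
      C * (c * ((C : ℝ)⁻¹ * ∑ i, f (w (a, i)) - m)) := by
    rw [← Finset.mul_sum, Finset.sum_sub_distrib]
    simp only [Finset.sum_const, Finset.card_univ, Fintype.card_fin, nsmul_eq_mul]
    field_simp
  change (C : ℝ) * r ≤ ∑ i : Fin C, c * (f (w (a, i)) - m)
  rw [h2]
  exact mul_le_mul_of_nonneg_left h1.le hCpos.le

/-- Hoeffding's inequality for the sample means of bounded samples, for all actions at once. -/
lemma pi_exists_sampleMean_sub_le (μ : A → Measure Y) [∀ a, IsProbabilityMeasure (μ a)] {f : Y → ℝ}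
    (hf : Measurable f) {V : ℝ} (hV : 0 < V) (hb : ∀ a, ∀ᵐ y ∂(μ a), f y ∈ Icc 0 V) {C : ℕ}
    (hC : 0 < C) {r : ℝ} (hr : 0 ≤ r) :
    (Measure.pi fun j : A × Fin C => μ j.1)
      {w | ∃ a, r < |(C : ℝ)⁻¹ * ∑ i, f (w (a, i)) - ∫ y, f y ∂(μ a)|} ≤
      ENNReal.ofReal (2 * Fintype.card A * Real.exp (-(2 * C * r ^ 2 / V ^ 2))) := by
  set P := Measure.pi fun j : A × Fin C => μ j.1 with hP
  let S : ℝ → A → Set (A × Fin C → Y) := fun c a =>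
    {w | r < c * ((C : ℝ)⁻¹ * ∑ i, f (w (a, i)) - ∫ y, f y ∂(μ a))}
  calc _ ≤ P (⋃ a, (S 1 a ∪ S (-1) a)) := by
        refine measure_mono ?_
        rintro w ⟨a, ha⟩
        refine mem_iUnion.2 ⟨a, ?_⟩
        rcases lt_abs.1 ha with h | h
        · exact Or.inl (by simpa [S] using h)
        · exact Or.inr (by simpa [S] using h)
    _ ≤ ∑ a, P (S 1 a ∪ S (-1) a) := measure_iUnion_fintype_le _ _
    _ ≤ ∑ _a : A, (ENNReal.ofReal (Real.exp (-(2 * C * r ^ 2 / V ^ 2))) +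
          ENNReal.ofReal (Real.exp (-(2 * C * r ^ 2 / V ^ 2)))) := by
        refine Finset.sum_le_sum fun a _ => (measure_union_le _ _).trans (add_le_add ?_ ?_)
        · exact pi_sampleMean_sub_le μ hf hV hb hC hr a 1 (Or.inl rfl)
        · exact pi_sampleMean_sub_le μ hf hV hb hC hr a (-1) (Or.inr rfl)
    _ = _ := by
        rw [← ENNReal.ofReal_add (Real.exp_pos _).le (Real.exp_pos _).le, Finset.sum_const,
          Finset.card_univ, nsmul_eq_mul, ← ENNReal.ofReal_natCast, ← ENNReal.ofReal_mul (by simp)]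
        congr 1; ring

lemma sampleMean_mem_Icc {C : ℕ} (hC : 0 < C) {V : ℝ} {x : Fin C → ℝ} (h : ∀ i, x i ∈ Icc 0 V) :
    (C : ℝ)⁻¹ * ∑ i, x i ∈ Icc 0 V := by
  have hCpos : (0 : ℝ) < C := by exact_mod_cast hC
  constructor
  · exact mul_nonneg (by positivity) (Finset.sum_nonneg fun i _ => (h i).1)
  · rw [inv_mul_le_iff₀ hCpos]
    calc _ ≤ ∑ _i : Fin C, V := Finset.sum_le_sum fun i _ => (h i).2
      _ = _ := by simp

end Hoeffding

/-- The integrand is at most `e` off the bad event and at most `V` on it. Replacing the event by a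
measurable hull avoids proving that it is measurable. -/
lemma lintegral_ofReal_le_of_bad {Ω : Type*} [MeasurableSpace Ω] (P : Measure Ω)
    [IsProbabilityMeasure P] {g : Ω → ℝ} {bad : Set Ω} {e V p : ℝ} (he : 0 ≤ e)
    (hV : 0 ≤ V) (hp : 0 ≤ p) (hgood : ∀ᵐ ω ∂P, ω ∉ bad → g ω ≤ e) (hall : ∀ᵐ ω ∂P, g ω ≤ V)
    (hbad : P bad ≤ ENNReal.ofReal p) :
    ∫⁻ ω, ENNReal.ofReal (g ω) ∂P ≤ ENNReal.ofReal (e + V * p) := by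
  set bad' := toMeasurable P bad with hb
  have hm : MeasurableSet bad' := measurableSet_toMeasurable _ _
  calc _ ≤ ∫⁻ ω, (ENNReal.ofReal e + bad'.indicator (fun _ => ENNReal.ofReal V) ω) ∂P := by
        refine lintegral_mono_ae ?_
        filter_upwards [hgood, hall] with ω h1 h2
        by_cases h : ω ∈ bad'
        · simp only [h, indicator_of_mem]
          exact le_add_left (ENNReal.ofReal_le_ofReal h2)
        · simp only [h, not_false_eq_true, indicator_of_notMem, add_zero]
          exact ENNReal.ofReal_le_ofReal (h1 fun h' => h (subset_toMeasurable _ _ h'))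
    _ = ENNReal.ofReal e + ENNReal.ofReal V * P bad := by
        rw [lintegral_add_left measurable_const, lintegral_indicator_const hm, hb,
          measure_toMeasurable]
        simp
    _ ≤ ENNReal.ofReal e + ENNReal.ofReal V * ENNReal.ofReal p := by gcongr
    _ ≤ _ := by
        rw [← ENNReal.ofReal_mul hV, ← ENNReal.ofReal_add he (by positivity)]

namespace MDP

variable {X A : Type*} [MeasurableSpace X] [MeasurableSpace A] (M : MDP X A)
  [Fintype A] [Nonempty A] [DiscreteMeasurableSpace A]

/-! ### Accuracy of the sparse sampling oracle -/

lemma depth_pos (δ : ℝ) : 0 < M.depth δ := lt_of_lt_of_le one_pos (le_max_left _ _)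

lemma pow_depth_le {δ : ℝ} (hδ : 0 < δ) : M.γ ^ M.depth δ ≤ δ := by
  have h1 : Real.logb M.γ δ ≤ M.depth δ :=
    (Nat.le_ceil _).trans (by exact_mod_cast le_max_right _ _)
  calc M.γ ^ M.depth δ = M.γ ^ (M.depth δ : ℝ) := (Real.rpow_natCast _ _).symm
    _ ≤ M.γ ^ Real.logb M.γ δ := Real.rpow_le_rpow_of_exponent_ge M.γ_pos M.γ_lt_one.le h1
    _ = δ := Real.rpow_logb M.γ_pos M.γ_lt_one.ne hδ

lemma backup_sub_optQ {C : ℕ} (s : X) (w : A × Fin C → ℝ) (a : A) :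
    M.backup s w a - M.optQ s a =
      M.γ * ((C : ℝ)⁻¹ * ∑ i, w (a, i) - ∫ s', M.optValue s' ∂(M.P (s, a))) := by
  unfold backup optQ
  ring

lemma abs_sub_le_of_mem_Icc {x y V : ℝ} (hx : x ∈ Icc 0 V) (hy : y ∈ Icc 0 V) : |x - y| ≤ V := by
  rw [abs_le]
  constructor <;> linarith [hx.1, hx.2, hy.1, hy.2]

lemma integral_optValue_mem_Icc (z : X × A) : ∫ s', M.optValue s' ∂(M.P z) ∈ Icc 0 M.Vmax :=
  integral_mem_Icc M.optValue_spec.1 M.optValue_spec.2.1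

lemma backup_mem_Icc {C : ℕ} (hC : 0 < C) (s : X) {w : A × Fin C → ℝ}
    (hw : ∀ j, w j ∈ Icc 0 M.Vmax) (a : A) : M.backup s w a ∈ Icc 0 M.Vmax := by
  have h := sampleMean_mem_Icc hC fun i => hw (a, i)
  constructor
  · exact add_nonneg (M.R_nonneg _) (mul_nonneg M.γ_pos.le h.1)
  · rw [← M.Rmax_add_Vmax]
    exact add_le_add (M.R_le _) (mul_le_mul_of_nonneg_left h.2 M.γ_pos.le)

lemma norm_backup_sub_optQ_le {C : ℕ} (hC : 0 < C) (s : X) {w : A × Fin C → ℝ}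
    (hw : ∀ j, w j ∈ Icc 0 M.Vmax) : ‖M.backup s w - M.optQ s‖ ≤ M.γ * M.Vmax := by
  have hV := M.Vmax_pos
  have hγ := M.γ_pos
  rw [pi_norm_le_iff_of_nonneg (by positivity)]
  intro a
  rw [Pi.sub_apply, backup_sub_optQ, Real.norm_eq_abs, abs_mul, abs_of_pos hγ]
  exact mul_le_mul_of_nonneg_left (abs_sub_le_of_mem_Icc (sampleMean_mem_Icc hC fun i => hw (a, i))
    (M.integral_optValue_mem_Icc _)) hγ.le

lemma sparseStep_apply (C : ℕ) (v : Kernel X ℝ) [IsMarkovKernel v] (s : X) :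
    M.sparseStep C v s =
      (Measure.pi fun j : A × Fin C => (v ∘ₖ M.P) (s, j.1)).map (fun w => M.backup s w) := by
  have hm : Measurable fun p : X × (A × Fin C → ℝ) => M.backup p.1 p.2 :=
    M.measurable_backup measurable_fst measurable_snd
  unfold sparseStep
  rw [Kernel.map_apply _ hm, Kernel.prod_apply, Kernel.id_apply, Measure.dirac_prod,
    Measure.map_map hm measurable_prodMk_left]
  rfl

lemma ae_comp_mem {v : Kernel X ℝ} [IsMarkovKernel v] {V : ℝ}
    (hv : ∀ x, ∀ᵐ w ∂(v x), w ∈ Icc 0 V) (z : X × A) : ∀ᵐ w ∂((v ∘ₖ M.P) z), w ∈ Icc 0 V := by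
  rw [ae_iff]
  have hm : MeasurableSet {w : ℝ | ¬ w ∈ Icc 0 V} := measurableSet_Icc.compl
  rw [Kernel.comp_apply' _ _ _ hm, lintegral_eq_zero_iff (v.measurable_coe hm)]
  exact ae_of_all _ fun x => ae_iff.1 (hv x)

lemma ae_sparseStep {C : ℕ} (hC : 0 < C) {v : Kernel X ℝ} [IsMarkovKernel v]
    (hv : ∀ x, ∀ᵐ w ∂(v x), w ∈ Icc 0 M.Vmax) (s : X) :
    ∀ᵐ q ∂(M.sparseStep C v s),
      (∀ a, q a ∈ Icc 0 M.Vmax) ∧ ‖q - M.optQ s‖ ≤ M.γ * M.Vmax := by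
  have hm : Measurable fun w : A × Fin C → ℝ => M.backup s w :=
    M.measurable_backup measurable_const measurable_id
  have hset : MeasurableSet {q : A → ℝ |
      (∀ a, q a ∈ Icc 0 M.Vmax) ∧ ‖q - M.optQ s‖ ≤ M.γ * M.Vmax} := by
    have hn : MeasurableSet {q : A → ℝ | ‖q - M.optQ s‖ ≤ M.γ * M.Vmax} :=
      measurableSet_le (by fun_prop) measurable_const
    have : {q : A → ℝ | ∀ a, q a ∈ Icc 0 M.Vmax} = ⋂ a, (fun q => q a) ⁻¹' Icc 0 M.Vmax := by
      ext; simp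
    have hi : MeasurableSet {q : A → ℝ | ∀ a, q a ∈ Icc 0 M.Vmax} := by
      rw [this]
      exact MeasurableSet.iInter fun a => measurableSet_Icc.preimage (measurable_pi_apply a)
    exact hi.inter hn
  rw [sparseStep_apply, ae_map_iff hm.aemeasurable hset]
  have hall : ∀ᵐ w ∂(Measure.pi fun j : A × Fin C => (v ∘ₖ M.P) (s, j.1)),
      ∀ j, w j ∈ Icc 0 M.Vmax :=
    ae_all_iff.2 fun j => (measurePreserving_eval (fun j : A × Fin C =>
      (v ∘ₖ M.P) (s, j.1)) j).quasiMeasurePreserving.ae (M.ae_comp_mem hv _)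
  filter_upwards [hall] with w hw
  exact ⟨M.backup_mem_Icc hC s hw, M.norm_backup_sub_optQ_le hC s hw⟩

lemma abs_integral_comp_sub_le {v : Kernel X ℝ} [IsMarkovKernel v]
    (hv : ∀ x, ∀ᵐ w ∂(v x), w ∈ Icc 0 M.Vmax) {b : ℝ}
    (hbias : ∀ x, |∫ w, w ∂(v x) - M.optValue x| ≤ b) (z : X × A) :
    |∫ w, w ∂((v ∘ₖ M.P) z) - ∫ s', M.optValue s' ∂(M.P z)| ≤ b := by
  have hint : Integrable (fun w : ℝ => w) ((v ∘ₖ M.P) z) :=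
    Integrable.of_mem_Icc 0 M.Vmax measurable_id.aemeasurable (M.ae_comp_mem hv z)
  rw [Kernel.integral_comp hint, ← integral_sub hint.integral_comp
    (integrable_of_mem_Icc M.optValue_spec.1 M.optValue_spec.2.1)]
  have := norm_integral_le_of_norm_le_const (μ := M.P z)
    (f := fun x => ∫ w, w ∂(v x) - M.optValue x) (C := b) (ae_of_all _ hbias)
  simpa using this

/-- The error after one sampling step, in terms of the bias of the value estimates. -/
lemma lintegral_sparseStep_le {C : ℕ} (hC : 0 < C) {v : Kernel X ℝ} [IsMarkovKernel v]
    (hv : ∀ x, ∀ᵐ w ∂(v x), w ∈ Icc 0 M.Vmax) {b : ℝ} (hb : 0 ≤ b)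
    (hbias : ∀ x, |∫ w, w ∂(v x) - M.optValue x| ≤ b) {r p : ℝ} (hr : 0 ≤ r)
    (hp : 2 * Fintype.card A * Real.exp (-(2 * C * r ^ 2 / M.Vmax ^ 2)) ≤ p) (s : X) :
    ∫⁻ q, ENNReal.ofReal ‖q - M.optQ s‖ ∂(M.sparseStep C v s) ≤
      ENNReal.ofReal (M.γ * (b + (r + M.Vmax * p))) := by
  have hV := M.Vmax_pos
  have hγ := M.γ_pos
  have hp0 : 0 ≤ p := le_trans (by positivity) hp
  have hm : Measurable fun w : A × Fin C → ℝ => M.backup s w :=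
    M.measurable_backup measurable_const measurable_id
  set P := Measure.pi fun j : A × Fin C => (v ∘ₖ M.P) (s, j.1) with hP
  have hall : ∀ᵐ w ∂P, ∀ j, w j ∈ Icc 0 M.Vmax :=
    ae_all_iff.2 fun j => (measurePreserving_eval (fun j : A × Fin C =>
      (v ∘ₖ M.P) (s, j.1)) j).quasiMeasurePreserving.ae (M.ae_comp_mem hv _)
  have hdev := pi_exists_sampleMean_sub_le (fun a : A => (v ∘ₖ M.P) (s, a)) measurable_id hV
    (fun a => M.ae_comp_mem hv (s, a)) hC hr
  rw [sparseStep_apply, lintegral_map (by fun_prop) hm]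
  refine (lintegral_ofReal_le_of_bad P (e := M.γ * (b + r)) (V := M.γ * M.Vmax) (p := p)
    (by positivity) (by positivity) hp0 (ae_of_all _ fun w hw => ?_) ?_
    (hdev.trans (ENNReal.ofReal_le_ofReal hp))).trans_eq (by congr 1; ring)
  · rw [pi_norm_le_iff_of_nonneg (by positivity)]
    intro a
    rw [Pi.sub_apply, backup_sub_optQ, Real.norm_eq_abs, abs_mul, abs_of_pos hγ]
    refine mul_le_mul_of_nonneg_left ?_ hγ.le
    -- The sample mean is compared with the mean of the child estimates rather than with that of
    -- `V*`; the difference between these two means is the averaged bias `b`.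
    have h1 : |(C : ℝ)⁻¹ * ∑ i, w (a, i) - ∫ y, y ∂((v ∘ₖ M.P) (s, a))| ≤ r := by
      by_contra hcon
      exact hw ⟨a, not_le.1 hcon⟩
    have h2 := M.abs_integral_comp_sub_le hv hbias (s, a)
    have h3 := abs_sub_le ((C : ℝ)⁻¹ * ∑ i, w (a, i)) (∫ y, y ∂((v ∘ₖ M.P) (s, a)))
      (∫ s', M.optValue s' ∂(M.P (s, a)))
    linarith
  · filter_upwards [hall] with w hw
    exact M.norm_backup_sub_optQ_le hC s hw

lemma sparseValue_mem {C : ℕ} (hC : 0 < C) (h : ℕ) (x : X) :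
    ∀ᵐ w ∂((M.sparseValue C h).1 x), w ∈ Icc 0 M.Vmax := by
  induction h generalizing x with
  | zero =>
    change ∀ᵐ w ∂(Measure.dirac (0 : ℝ)), w ∈ Icc 0 M.Vmax
    exact (ae_dirac_iff (p := fun w => w ∈ Icc 0 M.Vmax) measurableSet_Icc).2
      ⟨le_rfl, M.Vmax_pos.le⟩
  | succ h ih =>
    have := (M.sparseValue C h).2
    change ∀ᵐ w ∂(((M.sparseStep C (M.sparseValue C h).1).map maxA) x), w ∈ Icc 0 M.Vmax
    rw [Kernel.map_apply _ measurable_maxA,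
      ae_map_iff (p := fun w => w ∈ Icc 0 M.Vmax) measurable_maxA.aemeasurable measurableSet_Icc]
    filter_upwards [M.ae_sparseStep hC ih x] with q hq
    exact ⟨(hq.1 (Classical.arbitrary A)).1.trans (le_maxA q _), maxA_le fun a => (hq.1 a).2⟩

/-- The bias of the maximum is at most the expected sup-norm error, so the bounds satisfy `b_{h+1} =
γ (b_h + e)` with `e = r + Vmax p`. Its fixed point is `γ e / (1 - γ)`, and leaves of value `0`
start with bias at most `Vmax`. -/
lemma sparseValue_bias {C : ℕ} (hC : 0 < C) {r p : ℝ} (hr : 0 ≤ r)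
    (hp : 2 * Fintype.card A * Real.exp (-(2 * C * r ^ 2 / M.Vmax ^ 2)) ≤ p) (h : ℕ) (x : X) :
    |∫ w, w ∂((M.sparseValue C h).1 x) - M.optValue x| ≤
      M.γ ^ h * M.Vmax + M.γ / (1 - M.γ) * (r + M.Vmax * p) := by
  have hV := M.Vmax_pos
  have hγ := M.γ_pos
  have hγ1 : 0 < 1 - M.γ := sub_pos.2 M.γ_lt_one
  have hp0 : 0 ≤ p := le_trans (by positivity) hp
  induction h generalizing x with
  | zero =>
    have h0 : ∫ w, w ∂((M.sparseValue C 0).1 x) = 0 := by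
      change ∫ w, w ∂(Measure.dirac (0 : ℝ)) = 0
      simp
    have h1 := M.optValue_spec.2.1 x
    rw [h0, zero_sub, abs_neg, abs_of_nonneg h1.1]
    have : 0 ≤ M.γ / (1 - M.γ) * (r + M.Vmax * p) := by positivity
    linarith [h1.2]
  | succ h ih =>
    have := (M.sparseValue C h).2
    have hnn : 0 ≤ M.γ ^ h * M.Vmax + M.γ / (1 - M.γ) * (r + M.Vmax * p) := by positivity
    have herr := M.lintegral_sparseStep_le hC (M.sparseValue_mem hC h) hnn ih hr hp x
    have hmem := M.ae_sparseStep hC (M.sparseValue_mem hC h) x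
    change |∫ w, w ∂(((M.sparseStep C (M.sparseValue C h).1).map maxA) x) - M.optValue x| ≤ _
    rw [Kernel.map_apply _ measurable_maxA, integral_map (f := fun w => w)
      measurable_maxA.aemeasurable measurable_id.aestronglyMeasurable]
    have hint : Integrable maxA (M.sparseStep C (M.sparseValue C h).1 x) := by
      refine Integrable.of_mem_Icc 0 M.Vmax measurable_maxA.aemeasurable ?_
      filter_upwards [hmem] with q hq
      exact ⟨(hq.1 (Classical.arbitrary A)).1.trans (le_maxA q _), maxA_le fun a => (hq.1 a).2⟩
    have hsub : ∫ q, maxA q ∂(M.sparseStep C (M.sparseValue C h).1 x) - M.optValue x =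
        ∫ q, (maxA q - maxA (M.optQ x)) ∂(M.sparseStep C (M.sparseValue C h).1 x) := by
      rw [integral_sub hint (integrable_const _), M.optValue_spec.2.2 x]
      simp
    rw [hsub]
    have hnorm : ‖∫ q, (maxA q - maxA (M.optQ x)) ∂(M.sparseStep C (M.sparseValue C h).1 x)‖ ≤
        (∫⁻ q, ENNReal.ofReal ‖maxA q - maxA (M.optQ x)‖
          ∂(M.sparseStep C (M.sparseValue C h).1 x)).toReal := norm_integral_le_lintegral_norm _
    rw [Real.norm_eq_abs] at hnorm
    refine hnorm.trans (ENNReal.toReal_le_of_le_ofReal (by positivity) ?_)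
    calc _ ≤ ∫⁻ q, ENNReal.ofReal ‖q - M.optQ x‖ ∂(M.sparseStep C (M.sparseValue C h).1 x) :=
          lintegral_mono fun q => ENNReal.ofReal_le_ofReal (abs_maxA_sub_le q _)
      _ ≤ _ := herr
      _ = _ := by
          congr 1
          field_simp
          ring

lemma lintegral_sparseOracle_le {C H : ℕ} (hC : 0 < C) (hH : 0 < H) {r p : ℝ} (hr : 0 ≤ r)
    (hp : 2 * Fintype.card A * Real.exp (-(2 * C * r ^ 2 / M.Vmax ^ 2)) ≤ p) (s : X) :
    ∫⁻ q, ENNReal.ofReal ‖q - M.optQ s‖ ∂(M.sparseOracle C H s) ≤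
      ENNReal.ofReal (M.γ ^ H * M.Vmax + M.γ / (1 - M.γ) * (r + M.Vmax * p)) := by
  have hV := M.Vmax_pos
  have hγ := M.γ_pos
  have hγ1 : 0 < 1 - M.γ := sub_pos.2 M.γ_lt_one
  have hp0 : 0 ≤ p := le_trans (by positivity) hp
  obtain ⟨h, rfl⟩ : ∃ h, H = h + 1 := ⟨H - 1, by omega⟩
  have := (M.sparseValue C h).2
  have hnn : 0 ≤ M.γ ^ h * M.Vmax + M.γ / (1 - M.γ) * (r + M.Vmax * p) := by positivity
  refine (M.lintegral_sparseStep_le hC (M.sparseValue_mem hC h) hnn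
    (M.sparseValue_bias hC hr hp h) hr hp s).trans_eq ?_
  congr 1
  field_simp
  ring

/-- The expected error of the sparse sampling oracle. -/
theorem sparseOracle_accuracy {δ : ℝ} (hδ0 : 0 < δ) (hδ1 : δ ≤ 1) {C : ℕ} (hC : 0 < C)
    (hCδ : M.sparseC δ ≤ C) (s : X) :
    ∫⁻ q, ENNReal.ofReal ‖q - M.optQ s‖ ∂(M.sparseOracle C (M.depth δ) s) ≤
      ENNReal.ofReal (4 * δ * M.Vmax) := by
  have hV := M.Vmax_pos
  have hγ := M.γ_pos
  have hγ1 : 0 < 1 - M.γ := sub_pos.2 M.γ_lt_one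
  have hA : (1 : ℝ) ≤ Fintype.card A := by exact_mod_cast Fintype.card_pos
  -- For `γ ≤ δ` the a priori error `γ Vmax` suffices. Otherwise `x = γ / (δ (1 - γ)) ≥ 1`, so the
  -- logarithms that occur are nonnegative.
  rcases le_or_gt M.γ δ with hle | hlt
  · have := (M.sparseValue C (M.depth δ - 1)).2
    calc _ ≤ ∫⁻ _q, ENNReal.ofReal (M.γ * M.Vmax) ∂(M.sparseOracle C (M.depth δ) s) := by
          refine lintegral_mono_ae ?_
          filter_upwards [M.ae_sparseStep hC (M.sparseValue_mem hC (M.depth δ - 1)) s] with q hq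
          exact ENNReal.ofReal_le_ofReal hq.2
      _ = ENNReal.ofReal (M.γ * M.Vmax) := by simp
      _ ≤ _ := ENNReal.ofReal_le_ofReal (by nlinarith)
  · set x := M.γ / (δ * (1 - M.γ)) with hx
    have hx1 : 1 ≤ x := by
      rw [hx, one_le_div (by positivity)]
      nlinarith
    have hxpos : 0 < x := by linarith
    have hH : (1 : ℝ) ≤ M.depth δ := by exact_mod_cast M.depth_pos δ
    have hu : 2 * x ^ 2 * (2 * Real.log (2 * x ^ 2 * Fintype.card A)) ≤ C := by
      refine le_trans ?_ hCδ
      have e1 : 2 * M.γ ^ 2 / (δ ^ 2 * (1 - M.γ) ^ 2) = 2 * x ^ 2 := by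
        rw [hx]; field_simp
      have e2 : 2 * M.γ ^ 2 * (Fintype.card A : ℝ) * M.depth δ / (δ ^ 2 * (1 - M.γ) ^ 2) =
          2 * x ^ 2 * Fintype.card A * M.depth δ := by
        rw [hx]; field_simp
      have hx2 : 1 ≤ x ^ 2 := one_le_pow₀ hx1
      have hy : 1 ≤ 2 * x ^ 2 * Fintype.card A := by nlinarith
      unfold sparseC
      rw [e1, e2]
      have hlog0 := Real.log_nonneg hy
      have hlog1 : Real.log (2 * x ^ 2 * Fintype.card A) ≤
          Real.log (2 * x ^ 2 * Fintype.card A * M.depth δ) :=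
        Real.log_le_log (by linarith) (le_mul_of_one_le_right (by linarith) hH)
      have hlog2 : 0 ≤ Real.log (2 / δ) := Real.log_nonneg (by
        rw [le_div_iff₀ hδ0]; linarith [hδ1])
      refine mul_le_mul_of_nonneg_left ?_ (by positivity)
      nlinarith
    -- With deviation `r = Vmax / x` and failure probability `p = 1 / x`, the accumulated sampling
    -- error is `2 δ Vmax`; truncation at depth `H` adds at most `δ Vmax`.
    have hlam : 0 ≤ M.Vmax / x := by positivity
    have hp : 2 * Fintype.card A * Real.exp (-(2 * C * (M.Vmax / x) ^ 2 / M.Vmax ^ 2)) ≤ 1 / x := by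
      have hy : 1 ≤ 2 * x ^ 2 * Fintype.card A := by nlinarith [one_le_pow₀ hx1 (n := 2)]
      have hlog0 := Real.log_nonneg hy
      have e1 : 2 * C * (M.Vmax / x) ^ 2 / M.Vmax ^ 2 = 2 * C / x ^ 2 := by field_simp
      have e2 : Real.log (2 * x ^ 2 * Fintype.card A) ≤ 2 * C / x ^ 2 := by
        rw [le_div_iff₀ (by positivity)]
        nlinarith [mul_nonneg (sq_nonneg x) hlog0]
      rw [e1]
      calc _ ≤ 2 * Fintype.card A * Real.exp (-Real.log (2 * x ^ 2 * Fintype.card A)) := by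
            gcongr
        _ = 1 / x ^ 2 := by
            rw [Real.exp_neg, Real.exp_log (by linarith)]
            field_simp
        _ ≤ 1 / x := one_div_le_one_div_of_le hxpos (le_self_pow₀ hx1 (by norm_num))
    refine (M.lintegral_sparseOracle_le hC (M.depth_pos δ) hlam hp s).trans
      (ENNReal.ofReal_le_ofReal ?_)
    have e3 : M.γ / (1 - M.γ) * (M.Vmax / x + M.Vmax * (1 / x)) = 2 * δ * M.Vmax := by
      rw [hx]; field_simp; norm_num
    rw [e3]
    have := mul_le_mul_of_nonneg_right (M.pow_depth_le hδ0) hV.le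
    nlinarith

end MDP

/-! ### Accuracy of the oracle on the grid -/

section GridGeometry

variable {d : ℕ} {ε : ℝ}

lemma abs_gridIndex_sub_le (x : EuclideanSpace ℝ (Fin d)) (i : Fin d) :
    |(gridIndex ε x i : ℝ) - x i / ε| ≤ 1 / 2 := by
  rw [abs_sub_comm]
  exact abs_sub_round _

lemma norm_gridPoint_gridIndex_sub_le (hε : 0 < ε) (x : EuclideanSpace ℝ (Fin d)) :
    ‖gridPoint ε (gridIndex ε x) - x‖ ≤ ε * Real.sqrt d / 2 := by
  have hi : ∀ i, ‖(gridPoint ε (gridIndex ε x) - x) i‖ ^ 2 ≤ (ε / 2) ^ 2 := by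
    intro i
    refine pow_le_pow_left₀ (norm_nonneg _) ?_ 2
    have h1 : (gridPoint ε (gridIndex ε x) - x) i = ((gridIndex ε x i : ℝ) - x i / ε) * ε := by
      change (gridIndex ε x i : ℝ) * ε - x i = _
      field_simp
    rw [h1, norm_mul, Real.norm_eq_abs, Real.norm_eq_abs, abs_of_pos hε]
    nlinarith [abs_gridIndex_sub_le (ε := ε) x i]
  rw [EuclideanSpace.norm_eq]
  calc _ ≤ Real.sqrt (∑ _i : Fin d, (ε / 2) ^ 2) :=
        Real.sqrt_le_sqrt (Finset.sum_le_sum fun i _ => hi i)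
    _ = _ := by
        rw [Finset.sum_const, Finset.card_univ, Fintype.card_fin, nsmul_eq_mul,
          Real.sqrt_mul (Nat.cast_nonneg _), Real.sqrt_sq (by positivity)]
        ring

/-- A move by at most `ν'` shifts each coordinate by `ν' / ε` in grid units, and rounding adds at
most `1/2`, relaxed here to `1`. -/
lemma abs_gridIndex_sub_le_of_norm_le (hε : 0 < ε) {x y : EuclideanSpace ℝ (Fin d)} {ν' : ℝ}
    (h : ‖x - y‖ ≤ ν') (i : Fin d) : |(gridIndex ε x i : ℝ) - y i / ε| ≤ ν' / ε + 1 := by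
  have h1 := abs_gridIndex_sub_le (ε := ε) x i
  have h2 : |x i / ε - y i / ε| ≤ ν' / ε := by
    rw [← sub_div, abs_div, abs_of_pos hε]
    gcongr
    exact (PiLp.norm_apply_le (x - y) i).trans h
  have h3 := abs_sub_le (gridIndex ε x i : ℝ) (x i / ε) (y i / ε)
  linarith

/-- The indices of the points of the grid in a box around `s`. -/
def gridBox (ε : ℝ) (s : EuclideanSpace ℝ (Fin d)) (R : ℝ) : Finset (Fin d → ℤ) :=
  Fintype.piFinset fun i => Finset.Icc ⌈s i / ε - R⌉ ⌊s i / ε + R⌋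

lemma mem_gridBox {s : EuclideanSpace ℝ (Fin d)} {R : ℝ} {k : Fin d → ℤ} :
    k ∈ gridBox ε s R ↔ ∀ i, |(k i : ℝ) - s i / ε| ≤ R := by
  simp only [gridBox, Fintype.mem_piFinset, Finset.mem_Icc, Int.ceil_le, Int.le_floor, abs_le]
  refine forall_congr' fun i => ?_
  constructor <;> rintro ⟨h1, h2⟩ <;> constructor <;> linarith

lemma card_gridBox_le (s : EuclideanSpace ℝ (Fin d)) {R : ℝ} (hR : 0 ≤ R) :
    ((gridBox ε s R).card : ℝ) ≤ (2 * R + 1) ^ d := by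
  unfold gridBox
  rw [Fintype.card_piFinset, Nat.cast_prod]
  calc _ ≤ ∏ _i : Fin d, (2 * R + 1) := by
        refine Finset.prod_le_prod (fun i _ => Nat.cast_nonneg _) fun i _ => ?_
        rw [Int.card_Icc]
        have h1 : ((⌊s i / ε + R⌋ + 1 - ⌈s i / ε - R⌉ : ℤ) : ℝ) ≤ 2 * R + 1 := by
          push_cast
          linarith [Int.floor_le (s i / ε + R), Int.le_ceil (s i / ε - R)]
        rcases le_total 0 (⌊s i / ε + R⌋ + 1 - ⌈s i / ε - R⌉) with h | h
        · have h2 : (((⌊s i / ε + R⌋ + 1 - ⌈s i / ε - R⌉).toNat : ℤ) : ℝ) =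
              ((⌊s i / ε + R⌋ + 1 - ⌈s i / ε - R⌉ : ℤ) : ℝ) := by rw [Int.toNat_of_nonneg h]
          rw [Int.cast_natCast] at h2
          rw [h2]
          exact h1
        · rw [Int.toNat_of_nonpos h]
          push_cast
          linarith
    _ = _ := by simp

end GridGeometry

namespace MDP

section General

variable {X A : Type*} [MeasurableSpace X] [MeasurableSpace A] (M : MDP X A)
  [Fintype A] [Nonempty A] [DiscreteMeasurableSpace A]

/-- The error splits into that of the child estimates at the sampled states and that of the sample
mean of `V*`. As `V*` is not random, the second part can be controlled even though the samples are
reused throughout the tree. -/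
lemma norm_backup_sub_optQ_le_of_sampleMean {C : ℕ} (hC : 0 < C) (s : X) {w : A × Fin C → ℝ}
    {y : A × Fin C → X} {b r : ℝ} (hw : ∀ j, |w j - M.optValue (y j)| ≤ b)
    (hy : ∀ a, |(C : ℝ)⁻¹ * ∑ i, M.optValue (y (a, i)) - ∫ s', M.optValue s' ∂(M.P (s, a))| ≤ r) :
    ‖M.backup s w - M.optQ s‖ ≤ M.γ * (b + r) := by
  have hCpos : (0 : ℝ) < C := by exact_mod_cast hC
  have hγ := M.γ_pos
  have a₀ := Classical.arbitrary A
  have hb : 0 ≤ b := (abs_nonneg _).trans (hw (a₀, ⟨0, hC⟩))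
  have hr : 0 ≤ r := (abs_nonneg _).trans (hy a₀)
  rw [pi_norm_le_iff_of_nonneg (by positivity)]
  intro a
  rw [Pi.sub_apply, backup_sub_optQ, Real.norm_eq_abs, abs_mul, abs_of_pos hγ]
  refine mul_le_mul_of_nonneg_left ?_ hγ.le
  have h1 : |(C : ℝ)⁻¹ * ∑ i, w (a, i) - (C : ℝ)⁻¹ * ∑ i, M.optValue (y (a, i))| ≤ b := by
    rw [← mul_sub, ← Finset.sum_sub_distrib, abs_mul, abs_of_pos (inv_pos.2 hCpos),
      inv_mul_le_iff₀ hCpos]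
    calc _ ≤ ∑ i, |w (a, i) - M.optValue (y (a, i))| := Finset.abs_sum_le_sum_abs _ _
      _ ≤ ∑ _i : Fin C, b := Finset.sum_le_sum fun i _ => hw (a, i)
      _ = _ := by simp
  have h2 := abs_sub_le ((C : ℝ)⁻¹ * ∑ i, w (a, i)) ((C : ℝ)⁻¹ * ∑ i, M.optValue (y (a, i)))
    (∫ s', M.optValue s' ∂(M.P (s, a)))
  linarith [hy a]

end General

variable {d : ℕ} {A : Type*} [MeasurableSpace A] [Fintype A] [Nonempty A]
  [DiscreteMeasurableSpace A] (M : MDP (EuclideanSpace ℝ (Fin d)) A)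

/-- The sample means of `V*` at the points `y` are `r`-accurate in the state `s`. -/
def AccurateSamples {C : ℕ} (s : EuclideanSpace ℝ (Fin d))
    (y : A × Fin C → EuclideanSpace ℝ (Fin d)) (r : ℝ) : Prop :=
  ∀ a, |(C : ℝ)⁻¹ * ∑ i, M.optValue (y (a, i)) - ∫ s', M.optValue s' ∂(M.P (s, a))| ≤ r

lemma gridValue_mem_Icc {C : ℕ} (hC : 0 < C) (ε : ℝ) (s : EuclideanSpace ℝ (Fin d))
    (ξ : Samples d A C) (h : ℕ) (k : Fin d → ℤ) : M.gridValue ε s ξ h k ∈ Icc 0 M.Vmax := by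
  induction h generalizing k with
  | zero => exact ⟨le_rfl, M.Vmax_pos.le⟩
  | succ h ih =>
    have hb := M.backup_mem_Icc hC (gridPoint ε k)
      (w := fun j => M.gridValue ε s ξ h (gridIndex ε (nodeSamples ε s ξ k j))) fun j => ih _
    exact ⟨(hb (Classical.arbitrary A)).1.trans (le_maxA _ _), maxA_le fun a => (hb a).2⟩

/-! ### Propagation of errors on the event of accurate samples -/

section Deterministic

variable {M} {C : ℕ} {ε ζ ν' r : ℝ} {s : EuclideanSpace ℝ (Fin d)} {ξ : Samples d A C}

/-- Here `m` counts the moves made from the root: each enlarges the box by `ν' / ε + 1`, and `m + h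
≤ H` keeps all descendants in the box where the samples are accurate. Each level contributes the
sampling error `r` and the rounding error `ζ ε √d / 2`, discounted by `γ`. -/
lemma abs_gridValue_sub_optValue_le (hC : 0 < C) (hε : 0 < ε) (hζ : 0 ≤ ζ)
    (hLip : ∀ s s', |M.optValue s - M.optValue s'| ≤ ζ * ‖s - s'‖) (hr : 0 ≤ r) {H : ℕ}
    (hstep : ∀ k j, ‖nodeSamples ε s ξ k j - gridPoint ε k‖ ≤ ν')
    (hacc : ∀ k ∈ gridBox ε s (H * (ν' / ε + 1)),
      M.AccurateSamples (gridPoint ε k) (nodeSamples ε s ξ k) r) (h : ℕ) {m : ℕ} (hm : m + h ≤ H)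
    (hν' : 0 ≤ ν') {k : Fin d → ℤ} (hk : k ∈ gridBox ε s (m * (ν' / ε + 1))) :
    |M.gridValue ε s ξ h k - M.optValue (gridPoint ε k)| ≤
      M.γ ^ h * M.Vmax + M.γ / (1 - M.γ) * (r + ζ * (ε * Real.sqrt d / 2)) := by
  have hV := M.Vmax_pos
  have hγ := M.γ_pos
  have hγ1 : 0 < 1 - M.γ := sub_pos.2 M.γ_lt_one
  have hnn : 0 ≤ M.γ / (1 - M.γ) * (r + ζ * (ε * Real.sqrt d / 2)) := by positivity
  have hρ : 0 ≤ ν' / ε + 1 := by positivity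
  induction h generalizing k m with
  | zero =>
    have h1 := M.optValue_spec.2.1 (gridPoint ε k)
    change |0 - _| ≤ _
    rw [zero_sub, abs_neg, abs_of_nonneg h1.1]
    linarith [h1.2]
  | succ h ih =>
    have hchild : ∀ j, gridIndex ε (nodeSamples ε s ξ k j) ∈
        gridBox ε s ((m + 1 : ℕ) * (ν' / ε + 1)) := by
      intro j
      rw [mem_gridBox] at hk ⊢
      intro i
      have h1 := abs_gridIndex_sub_le_of_norm_le hε (hstep k j) i
      have h2 : gridPoint ε k i / ε = k i := by
        change (k i : ℝ) * ε / ε = k i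
        field_simp
      rw [h2] at h1
      have h3 := abs_sub_le (gridIndex ε (nodeSamples ε s ξ k j) i : ℝ) (k i) (s i / ε)
      push_cast
      linarith [hk i]
    have hbox : k ∈ gridBox ε s (H * (ν' / ε + 1)) := by
      rw [mem_gridBox] at hk ⊢
      intro i
      refine (hk i).trans (mul_le_mul_of_nonneg_right ?_ hρ)
      exact_mod_cast (by omega : m ≤ H)
    have hw : ∀ j, |M.gridValue ε s ξ h (gridIndex ε (nodeSamples ε s ξ k j)) -
        M.optValue (nodeSamples ε s ξ k j)| ≤
        M.γ ^ h * M.Vmax + M.γ / (1 - M.γ) * (r + ζ * (ε * Real.sqrt d / 2)) +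
          ζ * (ε * Real.sqrt d / 2) := by
      intro j
      have h1 := ih (m := m + 1) (by omega) (hchild j)
      have h2 := (hLip (gridPoint ε (gridIndex ε (nodeSamples ε s ξ k j)))
        (nodeSamples ε s ξ k j)).trans
        (mul_le_mul_of_nonneg_left (norm_gridPoint_gridIndex_sub_le hε _) hζ)
      have h3 := abs_sub_le (M.gridValue ε s ξ h (gridIndex ε (nodeSamples ε s ξ k j)))
        (M.optValue (gridPoint ε (gridIndex ε (nodeSamples ε s ξ k j))))
        (M.optValue (nodeSamples ε s ξ k j))
      linarith
    have hback := M.norm_backup_sub_optQ_le_of_sampleMean hC (gridPoint ε k) hw (hacc k hbox)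
    rw [M.optValue_spec.2.2 (gridPoint ε k)]
    refine (abs_maxA_sub_le _ _).trans (hback.trans_eq ?_)
    field_simp
    ring

lemma norm_gridQ_sub_optQ_le (hC : 0 < C) (hε : 0 < ε) (hζ : 0 ≤ ζ)
    (hLip : ∀ s s', |M.optValue s - M.optValue s'| ≤ ζ * ‖s - s'‖) (hr : 0 ≤ r) {H : ℕ}
    (hH : 0 < H) (hstep : ∀ k j, ‖nodeSamples ε s ξ k j - gridPoint ε k‖ ≤ ν')
    (hroot : ∀ j, ‖ξ.2 j - s‖ ≤ ν') (hν' : 0 ≤ ν')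
    (hacc : ∀ k ∈ gridBox ε s (H * (ν' / ε + 1)),
      M.AccurateSamples (gridPoint ε k) (nodeSamples ε s ξ k) r)
    (haccroot : M.AccurateSamples s ξ.2 r) :
    ‖M.gridQ ε H s ξ - M.optQ s‖ ≤
      M.γ ^ H * M.Vmax + M.γ / (1 - M.γ) * (r + ζ * (ε * Real.sqrt d / 2)) := by
  have hγ1 : 0 < 1 - M.γ := sub_pos.2 M.γ_lt_one
  obtain ⟨h, rfl⟩ : ∃ h, H = h + 1 := ⟨H - 1, by omega⟩
  have hw : ∀ j, |M.gridValue ε s ξ h (gridIndex ε (ξ.2 j)) - M.optValue (ξ.2 j)| ≤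
      M.γ ^ h * M.Vmax + M.γ / (1 - M.γ) * (r + ζ * (ε * Real.sqrt d / 2)) +
        ζ * (ε * Real.sqrt d / 2) := by
    intro j
    have hbox : gridIndex ε (ξ.2 j) ∈ gridBox ε s ((1 : ℕ) * (ν' / ε + 1)) := by
      rw [mem_gridBox]
      intro i
      simpa using abs_gridIndex_sub_le_of_norm_le hε (hroot j) i
    have h1 := abs_gridValue_sub_optValue_le hC hε hζ hLip hr hstep hacc h (m := 1)
      (by omega) hν' hbox
    have h2 := (hLip (gridPoint ε (gridIndex ε (ξ.2 j))) (ξ.2 j)).trans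
      (mul_le_mul_of_nonneg_left (norm_gridPoint_gridIndex_sub_le hε _) hζ)
    have h3 := abs_sub_le (M.gridValue ε s ξ h (gridIndex ε (ξ.2 j)))
      (M.optValue (gridPoint ε (gridIndex ε (ξ.2 j)))) (M.optValue (ξ.2 j))
    linarith
  refine (M.norm_backup_sub_optQ_le_of_sampleMean hC s hw haccroot).trans_eq ?_
  field_simp
  ring

end Deterministic

/-! ### Law of the grid samples and union bound over reachable points -/

section Random

variable (C : ℕ) (ε : ℝ) (s : EuclideanSpace ℝ (Fin d))

lemma samplesLaw_apply : M.samplesLaw C ε s =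
    (Measure.infinitePi fun z : (Fin d → ℤ) × (A × Fin C) => M.P (gridPoint ε z.1, z.2.1)).prod
      (Measure.pi fun j : A × Fin C => M.P (s, j.1)) := by
  unfold samplesLaw
  rw [Kernel.prod_apply]
  rfl

lemma map_snd_samplesLaw :
    (M.samplesLaw C ε s).map Prod.snd = Measure.pi fun j : A × Fin C => M.P (s, j.1) := by
  rw [samplesLaw_apply, Measure.map_snd_prod, measure_univ, one_smul]

lemma map_fst_samplesLaw (k : Fin d → ℤ) :
    (M.samplesLaw C ε s).map (fun ξ j => ξ.1 (k, j)) =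
      Measure.pi fun j : A × Fin C => M.P (gridPoint ε k, j.1) := by
  have h1 : (fun (ξ : Samples d A C) j => ξ.1 (k, j)) =
      (fun (ξ : (Fin d → ℤ) × (A × Fin C) → EuclideanSpace ℝ (Fin d)) j => ξ (k, j)) ∘ Prod.fst :=
    rfl
  rw [samplesLaw_apply, h1, ← Measure.map_map (by fun_prop) measurable_fst, Measure.map_fst_prod,
    measure_univ, one_smul, Measure.map_infinitePi_infinitePi_of_inj (Prod.mk_right_injective k),
    Measure.infinitePi_eq_pi]

lemma gridOracle_apply (H : ℕ) :
    M.gridOracle C ε H s = (M.samplesLaw C ε s).map (fun ξ => M.gridQ ε H s ξ) := by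
  unfold gridOracle
  rw [Kernel.map_apply _ (M.measurable_gridQ ε H), Kernel.prod_apply, Kernel.id_apply,
    Measure.dirac_prod, Measure.map_map (M.measurable_gridQ ε H) measurable_prodMk_left]
  rfl

variable {C ε}

lemma samplesLaw_not_accurate_le (hC : 0 < C) {r : ℝ} (hr : 0 ≤ r) :
    M.samplesLaw C ε s {ξ | ¬ M.AccurateSamples s ξ.2 r} ≤
      ENNReal.ofReal (2 * Fintype.card A * Real.exp (-(2 * C * r ^ 2 / M.Vmax ^ 2))) := by
  have h := pi_exists_sampleMean_sub_le (fun a : A => M.P (s, a)) M.optValue_spec.1 M.Vmax_pos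
    (fun a => ae_of_all _ M.optValue_spec.2.1) hC hr
  rw [← M.map_snd_samplesLaw C ε s] at h
  refine le_trans (measure_mono ?_) ((Measure.le_map_apply measurable_snd.aemeasurable _).trans h)
  intro ξ hξ
  have hξ' : ¬ M.AccurateSamples s ξ.2 r := hξ
  simp only [AccurateSamples, not_forall, not_le] at hξ'
  exact hξ'

/-- A grid point that coincides with the queried state uses the root samples; these have the same
law as fresh samples there, so the same tail bound holds in both cases. -/
lemma samplesLaw_node_not_accurate_le (hC : 0 < C) {r : ℝ} (hr : 0 ≤ r) (k : Fin d → ℤ) :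
    M.samplesLaw C ε s
        {ξ | ¬ M.AccurateSamples (gridPoint ε k) (nodeSamples ε s ξ k) r} ≤
      ENNReal.ofReal (2 * Fintype.card A * Real.exp (-(2 * C * r ^ 2 / M.Vmax ^ 2))) := by
  by_cases hk : gridPoint ε k = s
  · simp only [nodeSamples, if_pos hk]
    rw [hk]
    exact M.samplesLaw_not_accurate_le s hC hr
  · simp only [nodeSamples, if_neg hk]
    have h := pi_exists_sampleMean_sub_le (fun a : A => M.P (gridPoint ε k, a)) M.optValue_spec.1
      M.Vmax_pos (fun a => ae_of_all _ M.optValue_spec.2.1) hC hr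
    rw [← M.map_fst_samplesLaw C ε s k] at h
    refine le_trans (measure_mono ?_)
      ((Measure.le_map_apply (Measurable.aemeasurable (by fun_prop)) _).trans h)
    intro ξ hξ
    have hξ' : ¬ M.AccurateSamples (gridPoint ε k) (fun j => ξ.1 (k, j)) r := hξ
    simp only [AccurateSamples, not_forall, not_le] at hξ'
    exact hξ'

lemma ae_samplesLaw_step {ν' : ℝ} (hinc : ∀ s a, ∀ᵐ s' ∂(M.P (s, a)), ‖s' - s‖ ≤ ν') :
    ∀ᵐ ξ ∂(M.samplesLaw C ε s), (∀ k j, ‖nodeSamples ε s ξ k j - gridPoint ε k‖ ≤ ν') ∧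
      ∀ j, ‖ξ.2 j - s‖ ≤ ν' := by
  have h2 : ∀ᵐ ξ ∂(M.samplesLaw C ε s), ∀ j, ‖ξ.2 j - s‖ ≤ ν' := by
    have : ∀ᵐ x ∂((M.samplesLaw C ε s).map Prod.snd), ∀ j, ‖x j - s‖ ≤ ν' := by
      rw [map_snd_samplesLaw]
      exact ae_all_iff.2 fun j => (measurePreserving_eval (fun j : A × Fin C =>
        M.P (s, j.1)) j).quasiMeasurePreserving.ae (hinc s j.1)
    exact ae_of_ae_map measurable_snd.aemeasurable this
  have h1 : ∀ᵐ ξ ∂(M.samplesLaw C ε s), ∀ k j, ‖ξ.1 (k, j) - gridPoint ε k‖ ≤ ν' := by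
    refine ae_all_iff.2 fun k => ?_
    have : ∀ᵐ x ∂((M.samplesLaw C ε s).map (fun ξ j => ξ.1 (k, j))),
        ∀ j, ‖x j - gridPoint ε k‖ ≤ ν' := by
      rw [map_fst_samplesLaw]
      exact ae_all_iff.2 fun j => (measurePreserving_eval (fun j : A × Fin C =>
        M.P (gridPoint ε k, j.1)) j).quasiMeasurePreserving.ae (hinc _ j.1)
    exact ae_of_ae_map (Measurable.aemeasurable (by fun_prop)) this
  filter_upwards [h1, h2] with ξ h1 h2
  refine ⟨fun k j => ?_, h2⟩
  by_cases hk : gridPoint ε k = s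
  · simp only [nodeSamples, if_pos hk]
    rw [hk]
    exact h2 j
  · simp only [nodeSamples, if_neg hk]
    exact h1 k j

/-- The bad event is a union over the points of the box, plus one term for the root, which need not
lie on the grid. Outside it the deterministic estimate applies; on it the error is still at most
`Vmax`. -/
lemma lintegral_gridOracle_le (hC : 0 < C) (hε : 0 < ε) {ζ : ℝ} (hζ : 0 ≤ ζ)
    (hLip : ∀ s s', |M.optValue s - M.optValue s'| ≤ ζ * ‖s - s'‖) {r : ℝ} (hr : 0 ≤ r) {H : ℕ}
    (hH : 0 < H) {ν' : ℝ} (hν' : 0 ≤ ν') (hinc : ∀ s a, ∀ᵐ s' ∂(M.P (s, a)), ‖s' - s‖ ≤ ν')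
    {p : ℝ} (hp : ((2 * (H * (ν' / ε + 1)) + 1) ^ d + 1) *
      (2 * Fintype.card A * Real.exp (-(2 * C * r ^ 2 / M.Vmax ^ 2))) ≤ p) :
    ∫⁻ q, ENNReal.ofReal ‖q - M.optQ s‖ ∂(M.gridOracle C ε H s) ≤
      ENNReal.ofReal (M.γ ^ H * M.Vmax + M.γ / (1 - M.γ) * (r + ζ * (ε * Real.sqrt d / 2)) +
        M.Vmax * p) := by
  have hV := M.Vmax_pos
  have hγ := M.γ_pos
  have hγ1 : 0 < 1 - M.γ := sub_pos.2 M.γ_lt_one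
  have hR : 0 ≤ H * (ν' / ε + 1) := by positivity
  have hp0 : 0 ≤ p := le_trans (by positivity) hp
  set p₁ := 2 * Fintype.card A * Real.exp (-(2 * C * r ^ 2 / M.Vmax ^ 2)) with hp₁
  have hp₁0 : 0 ≤ p₁ := by positivity
  set box := gridBox ε s (H * (ν' / ε + 1)) with hbox
  have hm : Measurable fun ξ : Samples d A C => M.gridQ ε H s ξ :=
    (M.measurable_gridQ ε H).comp measurable_prodMk_left
  let bad : Set (Samples d A C) := {ξ | ¬ M.AccurateSamples s ξ.2 r} ∪
    ⋃ k ∈ box, {ξ | ¬ M.AccurateSamples (gridPoint ε k) (nodeSamples ε s ξ k) r}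
  have hbad : M.samplesLaw C ε s bad ≤ ENNReal.ofReal p := by
    calc _ ≤ ENNReal.ofReal p₁ + ∑ _k ∈ box, ENNReal.ofReal p₁ := by
          refine (measure_union_le _ _).trans (add_le_add (M.samplesLaw_not_accurate_le s hC hr) ?_)
          exact (measure_biUnion_finset_le _ _).trans
            (Finset.sum_le_sum fun k _ => M.samplesLaw_node_not_accurate_le s hC hr k)
      _ = ENNReal.ofReal ((box.card + 1) * p₁) := by
          rw [Finset.sum_const, nsmul_eq_mul, ← ENNReal.ofReal_natCast,
            ← ENNReal.ofReal_mul (Nat.cast_nonneg _), ← ENNReal.ofReal_add hp₁0 (by positivity)]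
          congr 1; ring
      _ ≤ _ := by
          refine ENNReal.ofReal_le_ofReal (le_trans ?_ hp)
          gcongr
          exact card_gridBox_le s hR
  rw [gridOracle_apply, lintegral_map (by fun_prop) hm]
  refine lintegral_ofReal_le_of_bad _ (by positivity) hV.le hp0 ?_ (ae_of_all _ fun ξ => ?_) hbad
  · filter_upwards [M.ae_samplesLaw_step s hinc] with ξ hξ hgood
    have h1 : M.AccurateSamples s ξ.2 r := by
      by_contra hcon
      exact hgood (Or.inl hcon)
    refine norm_gridQ_sub_optQ_le hC hε hζ hLip hr hH hξ.1 hξ.2 hν' (fun k hk => ?_) h1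
    by_contra hcon
    exact hgood (Or.inr (mem_iUnion₂.2 ⟨k, hk, hcon⟩))
  · refine (M.norm_backup_sub_optQ_le hC s fun j => M.gridValue_mem_Icc hC ε s ξ _ _).trans ?_
    nlinarith [M.γ_lt_one]

end Random

/-- The factor in the number of samples for increments of norm at most `ν'`. -/
def gridFactor (d : ℕ) (ν' : ℝ) : ℝ := 1 + d * Real.log (4 * |ν'| + 6) / Real.log 2

lemma one_le_gridFactor (d : ℕ) (ν' : ℝ) : 1 ≤ gridFactor d ν' := by
  have h1 : 0 ≤ Real.log (4 * |ν'| + 6) := Real.log_nonneg (by linarith [abs_nonneg ν'])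
  have h2 : 0 < Real.log 2 := Real.log_pos one_lt_two
  unfold gridFactor
  have : 0 ≤ d * Real.log (4 * |ν'| + 6) / Real.log 2 := by positivity
  linarith

/-- The expected error of the oracle on the grid. -/
theorem gridOracle_accuracy (hd : 1 ≤ d) {ν' : ℝ} (hν' : 0 ≤ ν')
    (hinc : ∀ s a, ∀ᵐ s' ∂(M.P (s, a)), ‖s' - s‖ ≤ ν') {ζ : ℝ} (hζ : 0 < ζ)
    (hLip : ∀ s s', |M.optValue s - M.optValue s'| ≤ ζ * ‖s - s'‖) {δ : ℝ} (hδ0 : 0 < δ)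
    (hδ1 : δ ≤ 1) {C : ℕ} (hC : 0 < C) (hCδ : gridFactor d ν' * M.gridC ζ δ ≤ C)
    (s : EuclideanSpace ℝ (Fin d)) :
    ∫⁻ q, ENNReal.ofReal ‖q - M.optQ s‖ ∂(M.gridOracle C (M.gridSize ζ δ) (M.depth δ) s) ≤
      ENNReal.ofReal (4 * δ * M.Vmax) := by
  have hV := M.Vmax_pos
  have hγ := M.γ_pos
  have hγ1 : 0 < 1 - M.γ := sub_pos.2 M.γ_lt_one
  have hA : (1 : ℝ) ≤ Fintype.card A := by exact_mod_cast Fintype.card_pos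
  have hdpos : (0 : ℝ) < Real.sqrt d := Real.sqrt_pos.2 (by exact_mod_cast hd)
  set ε := M.gridSize ζ δ with hε
  have hεpos : 0 < ε := by rw [hε]; unfold gridSize; positivity
  have hεd : ζ * (ε * Real.sqrt d / 2) = δ * M.Vmax * (1 - M.γ) / (4 * M.γ) := by
    rw [hε]; unfold gridSize; field_simp; norm_num
  set H := M.depth δ with hH
  have hH1 : (1 : ℝ) ≤ H := by exact_mod_cast M.depth_pos δ
  set r := δ * M.Vmax * (1 - M.γ) / M.γ with hr
  have hr0 : 0 ≤ r := by positivity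
  set κ := 4 * |ν'| + 6 with hκ
  have hκ6 : 6 ≤ κ := by linarith [abs_nonneg ν']
  set x := max 1 (1 / ε) with hx
  have hx1 : 1 ≤ x := le_max_left _ _
  have hlogx : max 0 (Real.log (1 / ε)) = Real.log x := by
    rcases le_total 1 (1 / ε) with h | h
    · rw [hx, max_eq_right h, max_eq_right (Real.log_nonneg h)]
    · rw [hx, max_eq_left h, Real.log_one, max_eq_left (Real.log_nonpos (by positivity) h)]
  set lam := Real.log (2 * Fintype.card A / δ) + d * Real.log H + d * Real.log x with hlam
  have hlog2 : 0 < Real.log 2 := Real.log_pos one_lt_two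
  have hratio : 2 ≤ 2 * (Fintype.card A : ℝ) / δ := by
    rw [le_div_iff₀ hδ0]; nlinarith
  have hlam2 : Real.log 2 ≤ lam := by
    have h1 : Real.log 2 ≤ Real.log (2 * Fintype.card A / δ) := Real.log_le_log (by norm_num) hratio
    have h2 : 0 ≤ d * Real.log H := mul_nonneg (Nat.cast_nonneg _) (Real.log_nonneg hH1)
    have h3 : 0 ≤ d * Real.log x := mul_nonneg (Nat.cast_nonneg _) (Real.log_nonneg hx1)
    linarith
  -- Since `lam ≥ log 2`, the constant `d log κ` can be absorbed into a multiple of `lam`; this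
  -- dictates the form of `gridFactor`.
  have hfac : lam + d * Real.log κ ≤ gridFactor d ν' * lam := by
    unfold gridFactor
    rw [← hκ, add_mul, one_mul]
    have h1 : 0 ≤ d * Real.log κ / Real.log 2 := by
      have : 0 ≤ Real.log κ := Real.log_nonneg (by linarith)
      positivity
    have h2 := mul_le_mul_of_nonneg_left hlam2 h1
    rw [div_mul_cancel₀ _ hlog2.ne'] at h2
    linarith
  have hexp : lam + d * Real.log κ ≤ 2 * C * r ^ 2 / M.Vmax ^ 2 := by
    have h1 : M.gridC ζ δ = M.γ ^ 2 / ((1 - M.γ) ^ 2 * δ ^ 2) * lam := by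
      unfold gridC
      rw [← hε, ← hH, hlogx]
    rw [h1] at hCδ
    have h2 : 2 * C * r ^ 2 / M.Vmax ^ 2 = 2 * (C * ((1 - M.γ) ^ 2 * δ ^ 2 / M.γ ^ 2)) := by
      rw [hr]; field_simp
    have h3 : gridFactor d ν' * lam ≤ C * ((1 - M.γ) ^ 2 * δ ^ 2 / M.γ ^ 2) := by
      calc _ = gridFactor d ν' * (M.γ ^ 2 / ((1 - M.γ) ^ 2 * δ ^ 2) * lam) *
            ((1 - M.γ) ^ 2 * δ ^ 2 / M.γ ^ 2) := by field_simp
        _ ≤ _ := mul_le_mul_of_nonneg_right hCδ (by positivity)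
    have h4 : 0 ≤ gridFactor d ν' * lam :=
      mul_nonneg (by linarith [one_le_gridFactor d ν']) (by linarith)
    rw [h2]
    linarith
  have hp : ((2 * (H * (ν' / ε + 1)) + 1) ^ d + 1) *
      (2 * Fintype.card A * Real.exp (-(2 * C * r ^ 2 / M.Vmax ^ 2))) ≤ δ := by
    -- With `x = max 1 (1 / ε)` one has `4 (ν' / ε + 1) + 2 ≤ (4 ν' + 6) x`, which is where `κ`
    -- comes from.
    have hbase : 4 * (H * (ν' / ε + 1)) + 2 ≤ H * x * κ := by
      have h1 : ν' / ε ≤ ν' * x := by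
        rw [div_eq_mul_one_div]
        exact mul_le_mul_of_nonneg_left (le_max_right _ _) hν'
      have h2 : 4 * (ν' / ε + 1) + 2 ≤ x * κ := by
        rw [hκ, abs_of_nonneg hν']
        nlinarith
      calc 4 * (H * (ν' / ε + 1)) + 2 ≤ H * (4 * (ν' / ε + 1) + 2) := by nlinarith
        _ ≤ H * (x * κ) := mul_le_mul_of_nonneg_left h2 (by linarith)
        _ = _ := by ring
    have hy : 1 ≤ 2 * (H * (ν' / ε + 1)) + 1 := by
      have : 0 ≤ H * (ν' / ε + 1) := by positivity
      linarith
    have hcard : (2 * (H * (ν' / ε + 1)) + 1) ^ d + 1 ≤ (H * x * κ) ^ d := by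
      calc _ ≤ 2 * (2 * (H * (ν' / ε + 1)) + 1) ^ d := by linarith [one_le_pow₀ hy (n := d)]
        -- `2 ≤ 2 ^ d` requires `d ≥ 1`.
        _ ≤ 2 ^ d * (2 * (H * (ν' / ε + 1)) + 1) ^ d := by
            gcongr
            exact le_self_pow₀ (by norm_num) (by omega)
        _ = (4 * (H * (ν' / ε + 1)) + 2) ^ d := by rw [← mul_pow]; congr 1; ring
        _ ≤ _ := by gcongr
    have hpos : 0 < H * x * κ := by positivity
    calc _ ≤ (H * x * κ) ^ d * (2 * Fintype.card A * Real.exp (-(lam + d * Real.log κ))) := by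
          gcongr
      _ = δ := by
          have h1 : lam + d * Real.log κ =
              Real.log (2 * Fintype.card A / δ) + d * Real.log (H * x * κ) := by
            rw [Real.log_mul (by positivity) (by positivity),
              Real.log_mul (by positivity) (by positivity), hlam]
            ring
          rw [h1, ← Real.log_pow, ← Real.log_mul (by positivity) (by positivity), Real.exp_neg,
            Real.exp_log (by positivity)]
          field_simp
  refine (M.lintegral_gridOracle_le s hC hεpos hζ.le hLip hr0 (M.depth_pos δ) hν' hinc hp).trans
    (ENNReal.ofReal_le_ofReal ?_)
  -- Sampling contributes `δ Vmax` and rounding `δ Vmax / 4`; truncation and the bad event add at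
  -- most `δ Vmax` each, in total at most `13/4 δ Vmax`.
  have h1 : M.γ / (1 - M.γ) * (r + ζ * (ε * Real.sqrt d / 2)) = 5 / 4 * (δ * M.Vmax) := by
    rw [hεd, hr]; field_simp; norm_num
  rw [h1]
  have h2 := mul_le_mul_of_nonneg_right (M.pow_depth_le hδ0) hV.le
  have h3 : 0 < δ * M.Vmax := by positivity
  linarith

end MDP

lemma exists_seminorm_le {d : ℕ} (N : Seminorm ℝ (EuclideanSpace ℝ (Fin d))) :
    ∃ c, 0 < c ∧ ∀ x, N x ≤ c * ‖x‖ :=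
  Seminorm.bound_of_continuous_normedSpace N
    (continuousOn_univ.1 (N.convexOn.continuousOn isOpen_univ))

lemma exists_lt_norm_of_not_isBounded {E : Type*} [NormedAddCommGroup E] {S : Set E}
    (hS : ¬ Bornology.IsBounded S) (r : ℝ) : ∃ s : S, r < ‖(s : E)‖ := by
  by_contra hcon
  push Not at hcon
  exact hS (isBounded_iff_forall_norm_le.2 ⟨r, fun x hx => hcon ⟨x, hx⟩⟩)

end AdaptiveRL

end

/-! ### The theorem for both oracles -/

theorem theorem3 {d : ℕ} {A : Type*} [Fintype A] [Nonempty A] [MeasurableSpace A]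
    [DiscreteMeasurableSpace A] :
    (∀ (S : Set (EuclideanSpace ℝ (Fin d))), ¬ Bornology.IsBounded S →
      ∀ (M : AdaptiveRL.MDP S A), 0 < M.minGap →
      ∀ (L : S → ℝ) (ν ν' B α : ℝ), M.IsLyapunov Subtype.val L ν ν' B α →
      ∀ c₁ c₂ : ℝ, 0 < c₁ →
        (∀ s : S, c₁ * ‖(s : EuclideanSpace ℝ (Fin d))‖ + c₂ ≤ L s) →
      ∀ C : ℝ → ℕ, (∀ δ ∈ Set.Ioc (0 : ℝ) 1, 0 < C δ ∧ M.sparseC δ ≤ C δ) →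
      ∀ N : Seminorm ℝ (EuclideanSpace ℝ (Fin d)), (∀ x, N x = 0 → x = 0) →
      ∃ K : ℝ, ∀ s₀ : S,
        M.AdaptiveGuarantee Subtype.val
          (fun k => M.sparseOracle (C (AdaptiveRL.dyadic k)) (M.depth (AdaptiveRL.dyadic k)))
          ((AdaptiveRL.measurable_seminorm N).comp measurable_subtype_coe)
          (M.deltaThreshold ν α) K s₀) ∧
    (1 ≤ d → ∀ γ Rmax ν' : ℝ, ∃ c₀ : ℝ, 0 < c₀ ∧
      ∀ (M : AdaptiveRL.MDP (EuclideanSpace ℝ (Fin d)) A), M.γ = γ → M.Rmax = Rmax →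
        0 < M.minGap →
      ∀ (L : EuclideanSpace ℝ (Fin d) → ℝ) (ν B α : ℝ), M.IsLyapunov id L ν ν' B α →
      ∀ ζ : ℝ, 0 < ζ → (∀ s s', |M.optValue s - M.optValue s'| ≤ ζ * ‖s - s'‖) →
      ∀ c₁ c₂ : ℝ, 0 < c₁ → (∀ s, c₁ * ‖s‖ + c₂ ≤ L s) →
      ∀ C : ℝ → ℕ, (∀ δ ∈ Set.Ioc (0 : ℝ) 1, 0 < C δ ∧ c₀ * M.gridC ζ δ ≤ C δ) →
      ∀ N : Seminorm ℝ (EuclideanSpace ℝ (Fin d)), (∀ x, N x = 0 → x = 0) →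
      ∃ K : ℝ, ∀ s₀ : EuclideanSpace ℝ (Fin d),
        M.AdaptiveGuarantee id
          (fun k => M.gridOracle (C (AdaptiveRL.dyadic k))
            (M.gridSize ζ (AdaptiveRL.dyadic k)) (M.depth (AdaptiveRL.dyadic k)))
          (AdaptiveRL.measurable_seminorm N) (M.deltaThreshold ν α) K s₀) := by
  refine ⟨?_, ?_⟩
  · intro S hS M hgap L ν ν' B α hL c₁ c₂ hc₁ hlin C hC N _
    obtain ⟨cN, hcN, hN⟩ := AdaptiveRL.exists_seminorm_le N
    refine ⟨1, fun s₀ => hL.adaptiveGuarantee _ _ hgap (fun k s => ?_) hc₁ hcN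
      (AdaptiveRL.exists_lt_norm_of_not_isBounded hS) hlin (fun s => hN s) s₀⟩
    have hk := hC _ ⟨AdaptiveRL.dyadic_pos k, AdaptiveRL.dyadic_le_one k⟩
    exact M.sparseOracle_accuracy (AdaptiveRL.dyadic_pos k) (AdaptiveRL.dyadic_le_one k)
      hk.1 hk.2 s
  · intro hd γ Rmax ν'
    -- The constant is fixed before the process is given, so it may involve only `d` and `ν'`; the
    -- absolute value in `gridFactor` makes it positive for every real `ν'`.
    refine ⟨AdaptiveRL.MDP.gridFactor d ν',
      one_pos.trans_le (AdaptiveRL.MDP.one_le_gridFactor d ν'), ?_⟩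
    intro M _ _ hgap L ν B α hL ζ hζ hLip c₁ c₂ hc₁ hlin C hC N _
    obtain ⟨cN, hcN, hN⟩ := AdaptiveRL.exists_seminorm_le N
    -- With `d ≥ 1` the space is nontrivial, so it contains vectors of arbitrarily large norm.
    have : Nonempty (Fin d) := ⟨⟨0, hd⟩⟩
    refine ⟨1, fun s₀ => hL.adaptiveGuarantee _ _ hgap (fun k s => ?_) hc₁ hcN
      (fun r => NormedSpace.exists_lt_norm ℝ _ r) hlin hN s₀⟩
    have hk := hC _ ⟨AdaptiveRL.dyadic_pos k, AdaptiveRL.dyadic_le_one k⟩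
    exact M.gridOracle_accuracy hd hL.ν'_pos.le
      (fun s a => (hL.increment s a).mono fun s' h => h.2) hζ hLip (AdaptiveRL.dyadic_pos k)
      (AdaptiveRL.dyadic_le_one k) hk.1 hk.2 s
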